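/- Theorem 2.2. Let $\epsilon>0$, let $u_0,\rho_0:(0,\infty)\to\mathbb R$ be functions of bounded variation, let $u_B\in\mathbb R$ be a constant and let $\rho_B:(0,\infty)\to\mathbb R$ be Lipschitz continuous. Put $U_0(x)=\int_0^x u_0(s)\,ds$ and $R_0(x)=\int_0^x\rho_0(s)\,ds$. (i) There is a unique classical solution $p$ of $$p_t=\tfrac{\epsilon}{2}p_{xx}\ (x,t>0),\qquad p(x,0)=e^{-U_0(x)/\epsilon}\ (x>0),\qquad \epsilon p_x(0,t)+u_B\,p(0,t)=0\ (t>0),$$ and a unique classical solution $q$ of $$q_t=\tfrac{\epsilon}{2}q_{xx}\ (x,t>0),\qquad q(x,0)=R_0(x)e^{-U_0(x)/\epsilon}\ (x>0),\qquad \epsilon q_x(0,t)+u_B\,q(0,t)=\epsilon\,p(0,t)\rho_B(t)\ (t>0).$$ Here a classical solution is a function that is continuous on $[0,\infty)\times[0,\infty)$, has continuous derivatives $\partial_t,\partial_x,\partial_{xx}$ in $\{x>0,t>0\}$, has a first $x$-derivative (one-sided at $x=0$) that is continuous on $[0,\infty)\times(0,\infty)$, and for each $T>0$ is bounded by $Me^{Mx^2}$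 on $[0,\infty)\times[0,T]$ for some $M$. Moreover $p$ and $q$ are $C^\infty$ in $\{x>0,t>0\}$, and $p>0$ for all $x\ge0$, $t\ge0$. (ii) The functions $$u=-\epsilon\,\frac{p_x}{p},\qquad \rho=\Big(\frac qp\Big)_x$$ are $C^\infty$ in $\{x>0,t>0\}$, and $(u,\rho)$ is the unique classical solution of the modified adhesion system $$u_t+\Big(\frac{u^2}{2}\Big)_x=\frac{\epsilon}{2}u_{xx},\qquad \rho_t+(\rho u)_x=\frac{\epsilon}{2}\rho_{xx}\qquad(x>0,\ t>0)$$ with initial conditions $u(x,0)=u_0(x)$, $\rho(x,0)=\rho_0(x)$, $x>0$, and boundary conditions $u(0,t)=u_B$, $\rho(0,t)=\rho_B(t)$, $t>0$. Here a classical solution is a pair of functions continuous on $[0,\infty)\times(0,\infty)$ with continuous derivatives $\partial_t,\partial_x,\partial_{xx}$ in $\{x>0,t>0\}$ such that, for each $T>0$, on $[0,\infty)\times(0,T]$ the function $u$ is bounded and $|\rho|\le Me^{Mx^2}$ for some $M$. It satisfies the equations in $\{x>0,t>0\}$ and the boundary conditions pointwise, and the initial conditions in the sense that $u(y,t)\to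 u_0(x)$ as $(y,t)\to(x,0)$, $y,t>0$, at every $x>0$ where $u_0$ is continuous, and $\rho(y,t)\to\rho_0(x)$ at every $x>0$ where $\rho_0$ is continuous. -/

import Mathlib

open Set Filter Topology MeasureTheory
open scoped ContDiff

namespace Adhesion

/-- Space derivative `f_x (x, t)` of a function on the half-line `x ≥ 0`: the usual partial
derivative for `x > 0`, the one-sided (right) derivative at `x = 0`. -/
noncomputable def dx (f : ℝ → ℝ → ℝ) (x t : ℝ) : ℝ :=
  derivWithin (fun y => f y t) (Ici 0) x

/-- Time derivative `f_t (x, t)`; only used for `t > 0`. -/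
noncomputable def dt (f : ℝ → ℝ → ℝ) (x t : ℝ) : ℝ :=
  deriv (fun s => f x s) t

/-- The open quarter plane `x > 0`, `t > 0`. -/
def quarter : Set (ℝ × ℝ) := Ioi 0 ×ˢ Ioi 0

/-- `f` is of class `C^{2,1}` in the open quarter plane: `f_t`, `f_x`, `f_xx` exist there and
are continuous. -/
structure IsC21 (f : ℝ → ℝ → ℝ) : Prop where
  diff_t : ∀ x > 0, ∀ t > 0, DifferentiableAt ℝ (fun s => f x s) t
  diff_x : ∀ x > 0, ∀ t > 0, DifferentiableAt ℝ (fun y => f y t) x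
  diff_xx : ∀ x > 0, ∀ t > 0, DifferentiableAt ℝ (fun y => dx f y t) x
  cont_t : ContinuousOn (fun z : ℝ × ℝ => dt f z.1 z.2) quarter
  cont_x : ContinuousOn (fun z : ℝ × ℝ => dx f z.1 z.2) quarter
  cont_xx : ContinuousOn (fun z : ℝ × ℝ => dx (dx f) z.1 z.2) quarter

/-- `f` is `C^∞` in the open quarter plane. -/
def IsSmooth (f : ℝ → ℝ → ℝ) : Prop :=
  ContDiffOn ℝ ∞ (fun z : ℝ × ℝ => f z.1 z.2) quarter

/-- The primitive `x ↦ ∫₀ˣ f(s) ds`. -/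
noncomputable def primitive (f : ℝ → ℝ) (x : ℝ) : ℝ := ∫ s in (0 : ℝ)..x, f s

/-- Classical solutions `p` of the heat equation `p_t = (ε/2) p_xx` in `x > 0`, `t > 0`, with
initial values `p(x,0) = g(x)` and boundary condition `ε p_x(0,t) + b p(0,t) = h(t)`, in the
usual uniqueness class of functions of at most Gaussian growth in `x`, locally uniformly in
`t`. -/
structure IsRobinHeatSolution (ε b : ℝ) (g h : ℝ → ℝ) (p : ℝ → ℝ → ℝ) : Prop where
  /-- `p` is continuous up to the initial line, the boundary and the corner. -/
  cont : ContinuousOn (fun z : ℝ × ℝ => p z.1 z.2) (Ici 0 ×ˢ Ici 0)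
  /-- `p_x` exists and is continuous up to the boundary `x = 0`, for `t > 0`. -/
  diff_bdry : ∀ t > 0, DifferentiableWithinAt ℝ (fun y => p y t) (Ici 0) 0
  cont_x_bdry : ContinuousOn (fun z : ℝ × ℝ => dx p z.1 z.2) (Ici 0 ×ˢ Ioi 0)
  c21 : IsC21 p
  heat : ∀ x > 0, ∀ t > 0, dt p x t = ε / 2 * dx (dx p) x t
  init : ∀ x > 0, p x 0 = g x
  bdry : ∀ t > 0, ε * dx p 0 t + b * p 0 t = h t
  growth : ∀ T > 0, ∃ M : ℝ, ∀ x ≥ 0, ∀ t ∈ Icc 0 T, |p x t| ≤ M * Real.exp (M * x ^ 2)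

/-- Classical solutions `(u, ρ)` of the modified adhesion system
`u_t + (u²/2)_x = (ε/2) u_xx`, `ρ_t + (ρ u)_x = (ε/2) ρ_xx` in `x > 0`, `t > 0`, with initial
data `u₀, ρ₀` and Dirichlet boundary data `uB, ρB` at `x = 0`.
The initial data are allowed to jump; their values are attained at each continuity point.
As usual for problems on an unbounded domain, growth conditions are part of the notion. -/
structure IsAdhesionSolution (ε : ℝ) (u₀ ρ₀ uB ρB : ℝ → ℝ) (u ρ : ℝ → ℝ → ℝ) : Prop where
  u_c21 : IsC21 u
  rho_c21 : IsC21 ρ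
  u_eq : ∀ x > 0, ∀ t > 0,
    dt u x t + dx (fun y s => u y s ^ 2 / 2) x t = ε / 2 * dx (dx u) x t
  rho_eq : ∀ x > 0, ∀ t > 0,
    dt ρ x t + dx (fun y s => ρ y s * u y s) x t = ε / 2 * dx (dx ρ) x t
  /-- `u`, `ρ` are continuous up to the boundary `x = 0` for `t > 0`. -/
  u_cont : ContinuousOn (fun z : ℝ × ℝ => u z.1 z.2) (Ici 0 ×ˢ Ioi 0)
  rho_cont : ContinuousOn (fun z : ℝ × ℝ => ρ z.1 z.2) (Ici 0 ×ˢ Ioi 0)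
  u_bdry : ∀ t > 0, u 0 t = uB t
  rho_bdry : ∀ t > 0, ρ 0 t = ρB t
  u_init : ∀ x > 0, ContinuousAt u₀ x →
    Tendsto (fun z : ℝ × ℝ => u z.1 z.2) (𝓝[quarter] (x, 0)) (𝓝 (u₀ x))
  rho_init : ∀ x > 0, ContinuousAt ρ₀ x →
    Tendsto (fun z : ℝ × ℝ => ρ z.1 z.2) (𝓝[quarter] (x, 0)) (𝓝 (ρ₀ x))
  u_bdd : ∀ T > 0, ∃ M : ℝ, ∀ x ≥ 0, ∀ t ∈ Ioc 0 T, |u x t| ≤ M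
  rho_growth : ∀ T > 0, ∃ M : ℝ, ∀ x ≥ 0, ∀ t ∈ Ioc 0 T,
    |ρ x t| ≤ M * Real.exp (M * x ^ 2)

/-- `u = -ε p_x / p`. -/
noncomputable def velocity (ε : ℝ) (p : ℝ → ℝ → ℝ) (x t : ℝ) : ℝ :=
  -ε * (dx p x t / p x t)

/-- `ρ = (q / p)_x`. -/
noncomputable def density (p q : ℝ → ℝ → ℝ) : ℝ → ℝ → ℝ :=
  dx (fun x t => q x t / p x t)

end Adhesion

/-!
The Cole–Hopf transform turns the adhesion system into two linear heat problems on the half-line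
with Robin boundary conditions, and these are solved explicitly enough to read off the behaviour of
`u` and `ρ` at the boundary and at `t = 0`.

*Robin from Dirichlet.* If `p` solves the heat equation, so does `r = p_x + (b/ε) p`, and the Robin
condition for `p` is a Dirichlet condition for `r`. Conversely a Dirichlet solution `r` determines
`p` by integrating a closed form (`exists_robin_of_heatFlow`). The Dirichlet solutions needed are
the heat flow of the odd extension of the initial values (`heatFlow`, `oddExt`) plus, for the
inhomogeneous problem, the double layer potential of the boundary values (`doubleLayer`). Functions
of bounded variation enter only through boundedness, measurability and the countability of their
discontinuities (`HalfLineData`).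

*Uniqueness and positivity.* A maximum principle of Tychonoff type (`heat_nonpos`) gives uniqueness
in the class of Gaussian growth and comparison: `p` dominates the Dirichlet heat flow of its initial
values, so `|r| ≤ C p` (`exists_colehopf`). Hence `p > 0`, `p` decays at most exponentially, and
`u = b - ε r / p` is bounded.

*The adhesion system.* The functions `φ = -ε log p` and `w = q / p` satisfy
`φ_t + φ_x² / 2 = (ε/2) φ_xx` and `w_t + φ_x w_x = (ε/2) w_xx`; the adhesion system consists of the
`x`-derivatives of these equations (`velocity_eq`, `density_eq`). With `s = q_x + (b/ε) q` one has
`ρ = (s - (q/p) r) / p`, which exhibits the boundary values, the growth and the initial values of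
`ρ`, the latter also where `u₀` jumps (`exists_adhesion`).

*Uniqueness for the system.* Any solution `(u, ρ)` has potentials `Φ` and `R` which are continuous
down to `t = 0` (`exists_potential`), and `exp (-Φ / ε)` and `R exp (-Φ / ε)` solve the two Robin
problems. By uniqueness there they equal `p` and `q`, so `u = -ε p_x / p` and `ρ = (q / p)_x`.
-/

namespace Adhesion

/-! ### Partial derivatives on the quarter plane -/

lemma isOpen_quarter : IsOpen quarter := isOpen_Ioi.prod isOpen_Ioi

lemma mem_quarter {x t : ℝ} : (x, t) ∈ quarter ↔ 0 < x ∧ 0 < t := Iff.rfl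

/-- A function of two variables with continuous partial derivatives on an open set is
differentiable there. -/
lemma hasFDerivAt_of_partials {f fx ft : ℝ → ℝ → ℝ} {Ω : Set (ℝ × ℝ)} (hΩ : IsOpen Ω)
    (hx : ∀ z ∈ Ω, HasDerivAt (fun y => f y z.2) (fx z.1 z.2) z.1)
    (ht : ∀ z ∈ Ω, HasDerivAt (fun s => f z.1 s) (ft z.1 z.2) z.2)
    (cx : ContinuousOn (fun z : ℝ × ℝ => fx z.1 z.2) Ω)
    (ct : ContinuousOn (fun z : ℝ × ℝ => ft z.1 z.2) Ω) {z : ℝ × ℝ} (hz : z ∈ Ω) :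
    HasFDerivAt (fun z : ℝ × ℝ => f z.1 z.2)
      (fx z.1 z.2 • ContinuousLinearMap.fst ℝ ℝ ℝ + ft z.1 z.2 • ContinuousLinearMap.snd ℝ ℝ ℝ)
      z := by
  have hn : Ω ∈ 𝓝 z := hΩ.mem_nhds hz
  have h := (hasStrictFDerivAt_uncurry_coprod (𝕜 := ℝ) (u := z) (f := f)
    (f₁ := fun x t => fx x t • ContinuousLinearMap.id ℝ ℝ)
    (f₂ := fun x t => ft x t • ContinuousLinearMap.id ℝ ℝ) ?_ ?_ ?_ ?_).hasFDerivAt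
  · refine h.congr_fderiv ?_
    ext <;> simp [Function.HasUncurry.uncurry]
  · filter_upwards [hn] with v hv
    refine (hx v hv).hasFDerivAt.congr_fderiv ?_
    ext; simp [Function.HasUncurry.uncurry]
  · filter_upwards [hn] with v hv
    refine (ht v hv).hasFDerivAt.congr_fderiv ?_
    ext; simp [Function.HasUncurry.uncurry]
  · exact ((cx.continuousAt hn).smul continuousAt_const)
  · exact ((ct.continuousAt hn).smul continuousAt_const)

lemma contDiffOn_succ_of_partials {f fx ft : ℝ → ℝ → ℝ} {Ω : Set (ℝ × ℝ)} (hΩ : IsOpen Ω)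
    (hx : ∀ z ∈ Ω, HasDerivAt (fun y => f y z.2) (fx z.1 z.2) z.1)
    (ht : ∀ z ∈ Ω, HasDerivAt (fun s => f z.1 s) (ft z.1 z.2) z.2) {n : ℕ}
    (cx : ContDiffOn ℝ n (fun z : ℝ × ℝ => fx z.1 z.2) Ω)
    (ct : ContDiffOn ℝ n (fun z : ℝ × ℝ => ft z.1 z.2) Ω) :
    ContDiffOn ℝ (n + 1) (fun z : ℝ × ℝ => f z.1 z.2) Ω := by
  have hf : ∀ z ∈ Ω, _ := fun z hz =>
    hasFDerivAt_of_partials hΩ hx ht cx.continuousOn ct.continuousOn hz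
  rw [contDiffOn_succ_iff_fderiv_of_isOpen hΩ]
  refine ⟨fun z hz => (hf z hz).differentiableAt.differentiableWithinAt, by simp, ?_⟩
  exact ((cx.smul contDiffOn_const).add (ct.smul contDiffOn_const)).congr
    fun z hz => (hf z hz).fderiv

lemma contDiffOn_infty_of_partials {f fx ft : ℝ → ℝ → ℝ} {Ω : Set (ℝ × ℝ)} (hΩ : IsOpen Ω)
    (hx : ∀ z ∈ Ω, HasDerivAt (fun y => f y z.2) (fx z.1 z.2) z.1)
    (ht : ∀ z ∈ Ω, HasDerivAt (fun s => f z.1 s) (ft z.1 z.2) z.2)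
    (cx : ContDiffOn ℝ ∞ (fun z : ℝ × ℝ => fx z.1 z.2) Ω)
    (ct : ContDiffOn ℝ ∞ (fun z : ℝ × ℝ => ft z.1 z.2) Ω) :
    ContDiffOn ℝ ∞ (fun z : ℝ × ℝ => f z.1 z.2) Ω := by
  rw [contDiffOn_infty] at cx ct ⊢
  intro n
  exact (contDiffOn_succ_of_partials hΩ hx ht (cx n) (ct n)).of_le (by norm_cast; simp)

/-- At a boundary point `x = 0` as well as in the interior, `dx` is the right derivative. -/
lemma dx_eq_of_within {f : ℝ → ℝ → ℝ} {x t d : ℝ} (hx : 0 ≤ x)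
    (h : HasDerivWithinAt (fun y => f y t) d (Ici 0) x) : dx f x t = d :=
  h.derivWithin (uniqueDiffOn_Ici 0 x hx)

lemma dx_eq {f : ℝ → ℝ → ℝ} {x t d : ℝ} (hx : 0 < x)
    (h : HasDerivAt (fun y => f y t) d x) : dx f x t = d :=
  dx_eq_of_within hx.le h.hasDerivWithinAt

lemma dx_eq_deriv {f : ℝ → ℝ → ℝ} {x t : ℝ} (hx : 0 < x) :
    dx f x t = deriv (fun y => f y t) x :=
  derivWithin_of_mem_nhds (Ici_mem_nhds hx)

lemma dx_congr {f g : ℝ → ℝ → ℝ} {t : ℝ} (h : ∀ x ≥ 0, f x t = g x t) {x : ℝ} (hx : 0 ≤ x) :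
    dx f x t = dx g x t :=
  derivWithin_congr (fun y hy => h y hy) (h x hx)

lemma dx_congr_pos {f g : ℝ → ℝ → ℝ} {t : ℝ} (h : ∀ x > 0, f x t = g x t) {x : ℝ} (hx : 0 < x) :
    dx f x t = dx g x t := by
  rw [dx_eq_deriv hx, dx_eq_deriv hx]
  refine EventuallyEq.deriv_eq ?_
  filter_upwards [Ioi_mem_nhds hx] with y hy using h y hy

lemma dt_congr_pos {f g : ℝ → ℝ → ℝ} {x : ℝ} (h : ∀ t > 0, f x t = g x t) {t : ℝ} (ht : 0 < t) :
    dt f x t = dt g x t := by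
  refine EventuallyEq.deriv_eq ?_
  filter_upwards [Ioi_mem_nhds ht] with y hy using h y hy

lemma hasDerivAt_congr_pos {f g : ℝ → ℝ} {d x : ℝ} (h : ∀ y > 0, f y = g y) (hx : 0 < x)
    (hf : HasDerivAt f d x) : HasDerivAt g d x := by
  refine hf.congr_of_eventuallyEq ?_
  filter_upwards [Ioi_mem_nhds hx] with y hy using (h y hy).symm

namespace IsC21

variable {f : ℝ → ℝ → ℝ} {x t : ℝ}

lemma hasDerivAt_t (h : IsC21 f) (hx : 0 < x) (ht : 0 < t) :
    HasDerivAt (fun s => f x s) (dt f x t) t := (h.diff_t x hx t ht).hasDerivAt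

lemma hasDerivAt_x (h : IsC21 f) (hx : 0 < x) (ht : 0 < t) :
    HasDerivAt (fun y => f y t) (dx f x t) x := by
  rw [dx_eq_deriv hx]; exact (h.diff_x x hx t ht).hasDerivAt

lemma hasDerivAt_xx (h : IsC21 f) (hx : 0 < x) (ht : 0 < t) :
    HasDerivAt (fun y => dx f y t) (dx (dx f) x t) x := by
  rw [dx_eq_deriv (f := dx f) hx]; exact (h.diff_xx x hx t ht).hasDerivAt

lemma continuousOn (h : IsC21 f) : ContinuousOn (fun z : ℝ × ℝ => f z.1 z.2) quarter :=
  fun _ hz => (hasFDerivAt_of_partials isOpen_quarter (fun _ hv => h.hasDerivAt_x hv.1 hv.2)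
    (fun _ hv => h.hasDerivAt_t hv.1 hv.2) h.cont_x h.cont_t hz).continuousAt.continuousWithinAt

/-- Build `IsC21` from explicit partial derivatives. -/
lemma of_hasDerivAt {fx fxx ft : ℝ → ℝ → ℝ}
    (hx : ∀ x > 0, ∀ t > 0, HasDerivAt (fun y => f y t) (fx x t) x)
    (hxx : ∀ x > 0, ∀ t > 0, HasDerivAt (fun y => fx y t) (fxx x t) x)
    (ht : ∀ x > 0, ∀ t > 0, HasDerivAt (fun s => f x s) (ft x t) t)
    (cx : ContinuousOn (fun z : ℝ × ℝ => fx z.1 z.2) quarter)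
    (cxx : ContinuousOn (fun z : ℝ × ℝ => fxx z.1 z.2) quarter)
    (ct : ContinuousOn (fun z : ℝ × ℝ => ft z.1 z.2) quarter) : IsC21 f := by
  have e1 : ∀ x > 0, ∀ t > 0, dx f x t = fx x t := fun x h t h' => dx_eq h (hx x h t h')
  have h2 : ∀ x > 0, ∀ t > 0, HasDerivAt (fun y => dx f y t) (fxx x t) x := fun x h t h' =>
    hasDerivAt_congr_pos (fun y hy => (e1 y hy t h').symm) h (hxx x h t h')
  exact
  { diff_t := fun x h t h' => (ht x h t h').differentiableAt
    diff_x := fun x h t h' => (hx x h t h').differentiableAt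
    diff_xx := fun x h t h' => (h2 x h t h').differentiableAt
    cont_t := ct.congr fun z hz => (ht z.1 hz.1 z.2 hz.2).deriv
    cont_x := cx.congr fun z hz => e1 z.1 hz.1 z.2 hz.2
    cont_xx := cxx.congr fun z hz => dx_eq hz.1 (h2 z.1 hz.1 z.2 hz.2) }

lemma dxx_eq {fx : ℝ → ℝ → ℝ} {d : ℝ}
    (h1 : ∀ x > 0, HasDerivAt (fun y => f y t) (fx x t) x) (hx : 0 < x)
    (h2 : HasDerivAt (fun y => fx y t) d x) : dx (dx f) x t = d :=
  dx_eq hx (hasDerivAt_congr_pos (fun y hy => (dx_eq hy (h1 y hy)).symm) hx h2)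

end IsC21

lemma HasFDerivAt.hasDerivAt_fst_line {E : Type*} [NormedAddCommGroup E] [NormedSpace ℝ E]
    {F : ℝ × ℝ → E} {F' : ℝ × ℝ →L[ℝ] E} {x t : ℝ} (h : HasFDerivAt F F' (x, t)) :
    HasDerivAt (fun y => F (y, t)) (F' (1, 0)) x :=
  h.comp_hasDerivAt (f := fun y => (y, t)) x ((hasDerivAt_id x).prodMk (hasDerivAt_const x t))

lemma HasFDerivAt.hasDerivAt_snd_line {E : Type*} [NormedAddCommGroup E] [NormedSpace ℝ E]
    {F : ℝ × ℝ → E} {F' : ℝ × ℝ →L[ℝ] E} {x t : ℝ} (h : HasFDerivAt F F' (x, t)) :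
    HasDerivAt (fun s => F (x, s)) (F' (0, 1)) t :=
  h.comp_hasDerivAt (f := fun s => (x, s)) t ((hasDerivAt_const t x).prodMk (hasDerivAt_id t))

namespace IsSmooth

variable {f g : ℝ → ℝ → ℝ} {x t : ℝ}

lemma contDiffAt (h : IsSmooth f) (hx : 0 < x) (ht : 0 < t) :
    ContDiffAt ℝ ∞ (fun z : ℝ × ℝ => f z.1 z.2) (x, t) :=
  ContDiffOn.contDiffAt h (isOpen_quarter.mem_nhds (mem_quarter.2 ⟨hx, ht⟩))

lemma hasFDerivAt (h : IsSmooth f) (hx : 0 < x) (ht : 0 < t) :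
    HasFDerivAt (fun z : ℝ × ℝ => f z.1 z.2) (fderiv ℝ (fun z : ℝ × ℝ => f z.1 z.2) (x, t))
      (x, t) :=
  ((h.contDiffAt hx ht).differentiableAt (by simp)).hasFDerivAt

lemma dx_eq_fderiv (h : IsSmooth f) (hx : 0 < x) (ht : 0 < t) :
    dx f x t = fderiv ℝ (fun z : ℝ × ℝ => f z.1 z.2) (x, t) (1, 0) :=
  dx_eq hx (HasFDerivAt.hasDerivAt_fst_line (h.hasFDerivAt hx ht))

lemma hasDerivAt_x (h : IsSmooth f) (hx : 0 < x) (ht : 0 < t) :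
    HasDerivAt (fun y => f y t) (dx f x t) x := by
  rw [h.dx_eq_fderiv hx ht]
  exact HasFDerivAt.hasDerivAt_fst_line (h.hasFDerivAt hx ht)

lemma dt_eq_fderiv (h : IsSmooth f) (hx : 0 < x) (ht : 0 < t) :
    dt f x t = fderiv ℝ (fun z : ℝ × ℝ => f z.1 z.2) (x, t) (0, 1) :=
  (HasFDerivAt.hasDerivAt_snd_line (h.hasFDerivAt hx ht)).deriv

lemma hasDerivAt_t (h : IsSmooth f) (hx : 0 < x) (ht : 0 < t) :
    HasDerivAt (fun s => f x s) (dt f x t) t := by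
  rw [h.dt_eq_fderiv hx ht]
  exact HasFDerivAt.hasDerivAt_snd_line (h.hasFDerivAt hx ht)

lemma dx (h : IsSmooth f) : IsSmooth (dx f) :=
  ((h.fderiv_of_isOpen isOpen_quarter (m := ∞) (by simp)).clm_apply contDiffOn_const).congr
    fun _ hz => h.dx_eq_fderiv hz.1 hz.2

lemma dt (h : IsSmooth f) : IsSmooth (dt f) :=
  ((h.fderiv_of_isOpen isOpen_quarter (m := ∞) (by simp)).clm_apply contDiffOn_const).congr
    fun _ hz => h.dt_eq_fderiv hz.1 hz.2

lemma isC21 (h : IsSmooth f) : IsC21 f :=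
  .of_hasDerivAt (fun _ hx _ ht => h.hasDerivAt_x hx ht) (fun _ hx _ ht => h.dx.hasDerivAt_x hx ht)
    (fun _ hx _ ht => h.hasDerivAt_t hx ht) h.dx.continuousOn h.dx.dx.continuousOn
    h.dt.continuousOn

lemma mul (hf : IsSmooth f) (hg : IsSmooth g) : IsSmooth (fun x t => f x t * g x t) :=
  ContDiffOn.mul hf hg

lemma add (hf : IsSmooth f) (hg : IsSmooth g) : IsSmooth (fun x t => f x t + g x t) :=
  ContDiffOn.add hf hg

lemma div (hf : IsSmooth f) (hg : IsSmooth g) (h0 : ∀ x > 0, ∀ t > 0, g x t ≠ 0) :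
    IsSmooth (fun x t => f x t / g x t) :=
  ContDiffOn.div hf hg fun z hz => h0 z.1 hz.1 z.2 hz.2

lemma const_mul (c : ℝ) (hf : IsSmooth f) : IsSmooth (fun x t => c * f x t) :=
  contDiffOn_const.mul hf

/-- The mixed partial derivatives of a smooth function agree. -/
lemma dt_dx (h : IsSmooth f) (hx : 0 < x) (ht : 0 < t) :
    Adhesion.dt (Adhesion.dx f) x t = Adhesion.dx (Adhesion.dt f) x t := by
  have hd : DifferentiableAt ℝ (fderiv ℝ (fun z : ℝ × ℝ => f z.1 z.2)) (x, t) :=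
    (((h.fderiv_of_isOpen isOpen_quarter (m := ∞) (by simp))).contDiffAt
      (isOpen_quarter.mem_nhds (mem_quarter.2 ⟨hx, ht⟩))).differentiableAt (by simp)
  have hs : IsSymmSndFDerivAt ℝ (fun z : ℝ × ℝ => f z.1 z.2) (x, t) :=
    ((contDiffOn_infty.1 h 2).contDiffAt
      (isOpen_quarter.mem_nhds (mem_quarter.2 ⟨hx, ht⟩))).isSymmSndFDerivAt (by simp)
  have h1 := hasDerivAt_congr_pos (fun s hs => (h.dx_eq_fderiv hx hs).symm) ht
    ((HasFDerivAt.hasDerivAt_snd_line hd.hasFDerivAt).clm_apply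
      (hasDerivAt_const t ((1, 0) : ℝ × ℝ)))
  have h2 := hasDerivAt_congr_pos (fun y hy => (h.dt_eq_fderiv hy ht).symm) hx
    ((HasFDerivAt.hasDerivAt_fst_line hd.hasFDerivAt).clm_apply
      (hasDerivAt_const x ((0, 1) : ℝ × ℝ)))
  simp only [map_zero, add_zero] at h1 h2
  rw [dx_eq hx h2, ← hs.eq]
  exact h1.deriv

end IsSmooth

/-! ### A maximum principle of Tychonoff type with mixed boundary conditions -/

lemma nonpos_of_hasDerivWithinAt_Ici_of_max {f : ℝ → ℝ} {a d : ℝ}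
    (hf : HasDerivWithinAt f d (Ici a) a) (hm : ∀ x ≥ a, f x ≤ f a) : d ≤ 0 := by
  have h : IsLocalMaxOn f (Ici a) a := eventually_mem_nhdsWithin.mono fun x hx => hm x hx
  have := h.hasFDerivWithinAt_nonpos hf.hasFDerivWithinAt (y := 1)
    (mem_posTangentConeAt_of_segment_subset (by
      rw [segment_eq_Icc (by linarith)]; exact Icc_subset_Ici_self))
  simpa using this

lemma nonneg_of_hasDerivAt_of_left_max {f : ℝ → ℝ} {σ a d : ℝ} (hσ : σ < a)
    (hf : HasDerivAt f d a) (hm : ∀ x ∈ Ioc σ a, f x ≤ f a) : 0 ≤ d := by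
  have h : IsLocalMaxOn f (Iic a) a := by
    filter_upwards [eventually_mem_nhdsWithin, mem_nhdsWithin_of_mem_nhds (Ioi_mem_nhds hσ)]
      with x hx hx'
    exact hm x ⟨hx', hx⟩
  have := h.hasFDerivWithinAt_nonpos hf.hasDerivWithinAt.hasFDerivWithinAt (y := -1)
    (mem_posTangentConeAt_of_segment_subset (by
      rw [segment_symm, segment_eq_Icc (by linarith)]; exact Icc_subset_Iic_self))
  simpa using this

lemma second_deriv_nonpos_of_isLocalMax {f f' : ℝ → ℝ} {a d : ℝ}
    (hf : ∀ᶠ x in 𝓝 a, HasDerivAt f (f' x) x) (hf' : HasDerivAt f' d a) (hm : IsLocalMax f a) :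
    d ≤ 0 := by
  by_contra! hd
  have e : deriv f =ᶠ[𝓝 a] f' := hf.mono fun x hx => hx.deriv
  have hd2 : deriv (deriv f) a = d := by rw [e.deriv_eq, hf'.deriv]
  have hmin := isLocalMin_of_deriv_deriv_pos (hd2 ▸ hd) hm.deriv_eq_zero
    hf.self_of_nhds.continuousAt
  -- a simultaneous local maximum and minimum forces `f` to be locally constant
  have hc : f =ᶠ[𝓝 a] fun _ => f a := by
    filter_upwards [hm, hmin] with x h1 h2 using le_antisymm h1 h2
  have : deriv (deriv f) a = 0 := by
    rw [hc.deriv.deriv_eq]; simp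
  linarith

/-- The exponent of the barrier `exp (barrierExp ..)` of the maximum principle. -/
noncomputable def barrierExp (M τ a c σ x t : ℝ) : ℝ :=
  (2 * M + 2 * M / τ * (t - σ)) * (x - a) ^ 2 + c * (t - σ)

lemma tendsto_gaussian_tail (M a : ℝ) (hM : 0 < M) :
    Tendsto (fun x => M * Real.exp (2 * M * a ^ 2 - M * (x - 2 * a) ^ 2)) atTop (𝓝 0) := by
  have h1 : Tendsto (fun x : ℝ => M * (x - 2 * a) ^ 2) atTop atTop :=
    ((tendsto_pow_atTop two_ne_zero).comp
      (tendsto_atTop_add_const_right _ (-(2 * a)) tendsto_id)).const_mul_atTop hM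
  have h2 := (Real.tendsto_exp_atBot.comp
    (tendsto_atBot_add_const_left atTop (2 * M * a ^ 2)
      (tendsto_neg_atTop_atBot.comp h1))).const_mul M
  simpa [Function.comp_def, sub_eq_add_neg] using h2

lemma barrier_ineq {ε M τ α Y : ℝ} (hε : 0 < ε) (hM : 0 < M) (hτ0 : 0 < τ)
    (hτ : 16 * ε * M * τ ≤ 1) (hα1 : 2 * M ≤ α) (hα2 : α ≤ 4 * M) (hY : 0 ≤ Y) :
    ε / 2 * (2 * α + 4 * α ^ 2 * Y) < 2 * M / τ * Y + 5 * ε * M := by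
  have hα0 : 0 ≤ α := by linarith
  have h1 : ε * α ≤ ε * (4 * M) := mul_le_mul_of_nonneg_left hα2 hε.le
  have h2 : 2 * ε * α ^ 2 ≤ 2 * M / τ := by
    rw [le_div_iff₀ hτ0]
    calc 2 * ε * α ^ 2 * τ ≤ 2 * ε * (4 * M) ^ 2 * τ := by gcongr
      _ = 2 * M * (16 * ε * M * τ) := by ring
      _ ≤ 2 * M * 1 := by gcongr
      _ = 2 * M := by ring
  have h3 := mul_le_mul_of_nonneg_right h2 hY
  have h4 := mul_pos hε hM
  linarith

set_option maxHeartbeats 800000 in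
/-- The maximum principle on a short time interval `(σ, σ + τ]`: the quotient of `w` and the
barrier `V = exp (barrierExp ..)` has no positive maximum, since `V_t > (ε/2) V_xx` and
`ε V_x + b V < 0` at `x = 0`. -/
lemma heat_nonpos_step {ε b : ℝ} (hε : 0 < ε) {w : ℝ → ℝ → ℝ} (hw : IsC21 w)
    (heat : ∀ x > 0, ∀ t > 0, dt w x t = ε / 2 * dx (dx w) x t)
    (cont : ContinuousOn (fun z : ℝ × ℝ => w z.1 z.2) (Ici 0 ×ˢ Ioi 0))
    (bdry : ∀ t > 0, w 0 t ≤ 0 ∨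
      ∃ d, HasDerivWithinAt (fun y => w y t) d (Ici 0) 0 ∧ 0 ≤ ε * d + b * w 0 t)
    {σ τ T M : ℝ} (hσ : 0 ≤ σ) (hM : 0 < M) (hτ0 : 0 < τ) (hτ : 16 * ε * M * τ ≤ 1)
    (growth : ∀ x ≥ 0, ∀ t ∈ Ioc 0 T, w x t ≤ M * Real.exp (M * x ^ 2))
    (init : ∀ x ≥ 0, ∀ η > 0, ∀ᶠ z in 𝓝[Ici 0 ×ˢ Ioi σ] (x, σ), w z.1 z.2 ≤ η)
    {x₁ t₁ : ℝ} (hx₁ : 0 ≤ x₁) (ht₁ : σ < t₁) (ht₁τ : t₁ ≤ σ + τ) (ht₁T : t₁ ≤ T) :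
    w x₁ t₁ ≤ 0 := by
  by_contra! hpos
  -- `a` makes the boundary condition of the barrier strict
  obtain ⟨a, ha0, ha⟩ : ∃ a > 0, b < 4 * ε * M * a := by
    refine ⟨(|b| + 1) / (4 * ε * M), by positivity, ?_⟩
    rw [mul_div_cancel₀ _ (by positivity)]
    linarith [le_abs_self b]
  -- `c` absorbs `(ε/2) · 2α ≤ 4εM`, the term of `(ε/2) V_xx / V` that does not grow in `x`
  set c : ℝ := 5 * ε * M with hc
  have hc0 : 0 < c := by positivity
  set L : ℝ → ℝ → ℝ := barrierExp M τ a c σ with hL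
  have hLge : ∀ x t, σ ≤ t → 2 * M * (x - a) ^ 2 ≤ L x t := by
    intro x t ht
    have h1 : 0 ≤ 2 * M / τ * (t - σ) := mul_nonneg (by positivity) (by linarith)
    have h2 : 0 ≤ c * (t - σ) := mul_nonneg hc0.le (by linarith)
    simp only [hL, barrierExp]
    nlinarith [mul_nonneg h1 (sq_nonneg (x - a))]
  have hLnn : ∀ x t, σ ≤ t → 0 ≤ L x t := fun x t ht =>
    le_trans (by positivity) (hLge x t ht)
  have hLcont : Continuous fun z : ℝ × ℝ => L z.1 z.2 := by
    simp only [hL, barrierExp]; fun_prop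
  set η := w x₁ t₁ * Real.exp (-L x₁ t₁) with hη
  have hη0 : 0 < η := by positivity
  -- far away the quotient is smaller than its value at `(x₁, t₁)`
  obtain ⟨X, hX1, hX⟩ : ∃ X ≥ x₁, ∀ x ≥ X, ∀ t ∈ Ioc σ t₁, w x t * Real.exp (-L x t) ≤ η := by
    have h := (tendsto_gaussian_tail M a hM).eventually (Iio_mem_nhds hη0)
    obtain ⟨X, hX⟩ := (h.and (eventually_ge_atTop x₁)).exists_forall_of_atTop
    refine ⟨X, (hX X le_rfl).2, fun x hx t ht => ?_⟩
    have h0 : 0 ≤ x := hx₁.trans (hX x hx).2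
    calc w x t * Real.exp (-L x t)
        ≤ (M * Real.exp (M * x ^ 2)) * Real.exp (-(2 * M * (x - a) ^ 2)) := by
          refine mul_le_mul (growth x h0 t ⟨hσ.trans_lt ht.1, ht.2.trans ht₁T⟩)
            (Real.exp_le_exp.2 (neg_le_neg (hLge x t ht.1.le))) (Real.exp_pos _).le (by positivity)
      _ = M * Real.exp (2 * M * a ^ 2 - M * (x - 2 * a) ^ 2) := by
          rw [mul_assoc, ← Real.exp_add]; congr 2; ring
      _ ≤ η := le_of_lt (hX x hx).1
  -- the positive part of the quotient, extended by zero to `t = σ`, is upper semicontinuous by the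
  -- initial condition, so it attains its maximum
  set F : ℝ × ℝ → ℝ := fun z => if z.2 ≤ σ then 0 else max 0 (w z.1 z.2 * Real.exp (-L z.1 z.2))
    with hF
  set K : Set (ℝ × ℝ) := Icc 0 X ×ˢ Icc σ t₁ with hK
  have hKc : IsCompact K := isCompact_Icc.prod isCompact_Icc
  have h1K : (x₁, t₁) ∈ K := ⟨⟨hx₁, hX1⟩, ht₁.le, le_rfl⟩
  have hUSC : UpperSemicontinuousOn F K := by
    rw [upperSemicontinuousOn_iff]
    rintro ⟨x, t⟩ hz
    rcases eq_or_lt_of_le hz.2.1 with h | h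
    · rw [upperSemicontinuousWithinAt_iff]
      intro y hy
      have ht : t = σ := h.symm
      subst ht
      have hy0 : 0 < y := by simpa [hF] using hy
      have hi := eventually_nhdsWithin_iff.1 (init x hz.1.1 (y / 2) (by positivity))
      filter_upwards [mem_nhdsWithin_of_mem_nhds hi, self_mem_nhdsWithin] with z hz1 hz2
      by_cases hzt : z.2 ≤ t
      · simpa [hF, hzt] using hy0
      · push Not at hzt
        have hwz := hz1 ⟨hz2.1.1, hzt⟩
        have he : Real.exp (-L z.1 z.2) ≤ 1 :=
          Real.exp_le_one_iff.2 (by linarith [hLnn z.1 z.2 hzt.le])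
        have he0 := Real.exp_pos (-L z.1 z.2)
        simp only [hF, hzt.not_ge, if_false]
        refine max_lt hy0 ?_
        nlinarith
    · refine ContinuousWithinAt.upperSemicontinuousWithinAt ?_
      have hc1 : ContinuousWithinAt
          (fun z : ℝ × ℝ => max 0 (w z.1 z.2 * Real.exp (-L z.1 z.2)))
          (K ∩ {z | σ < z.2}) (x, t) := by
        have h1 : ContinuousWithinAt (fun z : ℝ × ℝ => w z.1 z.2) (K ∩ {z | σ < z.2}) (x, t) :=
          (cont (x, t) ⟨hz.1.1, hσ.trans_lt h⟩).mono fun z hz => ⟨hz.1.1.1, hσ.trans_lt hz.2⟩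
        exact continuousWithinAt_const.max
          (h1.mul (Real.continuous_exp.comp hLcont.neg).continuousWithinAt)
      have hn : {z : ℝ × ℝ | σ < z.2} ∈ 𝓝 (x, t) :=
        (isOpen_lt continuous_const continuous_snd).mem_nhds h
      rw [continuousWithinAt_inter hn] at hc1
      refine hc1.congr_of_eventuallyEq ?_ (by simp [hF, h.not_ge])
      filter_upwards [mem_nhdsWithin_of_mem_nhds hn] with z hz
      have : ¬ z.2 ≤ σ := not_le.2 hz
      simp [hF, this]
  obtain ⟨⟨x, t⟩, hzK, hmax⟩ := hUSC.exists_isMaxOn ⟨_, h1K⟩ hKc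
  have hF1 : F (x₁, t₁) = η := by
    simp only [hF, ht₁.not_ge, if_false]
    exact max_eq_right hη0.le
  have hFη : η ≤ F (x, t) := hF1 ▸ hmax h1K
  have hσt : σ < t := by
    by_contra! h
    have : F (x, t) = 0 := by simp [hF, h]
    linarith
  have ht0 : 0 < t := hσ.trans_lt hσt
  set m := w x t * Real.exp (-L x t) with hm
  have hFm : F (x, t) = m := by
    have : F (x, t) = max 0 m := by simp [hF, hσt.not_ge, hm]
    rw [this]
    refine max_eq_right ?_
    by_contra! h
    rw [this, max_eq_left h.le] at hFη
    linarith
  have hmη : η ≤ m := hFm ▸ hFη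
  have hm0 : 0 < m := by linarith
  have hle : ∀ y ≥ 0, ∀ s ∈ Ioc σ t₁, w y s - m * Real.exp (L y s) ≤ 0 := by
    intro y hy s hs
    have h1 : w y s * Real.exp (-L y s) ≤ m := by
      rcases le_total y X with h | h
      · have h2 := hmax (show (y, s) ∈ K from ⟨⟨hy, h⟩, hs.1.le, hs.2⟩)
        rw [mem_ofPred_eq, hFm] at h2
        refine le_trans ?_ h2
        simp [hF, hs.1.not_ge]
      · exact (hX y h s hs).trans hmη
    rw [Real.exp_neg, ← div_eq_mul_inv, div_le_iff₀ (Real.exp_pos _)] at h1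
    linarith
  have hwm : w x t = m * Real.exp (L x t) := by
    rw [hm, mul_assoc, ← Real.exp_add]; simp
  have hts : t ∈ Ioc σ t₁ := ⟨hσt, hzK.2.2⟩
  set α := 2 * M + 2 * M / τ * (t - σ) with hα
  have hα1 : 2 * M ≤ α := by
    have : 0 ≤ 2 * M / τ * (t - σ) := mul_nonneg (by positivity) (by linarith)
    linarith
  have hα2 : α ≤ 4 * M := by
    have h1 : t - σ ≤ τ := by linarith [hzK.2.2]
    have : 2 * M / τ * (t - σ) ≤ 2 * M / τ * τ := by gcongr
    rw [div_mul_cancel₀ _ hτ0.ne'] at this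
    linarith
  have hV := Real.exp_pos (L x t)
  have hLx : ∀ y, HasDerivAt (fun y => Real.exp (L y t))
      (2 * α * (y - a) * Real.exp (L y t)) y := by
    intro y
    have h : HasDerivAt (fun y => L y t) (α * (2 * (y - a))) y := by
      have := ((((hasDerivAt_id y).sub_const a).pow 2).const_mul α).add_const (c * (t - σ))
      simpa [hL, barrierExp] using this
    exact h.exp.congr_deriv (by ring)
  rcases eq_or_lt_of_le hzK.1.1 with h0 | h0
  · -- the maximum is on the boundary
    simp only at h0
    subst h0
    rcases bdry t ht0 with h | ⟨d, hd, hdb⟩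
    · rw [hwm] at h
      have := mul_pos hm0 hV
      linarith
    · have h1 := hd.sub ((hLx 0).const_mul m).hasDerivWithinAt
      have h2 := nonpos_of_hasDerivWithinAt_Ici_of_max h1 (by
        intro y hy
        have := hle y hy t hts
        simpa [hwm] using this)
      rw [hwm] at hdb
      have h3 : b < 2 * ε * α * a := by
        have : 4 * ε * M * a ≤ 2 * ε * α * a := by nlinarith [mul_pos hε ha0]
        linarith
      have h4 : d ≤ m * (2 * α * (0 - a) * Real.exp (L 0 t)) := by linarith
      have h5 : ε * d ≤ ε * (m * (2 * α * (0 - a) * Real.exp (L 0 t))) := by gcongr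
      nlinarith [mul_pos hm0 hV]
  · -- the maximum is in the interior
    have hx0 : 0 < x := h0
    have hLxx : HasDerivAt (fun y => 2 * α * (y - a) * Real.exp (L y t))
        ((2 * α + 4 * α ^ 2 * (x - a) ^ 2) * Real.exp (L x t)) x := by
      have := (((hasDerivAt_id x).sub_const a).const_mul (2 * α)).mul (hLx x)
      exact this.congr_deriv (by simp; ring)
    have hLt : HasDerivAt (fun s => Real.exp (L x s))
        ((2 * M / τ * (x - a) ^ 2 + c) * Real.exp (L x t)) t := by
      have h : HasDerivAt (fun s => L x s) (2 * M / τ * (x - a) ^ 2 + c) t := by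
        have h1 := (((((hasDerivAt_id t).sub_const σ).const_mul (2 * M / τ)).const_add
          (2 * M)).mul_const ((x - a) ^ 2)).add (((hasDerivAt_id t).sub_const σ).const_mul c)
        simpa [hL, barrierExp, Pi.add_def] using h1
      exact h.exp.congr_deriv (by ring)
    have htime := nonneg_of_hasDerivAt_of_left_max hσt
      ((hw.hasDerivAt_t hx0 ht0).sub (hLt.const_mul m)) (by
        intro s hs
        have := hle x hx0.le s ⟨hs.1, hs.2.trans hts.2⟩
        simpa [hwm] using this)
    have hspace := second_deriv_nonpos_of_isLocalMax
      (f := fun y => w y t - m * Real.exp (L y t))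
      (f' := fun y => dx w y t - m * (2 * α * (y - a) * Real.exp (L y t))) (a := x) (by
        filter_upwards [Ioi_mem_nhds hx0] with y hy
        exact (hw.hasDerivAt_x hy ht0).sub ((hLx y).const_mul m))
      ((hw.hasDerivAt_xx hx0 ht0).sub (hLxx.const_mul m)) (by
        filter_upwards [Ioi_mem_nhds hx0] with y hy
        have := hle y (le_of_lt hy) t hts
        simpa [hwm] using this)
    rw [heat x hx0 t ht0] at htime
    have hkey : ε / 2 * (2 * α + 4 * α ^ 2 * (x - a) ^ 2) < 2 * M / τ * (x - a) ^ 2 + c :=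
      barrier_ineq hε hM hτ0 hτ hα1 hα2 (sq_nonneg _)
    have h3 : dx (dx w) x t ≤ m * ((2 * α + 4 * α ^ 2 * (x - a) ^ 2) * Real.exp (L x t)) := by
      linarith
    have h4 := mul_lt_mul_of_pos_right hkey (mul_pos hm0 hV)
    have h5 : ε / 2 * dx (dx w) x t ≤
      ε / 2 * (m * ((2 * α + 4 * α ^ 2 * (x - a) ^ 2) * Real.exp (L x t))) := by gcongr
    linarith

/-- Maximum principle: a solution of the heat equation in the quarter plane which has Gaussian
growth, nonpositive initial values and, at every boundary point, is nonpositive or satisfies the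
Robin inequality `ε w_x + b w ≥ 0`, is nonpositive. -/
theorem heat_nonpos {ε b : ℝ} (hε : 0 < ε) {w : ℝ → ℝ → ℝ} (hw : IsC21 w)
    (heat : ∀ x > 0, ∀ t > 0, dt w x t = ε / 2 * dx (dx w) x t)
    (cont : ContinuousOn (fun z : ℝ × ℝ => w z.1 z.2) (Ici 0 ×ˢ Ioi 0))
    (bdry : ∀ t > 0, w 0 t ≤ 0 ∨
      ∃ d, HasDerivWithinAt (fun y => w y t) d (Ici 0) 0 ∧ 0 ≤ ε * d + b * w 0 t)
    (growth : ∀ T > 0, ∃ M : ℝ, ∀ x ≥ 0, ∀ t ∈ Ioc 0 T, w x t ≤ M * Real.exp (M * x ^ 2))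
    (init : ∀ x ≥ 0, ∀ η > 0, ∀ᶠ z in 𝓝[Ici 0 ×ˢ Ioi 0] (x, (0 : ℝ)), w z.1 z.2 ≤ η) :
    ∀ x ≥ 0, ∀ t > 0, w x t ≤ 0 := by
  intro x hx t ht
  obtain ⟨M₀, hM₀⟩ := growth t ht
  obtain ⟨M, hM, hgr⟩ : ∃ M > 0, ∀ x ≥ 0, ∀ s ∈ Ioc 0 t, w x s ≤ M * Real.exp (M * x ^ 2) := by
    refine ⟨|M₀| + 1, by positivity, fun y hy s hs => (hM₀ y hy s hs).trans ?_⟩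
    have h := le_abs_self M₀
    gcongr <;> linarith
  set τ : ℝ := 1 / (16 * ε * M) with hτ
  have hτ0 : 0 < τ := by positivity
  have hτ1 : 16 * ε * M * τ ≤ 1 := by rw [hτ, mul_one_div_cancel (by positivity)]
  -- march forward in time by steps of length `τ`
  have key : ∀ n : ℕ, ∀ y ≥ 0, ∀ s ∈ Ioc 0 t, s ≤ n * τ → w y s ≤ 0 := by
    intro n
    induction n with
    | zero => intro y _ s hs h; simp at h; linarith [hs.1]
    | succ n ih =>
      intro y hy s hs h
      rcases le_or_gt s (n * τ) with hle | hlt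
      · exact ih y hy s hs hle
      push_cast at h
      have hn : (0 : ℝ) ≤ n * τ := by positivity
      refine heat_nonpos_step hε hw heat cont bdry hn hM hτ0 hτ1 hgr ?_ hy hlt (by linarith) hs.2
      intro z hz η hη
      rcases Nat.eq_zero_or_pos n with rfl | hn'
      · simpa using init z hz η hη
      have hn0 : (0 : ℝ) < n * τ := by positivity
      have h1 := ih z hz (n * τ) ⟨hn0, hlt.le.trans hs.2⟩ le_rfl
      have h2 := (cont (z, n * τ) ⟨hz, hn0⟩).eventually (Iio_mem_nhds (lt_of_le_of_lt h1 hη))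
      refine (h2.filter_mono (nhdsWithin_mono _ ?_)).mono fun v hv => le_of_lt hv
      exact prod_mono le_rfl (Ioi_subset_Ioi hn)
  obtain ⟨n, hn⟩ := exists_nat_ge (t / τ)
  exact key n x hx t ⟨ht, le_rfl⟩ ((div_le_iff₀ hτ0).1 hn)

/-! ### Integrals over a compact interval depending on time -/

section ParametricIntegral

variable {f : ℝ → ℝ → ℝ} {a b t : ℝ}

lemma uIcc_pos (ha : 0 < a) (hb : 0 < b) {y : ℝ} (hy : y ∈ uIcc a b) : 0 < y :=
  (lt_min ha hb).trans_le hy.1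

lemma continuousOn_slice (hf : ContinuousOn (fun z : ℝ × ℝ => f z.1 z.2) quarter) (ht : 0 < t) :
    ContinuousOn (fun y => f y t) (Ioi 0) :=
  hf.comp (f := fun y : ℝ => (y, t)) (by fun_prop) fun _ hy => ⟨hy, ht⟩

lemma continuousOn_slice_t (hf : ContinuousOn (fun z : ℝ × ℝ => f z.1 z.2) quarter) {x : ℝ}
    (hx : 0 < x) : ContinuousOn (fun s => f x s) (Ioi 0) :=
  hf.comp (f := fun s : ℝ => (x, s)) (by fun_prop) fun _ hs => ⟨hx, hs⟩

lemma continuousOn_slice_uIcc (hf : ContinuousOn (fun z : ℝ × ℝ => f z.1 z.2) quarter)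
    (ha : 0 < a) (hb : 0 < b) (ht : 0 < t) : ContinuousOn (fun y => f y t) (uIcc a b) :=
  (continuousOn_slice hf ht).mono fun _ hy => uIcc_pos ha hb hy

lemma exists_bound_near (hf : ContinuousOn (fun z : ℝ × ℝ => f z.1 z.2) quarter)
    (ha : 0 < a) (hb : 0 < b) (ht : 0 < t) :
    ∃ M, ∀ y ∈ uIcc a b, ∀ s ∈ Icc (t / 2) (2 * t), |f y s| ≤ M := by
  have hK : IsCompact (uIcc a b ×ˢ Icc (t / 2) (2 * t)) := isCompact_uIcc.prod isCompact_Icc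
  obtain ⟨M, hM⟩ := hK.exists_bound_of_continuousOn (f := fun z : ℝ × ℝ => f z.1 z.2)
    (hf.mono fun z hz => ⟨uIcc_pos ha hb hz.1, by have := hz.2.1; simp only [mem_Ioi]; linarith⟩)
  exact ⟨M, fun y hy s hs => hM (y, s) ⟨hy, hs⟩⟩

lemma Icc_half_double_mem_nhds (ht : 0 < t) : Icc (t / 2) (2 * t) ∈ 𝓝 t :=
  Icc_mem_nhds (by linarith) (by linarith)

lemma aestronglyMeasurable_slice (hf : ContinuousOn (fun z : ℝ × ℝ => f z.1 z.2) quarter)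
    (ha : 0 < a) (hb : 0 < b) (ht : 0 < t) :
    AEStronglyMeasurable (fun y => f y t) (volume.restrict (uIoc a b)) :=
  ((continuousOn_slice_uIcc hf ha hb ht).mono uIoc_subset_uIcc).aestronglyMeasurable
    measurableSet_uIoc

lemma continuousAt_integral_slice (hf : ContinuousOn (fun z : ℝ × ℝ => f z.1 z.2) quarter)
    (ha : 0 < a) (hb : 0 < b) (ht : 0 < t) : ContinuousAt (fun s => ∫ y in a..b, f y s) t := by
  obtain ⟨M, hM⟩ := exists_bound_near hf ha hb ht
  refine intervalIntegral.continuousAt_of_dominated_interval (bound := fun _ => M)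
    ?_ ?_ (by simp) ?_
  · filter_upwards [Ioi_mem_nhds ht] with s hs using aestronglyMeasurable_slice hf ha hb hs
  · filter_upwards [Icc_half_double_mem_nhds ht] with s hs
    exact .of_forall fun y hy => hM y (uIoc_subset_uIcc hy) s hs
  · refine .of_forall fun y hy => ?_
    exact (continuousOn_slice_t hf (uIcc_pos ha hb (uIoc_subset_uIcc hy))).continuousAt
      (Ioi_mem_nhds ht)

lemma hasDerivAt_integral_slice {ft : ℝ → ℝ → ℝ}
    (hf : ContinuousOn (fun z : ℝ × ℝ => f z.1 z.2) quarter)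
    (hft : ContinuousOn (fun z : ℝ × ℝ => ft z.1 z.2) quarter)
    (hd : ∀ x > 0, ∀ t > 0, HasDerivAt (fun s => f x s) (ft x t) t)
    (ha : 0 < a) (hb : 0 < b) (ht : 0 < t) :
    HasDerivAt (fun s => ∫ y in a..b, f y s) (∫ y in a..b, ft y t) t := by
  obtain ⟨M, hM⟩ := exists_bound_near hft ha hb ht
  refine (intervalIntegral.hasDerivAt_integral_of_dominated_loc_of_deriv_le
    (bound := fun _ => M) (F' := fun s y => ft y s) (Icc_half_double_mem_nhds ht) ?_ ?_ ?_ ?_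
    (by simp) ?_).2
  · filter_upwards [Ioi_mem_nhds ht] with s hs using aestronglyMeasurable_slice hf ha hb hs
  · exact (continuousOn_slice_uIcc hf ha hb ht).intervalIntegrable
  · exact aestronglyMeasurable_slice hft ha hb ht
  · exact .of_forall fun y hy s hs => hM y (uIoc_subset_uIcc hy) s hs
  · refine .of_forall fun y hy s hs => hd y (uIcc_pos ha hb (uIoc_subset_uIcc hy)) s ?_
    have := hs.1; linarith

end ParametricIntegral

/-! ### Potentials of closed forms with rough initial values -/

/-- The function `A` on the quarter plane, extended by its initial values `A₀` to `t ≤ 0` and by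
zero to `x ≤ 0`. -/
noncomputable def extendInit (A : ℝ → ℝ → ℝ) (A₀ : ℝ → ℝ) (x t : ℝ) : ℝ :=
  if x ≤ 0 then 0 else if t ≤ 0 then A₀ x else A x t

section ExtendInit

variable {A : ℝ → ℝ → ℝ} {A₀ : ℝ → ℝ}

lemma extendInit_pos {x t : ℝ} (hx : 0 < x) (ht : 0 < t) : extendInit A A₀ x t = A x t := by
  simp [extendInit, hx.not_ge, ht.not_ge]

lemma extendInit_zero {x t : ℝ} (hx : 0 < x) (ht : t ≤ 0) : extendInit A A₀ x t = A₀ x := by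
  simp [extendInit, hx.not_ge, ht]

lemma continuousAt_extendInit (hA : ContinuousOn (fun z : ℝ × ℝ => A z.1 z.2) quarter)
    {x : ℝ} (hi : 0 < x → Tendsto (fun t => A x t) (𝓝[>] 0) (𝓝 (A₀ x))) (t : ℝ) :
    ContinuousAt (fun s => extendInit A A₀ x s) t := by
  rcases le_or_gt x 0 with hx | hx
  · simp only [extendInit, hx, if_true]; exact continuousAt_const
  rcases lt_trichotomy t 0 with ht | rfl | ht
  · refine (continuousAt_const (y := A₀ x)).congr ?_
    filter_upwards [Iio_mem_nhds ht] with s hs using (extendInit_zero hx (le_of_lt hs)).symm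
  · rw [continuousAt_iff_continuous_left'_right']
    constructor
    · refine (continuousWithinAt_const (b := A₀ x)).congr_of_eventuallyEq ?_
        (extendInit_zero hx le_rfl)
      filter_upwards [self_mem_nhdsWithin] with s hs using extendInit_zero hx (le_of_lt hs)
    · change Tendsto _ _ (𝓝 (extendInit A A₀ x 0))
      rw [extendInit_zero hx le_rfl]
      refine (hi hx).congr' ?_
      filter_upwards [self_mem_nhdsWithin] with s hs using (extendInit_pos hx hs).symm
  · refine ((continuousOn_slice_t hA hx).continuousAt (Ioi_mem_nhds ht)).congr ?_
    filter_upwards [Ioi_mem_nhds ht] with s hs using (extendInit_pos hx hs).symm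

lemma aestronglyMeasurable_extendInit (hA : ContinuousOn (fun z : ℝ × ℝ => A z.1 z.2) quarter)
    (hi : ∀ᵐ x, 0 < x → Tendsto (fun t => A x t) (𝓝[>] 0) (𝓝 (A₀ x))) (t : ℝ) :
    AEStronglyMeasurable (fun x => extendInit A A₀ x t) volume := by
  have hpos : ∀ s > 0, AEStronglyMeasurable (fun x => extendInit A A₀ x s) volume := by
    intro s hs
    have h : (fun x => extendInit A A₀ x s) = (Ioi 0).indicator fun x => A x s := by
      ext x
      by_cases hx : 0 < x
      · simp [extendInit_pos hx hs, hx]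
      · simp [extendInit, not_lt.1 hx]
    rw [h, aestronglyMeasurable_indicator_iff measurableSet_Ioi]
    exact (continuousOn_slice hA hs).aestronglyMeasurable measurableSet_Ioi
  rcases lt_or_ge 0 t with ht | ht
  · exact hpos t ht
  · refine aestronglyMeasurable_of_tendsto_ae atTop
      (f := fun (n : ℕ) x => extendInit A A₀ x (1 / ((n : ℝ) + 1)))
      (fun n => hpos _ (by positivity)) ?_
    filter_upwards [hi] with x hx
    have h := (continuousAt_extendInit hA hx 0).tendsto.comp
      (tendsto_one_div_add_atTop_nhds_zero_nat (𝕜 := ℝ))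
    have e : extendInit A A₀ x t = extendInit A A₀ x 0 := by simp [extendInit, ht]
    simpa [e, Function.comp_def] using h

lemma extendInit_bound
    (hi : ∀ᵐ x, 0 < x → Tendsto (fun t => A x t) (𝓝[>] 0) (𝓝 (A₀ x)))
    {X T M : ℝ} (hT : 0 < T) (hM0 : 0 ≤ M) (hM : ∀ x ∈ Ioc 0 X, ∀ t ∈ Ioc 0 T, |A x t| ≤ M) :
    ∀ᵐ x, x ≤ X → ∀ t ≤ T, |extendInit A A₀ x t| ≤ M := by
  filter_upwards [hi] with x hx hxX t ht
  rcases le_or_gt x 0 with h0 | h0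
  · simpa [extendInit, h0] using hM0
  rcases le_or_gt t 0 with h1 | h1
  · rw [extendInit_zero h0 h1]
    refine le_of_tendsto (hx h0).abs ?_
    filter_upwards [Ioc_mem_nhdsGT hT] with s hs using hM x ⟨h0, hxX⟩ s hs
  · rw [extendInit_pos h0 h1]; exact hM x ⟨h0, hxX⟩ t ⟨h1, ht⟩

/-- Joint continuity, up to `x = 0` and `t = 0`, of the primitive in `x`. -/
lemma continuousAt_primitive_extendInit
    (hA : ContinuousOn (fun z : ℝ × ℝ => A z.1 z.2) quarter)
    (hi : ∀ᵐ x, 0 < x → Tendsto (fun t => A x t) (𝓝[>] 0) (𝓝 (A₀ x)))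
    (hb : ∀ X T : ℝ, ∃ M, ∀ x ∈ Ioc 0 X, ∀ t ∈ Ioc 0 T, |A x t| ≤ M)
    {x t : ℝ} (hx : 0 ≤ x) :
    ContinuousAt (fun z : ℝ × ℝ => ∫ y in (1 : ℝ)..z.1, extendInit A A₀ y z.2) (x, t) := by
  obtain ⟨M, hM⟩ := hb (x + 2) (|t| + 1)
  have hbd := extendInit_bound hi (X := x + 2) (T := |t| + 1) (M := |M|)
    (by positivity) (abs_nonneg M) (fun y hy s hs => (hM y hy s hs).trans (le_abs_self M))
  have h := intervalIntegral.continuousAt_parametric_primitive_of_dominated (μ := volume)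
    (F := fun s y => extendInit A A₀ y s) (fun _ => |M|) (-1) (x + 2) (a₀ := 1) (b₀ := x) (x₀ := t)
    (fun s => (aestronglyMeasurable_extendInit hA hi s).restrict) ?_ (by simp) ?_
    ⟨by norm_num, by linarith⟩ ⟨by linarith, by linarith⟩ (by simp)
  · exact h.comp_of_eq (f := fun z : ℝ × ℝ => (z.2, z.1)) (by fun_prop) rfl
  · filter_upwards [Iio_mem_nhds (show t < |t| + 1 by linarith [le_abs_self t])] with s hs
    rw [ae_restrict_iff' measurableSet_uIoc]
    filter_upwards [hbd] with y hy hyI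
    rw [uIoc_of_le (by linarith)] at hyI
    exact hy hyI.2 s (le_of_lt hs)
  · refine ae_restrict_of_ae ?_
    filter_upwards [hi] with y hy using continuousAt_extendInit hA hy t

/-- Continuity in time, down to `t = 0`, of weighted space integrals. -/
lemma continuous_integral_extendInit
    (hA : ContinuousOn (fun z : ℝ × ℝ => A z.1 z.2) quarter)
    (hi : ∀ᵐ x, 0 < x → Tendsto (fun t => A x t) (𝓝[>] 0) (𝓝 (A₀ x)))
    (hb : ∀ X T : ℝ, ∃ M, ∀ x ∈ Ioc 0 X, ∀ t ∈ Ioc 0 T, |A x t| ≤ M)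
    {χ : ℝ → ℝ} (hχ : Continuous χ) (a b : ℝ) :
    Continuous fun t : ℝ => ∫ y in a..b, χ y * extendInit A A₀ y t := by
  rw [continuous_iff_continuousAt]
  intro t
  obtain ⟨M, hM⟩ := hb (max a b) (|t| + 1)
  have hbd := extendInit_bound hi (X := max a b) (T := |t| + 1) (M := |M|)
    (by positivity) (abs_nonneg M) (fun y hy s hs => (hM y hy s hs).trans (le_abs_self M))
  refine intervalIntegral.continuousAt_of_dominated_interval
    (bound := fun y => |χ y| * |M|) ?_ ?_ ?_ ?_
  · exact .of_forall fun s => hχ.aestronglyMeasurable.mul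
      (aestronglyMeasurable_extendInit hA hi s).restrict
  · filter_upwards [Iio_mem_nhds (show t < |t| + 1 by linarith [le_abs_self t])] with s hs
    filter_upwards [hbd] with y hy hyI
    rw [Real.norm_eq_abs, abs_mul]
    exact mul_le_mul_of_nonneg_left (hy hyI.2 s (le_of_lt hs)) (abs_nonneg _)
  · exact (hχ.abs.mul continuous_const).intervalIntegrable _ _
  · filter_upwards [hi] with y hy _
    exact continuousAt_const.mul (continuousAt_extendInit hA hy t)

end ExtendInit

/-- A cubic on `[1, 2]` with `χ 1 = 1`, `χ 2 = 0` and vanishing derivative at both ends. -/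
noncomputable def cutoff (y : ℝ) : ℝ := 1 - 3 * (y - 1) ^ 2 + 2 * (y - 1) ^ 3

lemma hasDerivAt_cutoff (y : ℝ) : HasDerivAt cutoff (-6 * (y - 1) + 6 * (y - 1) ^ 2) y := by
  have h1 := ((hasDerivAt_id y).sub_const 1)
  exact (((h1.pow 2).const_mul 3).const_sub 1 |>.add ((h1.pow 3).const_mul 2)).congr_deriv
    (by simp; ring)

lemma hasDerivAt_cutoff_deriv (y : ℝ) :
    HasDerivAt (fun y : ℝ => -6 * (y - 1) + 6 * (y - 1) ^ 2) (-6 + 12 * (y - 1)) y := by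
  have h1 := ((hasDerivAt_id y).sub_const 1)
  exact ((h1.const_mul (-6)).add ((h1.pow 2).const_mul 6)).congr_deriv (by simp; ring)

/-- If `A_t = ((ε/2) A_x + N)_x`, then the closed form `A dx + ((ε/2) A_x + N) dt` has a potential
`Φ` which is continuous down to `t = 0`, even though `A_x` need not be integrable near `t = 0`:
testing the equation against `cutoff` moves the derivative away from `A`. -/
theorem exists_potential {ε : ℝ} {A N Nx : ℝ → ℝ → ℝ} {A₀ : ℝ → ℝ} (hA : IsC21 A)
    (hAc : ContinuousOn (fun z : ℝ × ℝ => A z.1 z.2) (Ici 0 ×ˢ Ioi 0))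
    (hN : ContinuousOn (fun z : ℝ × ℝ => N z.1 z.2) quarter)
    (hNx : ∀ x > 0, ∀ t > 0, HasDerivAt (fun y => N y t) (Nx x t) x)
    (heq : ∀ x > 0, ∀ t > 0, dt A x t = ε / 2 * dx (dx A) x t + Nx x t)
    (hbA : ∀ X T : ℝ, ∃ M, ∀ x ∈ Ioc 0 X, ∀ t ∈ Ioc 0 T, |A x t| ≤ M)
    (hbN : ∀ X T : ℝ, ∃ M, ∀ x ∈ Ioc 0 X, ∀ t ∈ Ioc 0 T, |N x t| ≤ M)
    (hi : ∀ᵐ x, 0 < x → Tendsto (fun t => A x t) (𝓝[>] 0) (𝓝 (A₀ x))) :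
    ∃ Φ : ℝ → ℝ → ℝ, ContinuousOn (fun z : ℝ × ℝ => Φ z.1 z.2) (Ici 0 ×ˢ Ici 0) ∧
      (∀ x ≥ 0, ∀ t > 0, HasDerivWithinAt (fun y => Φ y t) (A x t) (Ici 0) x) ∧
      (∀ x > 0, ∀ t > 0, HasDerivAt (fun s => Φ x s) (ε / 2 * dx A x t + N x t) t) ∧
      (∀ x ≥ 0, Φ x 0 = ∫ y in (0 : ℝ)..x, A₀ y) ∧
      (∀ x ≥ 0, ∀ t > 0, Φ x t = Φ 0 t + ∫ y in (0 : ℝ)..x, A y t) := by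
  have hAq := hA.continuousOn
  set E := extendInit A A₀ with hE
  set χ₁ : ℝ → ℝ := fun y => -6 * (y - 1) + 6 * (y - 1) ^ 2 with hχ₁
  set χ₂ : ℝ → ℝ := fun y => -6 + 12 * (y - 1) with hχ₂
  have hχc : Continuous cutoff := by unfold cutoff; fun_prop
  have hχ₁c : Continuous χ₁ := by fun_prop
  have hχ₂c : Continuous χ₂ := by fun_prop
  have h12 : ∀ y ∈ uIcc (1 : ℝ) 2, y ∈ Icc (1 : ℝ) 2 := fun y hy => by
    rwa [uIcc_of_le (by norm_num)] at hy
  -- `n` is `∫₁² (-χ') ((ε/2) A_x + N)` after integrating `A_x` by parts; the boundary terms vanish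
  -- because `χ'` does, and the result is bounded as `t → 0`
  set n : ℝ → ℝ := fun t => ∫ y in (1 : ℝ)..2, (ε / 2 * χ₂ y * A y t - χ₁ y * N y t) with hn
  have hncont : ContinuousOn (fun z : ℝ × ℝ => ε / 2 * χ₂ z.1 * A z.1 z.2 - χ₁ z.1 * N z.1 z.2)
      quarter := by
    refine ContinuousOn.sub (ContinuousOn.mul ?_ hAq) (ContinuousOn.mul ?_ hN)
    · exact (continuous_const.mul (hχ₂c.comp continuous_fst)).continuousOn
    · exact (hχ₁c.comp continuous_fst).continuousOn
  have hnc : ∀ t > 0, ContinuousAt n t := fun t ht =>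
    continuousAt_integral_slice (f := fun y t => ε / 2 * χ₂ y * A y t - χ₁ y * N y t) hncont
      one_pos two_pos ht
  have hnb : ∀ T, ∃ M, ∀ t ∈ Ioc 0 T, |n t| ≤ M := by
    intro T
    obtain ⟨MA, hMA⟩ := hbA 2 T
    obtain ⟨MN, hMN⟩ := hbN 2 T
    refine ⟨(|ε| / 2 * 18 * MA + 12 * MN) * |2 - 1|, fun t ht => ?_⟩
    refine intervalIntegral.norm_integral_le_of_norm_le_const (E := ℝ) fun y hy => ?_
    rw [uIoc_of_le (by norm_num)] at hy
    have hy0 : y ∈ Ioc (0 : ℝ) 2 := ⟨by linarith [hy.1], hy.2⟩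
    have h1 := hMA y hy0 t ht
    have h2 := hMN y hy0 t ht
    have h3 : |χ₂ y| ≤ 18 := by
      rw [abs_le, hχ₂]; constructor <;> simp only <;> linarith [hy.1, hy.2]
    have h4 : |χ₁ y| ≤ 12 := by
      rw [abs_le, hχ₁]; constructor <;> simp only <;> nlinarith [hy.1, hy.2]
    calc ‖ε / 2 * χ₂ y * A y t - χ₁ y * N y t‖
        ≤ |ε / 2 * χ₂ y * A y t| + |χ₁ y * N y t| := abs_sub _ _
      _ = |ε| / 2 * |χ₂ y| * |A y t| + |χ₁ y| * |N y t| := by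
          simp only [abs_mul, abs_div, abs_two]
      _ ≤ |ε| / 2 * 18 * MA + 12 * MN := by gcongr
  have hnint : ∀ a ≥ 0, ∀ b ≥ 0, IntervalIntegrable n volume a b := by
    intro a ha b hb
    obtain ⟨M, hM⟩ := hnb (max a b)
    rw [intervalIntegrable_iff]
    refine Integrable.mono' (g := fun _ => M) (intervalIntegrable_iff.1 intervalIntegrable_const)
      ?_ ?_
    · refine ContinuousOn.aestronglyMeasurable (fun t ht => ?_) measurableSet_uIoc
      exact (hnc t ((le_min ha hb).trans_lt ht.1)).continuousWithinAt
    · rw [ae_restrict_iff' measurableSet_uIoc]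
      exact .of_forall fun t ht => hM t ⟨(le_min ha hb).trans_lt ht.1, ht.2⟩
  -- the potential at `x = 1`: a primitive in time of `(ε/2) A_x + N`, continuous down to `t = 0`
  set c : ℝ → ℝ := fun t => (∫ s in (0 : ℝ)..t, n s) - ∫ y in (1 : ℝ)..2, cutoff y * E y t with hc
  have hcc : ContinuousOn c (Ici 0) := by
    refine ContinuousOn.sub ?_ (continuous_integral_extendInit hAq hi hbA hχc 1 2).continuousOn
    intro T hT
    have h1 := intervalIntegral.continuousOn_primitive_interval'
      (hnint 0 le_rfl (T + 1) (by have : 0 ≤ T := hT; linarith)) (a := 0) left_mem_uIcc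
    have h2 := h1 T (by rw [uIcc_of_le (by have : 0 ≤ T := hT; linarith)]; exact ⟨hT, by linarith⟩)
    refine h2.mono_of_mem_nhdsWithin ?_
    rw [uIcc_of_le (by have : 0 ≤ T := hT; linarith)]
    filter_upwards [self_mem_nhdsWithin, mem_nhdsWithin_of_mem_nhds
      (Iio_mem_nhds (show T < T + 1 by linarith))] with s hs1 hs2 using ⟨hs1, le_of_lt hs2⟩
  set B : ℝ → ℝ → ℝ := fun x t => ε / 2 * dx A x t + N x t with hB
  have hBx : ∀ x > 0, ∀ t > 0, HasDerivAt (fun y => B y t) (dt A x t) x := by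
    intro x hx t ht
    rw [heq x hx t ht]
    exact ((hA.hasDerivAt_xx hx ht).const_mul _).add (hNx x hx t ht)
  have hcd : ∀ t > 0, HasDerivAt c (B 1 t) t := by
    intro t ht
    have h1 : HasDerivAt (fun t => ∫ s in (0 : ℝ)..t, n s) (n t) t := by
      refine intervalIntegral.integral_hasDerivAt_right (hnint 0 le_rfl t ht.le) ?_ (hnc t ht)
      exact ContinuousOn.stronglyMeasurableAtFilter isOpen_Ioi
        (fun s hs => (hnc s hs).continuousWithinAt) t ht
    have h2 : HasDerivAt (fun t => ∫ y in (1 : ℝ)..2, cutoff y * E y t)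
        (∫ y in (1 : ℝ)..2, cutoff y * dt A y t) t := by
      refine hasDerivAt_congr_pos (f := fun t => ∫ y in (1 : ℝ)..2, cutoff y * A y t) ?_ ht
        (hasDerivAt_integral_slice (f := fun y t => cutoff y * A y t)
          (ft := fun y t => cutoff y * dt A y t)
          ((hχc.comp continuous_fst).continuousOn.mul hAq)
          ((hχc.comp continuous_fst).continuousOn.mul hA.cont_t)
          (fun x hx s hs => (hA.hasDerivAt_t hx hs).const_mul _) one_pos two_pos ht)
      intro s hs
      refine intervalIntegral.integral_congr fun y hy => ?_
      simp only [hE, extendInit_pos (lt_of_lt_of_le one_pos (h12 y hy).1) hs]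
    have ci : ∀ {g : ℝ → ℝ → ℝ}, ContinuousOn (fun z : ℝ × ℝ => g z.1 z.2) quarter →
        IntervalIntegrable (fun y => g y t) volume 1 2 := fun hg =>
      (continuousOn_slice_uIcc hg one_pos two_pos ht).intervalIntegrable
    have hp : ∀ y ∈ uIcc (1 : ℝ) 2, 0 < y := fun y hy => uIcc_pos one_pos two_pos hy
    have h3 : ∫ y in (1 : ℝ)..2, cutoff y * dt A y t
        = cutoff 2 * B 2 t - cutoff 1 * B 1 t - ∫ y in (1 : ℝ)..2, χ₁ y * B y t :=
      intervalIntegral.integral_mul_deriv_eq_deriv_mul (fun y _ => hasDerivAt_cutoff y)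
        (fun y hy => hBx y (hp y hy) t ht) (hχ₁c.intervalIntegrable _ _) (ci hA.cont_t)
    have h4 : ∫ y in (1 : ℝ)..2, χ₁ y * dx A y t
        = χ₁ 2 * A 2 t - χ₁ 1 * A 1 t - ∫ y in (1 : ℝ)..2, χ₂ y * A y t :=
      intervalIntegral.integral_mul_deriv_eq_deriv_mul (fun y _ => hasDerivAt_cutoff_deriv y)
        (fun y hy => hA.hasDerivAt_x (hp y hy) ht) (hχ₂c.intervalIntegrable _ _) (ci hA.cont_x)
    have i1 : IntervalIntegrable (fun y => χ₁ y * dx A y t) volume 1 2 :=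
      (ci hA.cont_x).continuousOn_mul hχ₁c.continuousOn
    have i2 : IntervalIntegrable (fun y => χ₁ y * N y t) volume 1 2 :=
      (ci hN).continuousOn_mul hχ₁c.continuousOn
    have i3 : IntervalIntegrable (fun y => χ₂ y * A y t) volume 1 2 :=
      (ci hAq).continuousOn_mul hχ₂c.continuousOn
    have h5 : ∫ y in (1 : ℝ)..2, χ₁ y * B y t
        = ε / 2 * (∫ y in (1 : ℝ)..2, χ₁ y * dx A y t) + ∫ y in (1 : ℝ)..2, χ₁ y * N y t := by
      rw [← intervalIntegral.integral_const_mul,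
        ← intervalIntegral.integral_add (i1.const_mul _) i2]
      refine intervalIntegral.integral_congr fun y _ => ?_
      simp only [hB]; ring
    have h6 : n t = ε / 2 * (∫ y in (1 : ℝ)..2, χ₂ y * A y t)
        - ∫ y in (1 : ℝ)..2, χ₁ y * N y t := by
      rw [← intervalIntegral.integral_const_mul,
        ← intervalIntegral.integral_sub (i3.const_mul _) i2]
      refine intervalIntegral.integral_congr fun y _ => ?_
      ring
    refine (h1.sub h2).congr_deriv ?_
    rw [h3, h5, h4, h6]
    simp only [cutoff, hχ₁]
    ring
  set G : ℝ → ℝ → ℝ := fun x t => ∫ y in (1 : ℝ)..x, E y t with hG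
  have hEint : ∀ t a b, IntervalIntegrable (fun y => E y t) volume a b := by
    intro t a b
    obtain ⟨M, hM⟩ := hbA (max a b) (|t| + 1)
    have hbd := extendInit_bound hi (X := max a b) (T := |t| + 1) (M := |M|)
      (by positivity) (abs_nonneg M) (fun y hy s hs => (hM y hy s hs).trans (le_abs_self M))
    rw [intervalIntegrable_iff]
    refine Measure.integrableOn_of_bounded (M := |M|) (by simp)
      (aestronglyMeasurable_extendInit hAq hi t) ?_
    rw [ae_restrict_iff' measurableSet_uIoc]
    filter_upwards [hbd] with y hy hyI using hy hyI.2 t (by linarith [le_abs_self t])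
  -- replacing `y` by `max y 0` makes the integrand continuous on the line, so that the primitive is
  -- differentiable at `x = 0` as well
  have hGpos : ∀ x ≥ 0, ∀ t > 0, G x t = ∫ y in (1 : ℝ)..x, A (max y 0) t := by
    intro x hx t ht
    refine intervalIntegral.integral_congr_ae (.of_forall fun y hy => ?_)
    have hy0 : 0 < y := (le_min zero_le_one hx).trans_lt hy.1
    rw [hE, extendInit_pos hy0 ht, max_eq_left hy0.le]
  have hAm : ∀ t > 0, Continuous fun y => A (max y 0) t := fun t ht =>
    hAc.comp_continuous (f := fun y : ℝ => (max y 0, t)) (by fun_prop)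
      fun y => ⟨le_max_right y 0, ht⟩
  refine ⟨fun x t => c t + G x t - (c 0 + G 0 0), ?_, ?_, ?_, ?_, ?_⟩
  · refine ContinuousOn.sub (ContinuousOn.add ?_ ?_) continuousOn_const
    · exact hcc.comp continuousOn_snd fun z hz => hz.2
    · exact fun z hz => (continuousAt_primitive_extendInit hAq hi hbA hz.1).continuousWithinAt
  · intro x hx t ht
    have h1 : HasDerivAt (fun x => ∫ y in (1 : ℝ)..x, A (max y 0) t) (A (max x 0) t) x :=
      (hAm t ht).integral_hasStrictDerivAt 1 x |>.hasDerivAt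
    rw [max_eq_left hx] at h1
    have h2 : HasDerivWithinAt (fun x => G x t) (A x t) (Ici 0) x :=
      h1.hasDerivWithinAt.congr (fun y hy => hGpos y hy t ht) (hGpos x hx t ht)
    exact (h2.const_add (c t)).sub_const _
  · intro x hx t ht
    have h1 : HasDerivAt (fun s => G x s) (∫ y in (1 : ℝ)..x, dt A y t) t := by
      refine hasDerivAt_congr_pos (f := fun s => ∫ y in (1 : ℝ)..x, A y s) ?_ ht
        (hasDerivAt_integral_slice hAq hA.cont_t (fun x hx s hs => hA.hasDerivAt_t hx hs)
          one_pos hx ht)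
      intro s hs
      refine intervalIntegral.integral_congr fun y hy => ?_
      simp only [hE, extendInit_pos (uIcc_pos one_pos hx hy) hs]
    have h2 : ∫ y in (1 : ℝ)..x, dt A y t = B x t - B 1 t :=
      intervalIntegral.integral_eq_sub_of_hasDerivAt
        (fun y hy => hBx y (uIcc_pos one_pos hx hy) t ht)
        (continuousOn_slice_uIcc hA.cont_t one_pos hx ht).intervalIntegrable
    refine (((hcd t ht).add h1).sub_const _).congr_deriv ?_
    rw [h2]; simp only [hB]; ring
  · intro x hx
    have h1 : G x 0 - G 0 0 = ∫ y in (0 : ℝ)..x, E y 0 := by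
      simp only [hG]
      rw [intervalIntegral.integral_interval_sub_left (hEint 0 1 x) (hEint 0 1 0)]
    have h2 : ∫ y in (0 : ℝ)..x, E y 0 = ∫ y in (0 : ℝ)..x, A₀ y := by
      refine intervalIntegral.integral_congr_ae (.of_forall fun y hy => ?_)
      rw [uIoc_of_le hx] at hy
      rw [hE, extendInit_zero hy.1 le_rfl]
    linarith
  · intro x hx t ht
    have h1 : G x t - G 0 t = ∫ y in (0 : ℝ)..x, E y t := by
      simp only [hG]
      rw [intervalIntegral.integral_interval_sub_left (hEint t 1 x) (hEint t 1 0)]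
    have h2 : ∫ y in (0 : ℝ)..x, E y t = ∫ y in (0 : ℝ)..x, A y t := by
      refine intervalIntegral.integral_congr_ae (.of_forall fun y hy => ?_)
      rw [uIoc_of_le hx] at hy
      rw [hE, extendInit_pos hy.1 ht]
    linarith

/-! ### The heat flow on the line for data of exponential growth -/

/-- Measurable functions of at most exponential growth. -/
structure ExpBounded (f : ℝ → ℝ) : Prop where
  meas : Measurable f
  bound : ∃ C, 0 ≤ C ∧ ∀ y, |f y| ≤ C * Real.exp (C * |y|)

/-- The solution at time `t` of `v_t = (ε/2) v_xx` on the line with initial values `f`, written as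
the expectation of `f (x + √(εt) Z)` for a standard Gaussian `Z`. It equals `f` for `t ≤ 0`,
since then `√(εt) = 0`. -/
noncomputable def heatFlow (ε : ℝ) (f : ℝ → ℝ) (x t : ℝ) : ℝ :=
  ∫ z, f (x + √(ε * t) * z) ∂(ProbabilityTheory.gaussianReal 0 1)

/-- Moments of `f` against the Gaussian weight `exp (a y - s y ^ 2)`. -/
noncomputable def expMoment (f : ℝ → ℝ) (k : ℕ) (a s : ℝ) : ℝ :=
  ∫ y, y ^ k * Real.exp (a * y - s * y ^ 2) * f y

namespace ExpBounded

variable {f : ℝ → ℝ}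

lemma of_bound (hm : Measurable f) {C D : ℝ} (h : ∀ y, |f y| ≤ C * Real.exp (D * |y|)) :
    ExpBounded f := by
  refine ⟨hm, max |C| |D|, le_max_of_le_left (abs_nonneg C), fun y => (h y).trans ?_⟩
  have h1 : C ≤ max |C| |D| := (le_abs_self C).trans (le_max_left _ _)
  have h2 : D ≤ max |C| |D| := (le_abs_self D).trans (le_max_right _ _)
  have h3 : 0 ≤ max |C| |D| := le_max_of_le_left (abs_nonneg C)
  gcongr

/-- A bound of the moment integrands, uniform for bounded `a` and `s` bounded below. -/
lemma moment_bound (hf : ExpBounded f) (k : ℕ) (A : ℝ) {S : ℝ} (hS : 0 < S) :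
    ∃ D, ∀ a s y : ℝ, |a| ≤ A → S ≤ s →
      ‖y ^ k * Real.exp (a * y - s * y ^ 2) * f y‖ ≤ D * Real.exp (-(S / 2) * y ^ 2) := by
  obtain ⟨C, hC0, hC⟩ := hf.bound
  set B := 1 + A + C with hB
  refine ⟨k.factorial * C * Real.exp (B ^ 2 / (2 * S)), fun a s y ha hs => ?_⟩
  have h1 : |y| ^ k ≤ k.factorial * Real.exp |y| := by
    have := Real.pow_div_factorial_le_exp |y| (abs_nonneg y) k
    rwa [div_le_iff₀ (by positivity), mul_comm] at this
  have h2 : a * y ≤ A * |y| :=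
    (le_abs_self _).trans (by rw [abs_mul]; exact mul_le_mul_of_nonneg_right ha (abs_nonneg y))
  have h3 : B * |y| ≤ B ^ 2 / (2 * S) + S / 2 * y ^ 2 := by
    have : B ^ 2 / (2 * S) + S / 2 * y ^ 2 - B * |y| = (B - S * |y|) ^ 2 / (2 * S) := by
      rw [← sq_abs y]; field_simp; ring
    have h4 : 0 ≤ (B - S * |y|) ^ 2 / (2 * S) := by positivity
    linarith
  have h5 : S * y ^ 2 ≤ s * y ^ 2 := mul_le_mul_of_nonneg_right hs (sq_nonneg y)
  calc ‖y ^ k * Real.exp (a * y - s * y ^ 2) * f y‖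
      = |y| ^ k * Real.exp (a * y - s * y ^ 2) * |f y| := by
        rw [norm_mul, norm_mul, norm_pow, Real.norm_eq_abs, Real.norm_eq_abs, Real.norm_eq_abs,
          Real.abs_exp]
    _ ≤ (k.factorial * Real.exp |y|) * Real.exp (A * |y| - S * y ^ 2)
          * (C * Real.exp (C * |y|)) := by
        gcongr
        exact hC y
    _ = k.factorial * C * Real.exp (B * |y| - S * y ^ 2) := by
        have : B * |y| - S * y ^ 2 = |y| + (A * |y| - S * y ^ 2) + C * |y| := by rw [hB]; ring
        rw [this, Real.exp_add, Real.exp_add]; ring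
    _ ≤ k.factorial * C * Real.exp (B ^ 2 / (2 * S) + -(S / 2) * y ^ 2) := by
        gcongr; linarith
    _ = _ := by rw [Real.exp_add]; ring

lemma integrable_moment_bound (D : ℝ) {S : ℝ} (hS : 0 < S) :
    Integrable fun y : ℝ => D * Real.exp (-(S / 2) * y ^ 2) :=
  (integrable_exp_neg_mul_sq (by positivity)).const_mul D

lemma moment_meas (hf : ExpBounded f) (k : ℕ) (a s : ℝ) :
    AEStronglyMeasurable (fun y : ℝ => y ^ k * Real.exp (a * y - s * y ^ 2) * f y) volume := by
  refine AEStronglyMeasurable.mul ?_ hf.meas.aestronglyMeasurable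
  exact Continuous.aestronglyMeasurable (by fun_prop)

lemma integrable_moment (hf : ExpBounded f) (k : ℕ) (a : ℝ) {s : ℝ} (hs : 0 < s) :
    Integrable fun y : ℝ => y ^ k * Real.exp (a * y - s * y ^ 2) * f y := by
  obtain ⟨D, hD⟩ := hf.moment_bound k |a| hs
  exact (integrable_moment_bound D hs).mono' (hf.moment_meas k a s)
    (.of_forall fun y => hD a s y le_rfl le_rfl)

lemma hasDerivAt_expMoment_fst (hf : ExpBounded f) (k : ℕ) (a : ℝ) {s : ℝ} (hs : 0 < s) :
    HasDerivAt (fun a => expMoment f k a s) (expMoment f (k + 1) a s) a := by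
  obtain ⟨D, hD⟩ := hf.moment_bound (k + 1) (|a| + 1) hs
  refine (hasDerivAt_integral_of_dominated_loc_of_deriv_le (Metric.ball_mem_nhds a one_pos)
    (.of_forall fun b => hf.moment_meas k b s) (hf.integrable_moment k a hs)
    (F' := fun b y => y ^ (k + 1) * Real.exp (b * y - s * y ^ 2) * f y)
    (hf.moment_meas (k + 1) a s) (.of_forall fun y b hb => hD b s y ?_ le_rfl)
    (integrable_moment_bound D hs) (.of_forall fun y b _ => ?_)).2
  · have := abs_sub_abs_le_abs_sub b a
    have h2 : |b - a| < 1 := by simpa [Real.dist_eq] using hb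
    linarith
  · have h : HasDerivAt (fun b => b * y - s * y ^ 2) y b := by
      simpa using ((hasDerivAt_id b).mul_const y).sub_const (s * y ^ 2)
    exact ((h.exp.const_mul (y ^ k)).mul_const (f y)).congr_deriv (by ring)

lemma hasDerivAt_expMoment_snd (hf : ExpBounded f) (k : ℕ) (a : ℝ) {s : ℝ} (hs : 0 < s) :
    HasDerivAt (fun s => expMoment f k a s) (-expMoment f (k + 2) a s) s := by
  obtain ⟨D, hD⟩ := hf.moment_bound (k + 2) |a| (half_pos hs)
  have h := (hasDerivAt_integral_of_dominated_loc_of_deriv_le (Ioi_mem_nhds (half_lt_self hs))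
    (.of_forall fun r => hf.moment_meas k a r) (hf.integrable_moment k a hs)
    (F' := fun r y => -(y ^ (k + 2) * Real.exp (a * y - r * y ^ 2) * f y))
    (hf.moment_meas (k + 2) a s).neg (.of_forall fun y r hr => ?_)
    (integrable_moment_bound D (half_pos hs)) (.of_forall fun y r _ => ?_)).2
  · simpa [expMoment, integral_neg] using h
  · rw [norm_neg]; exact hD a r y le_rfl (le_of_lt hr)
  · have h : HasDerivAt (fun r => a * y - r * y ^ 2) (-y ^ 2) r := by
      simpa using ((hasDerivAt_id r).mul_const (y ^ 2)).const_sub (a * y)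
    exact ((h.exp.const_mul (y ^ k)).mul_const (f y)).congr_deriv (by ring)

lemma continuousOn_expMoment (hf : ExpBounded f) (k : ℕ) :
    ContinuousOn (fun z : ℝ × ℝ => expMoment f k z.1 z.2) (univ ×ˢ Ioi 0) := by
  rintro ⟨a, s⟩ ⟨-, hs⟩
  have hs : 0 < s := hs
  obtain ⟨D, hD⟩ := hf.moment_bound k (|a| + 1) (half_pos hs)
  refine (continuousAt_of_dominated (.of_forall fun z : ℝ × ℝ => hf.moment_meas k z.1 z.2) ?_
    (integrable_moment_bound D (half_pos hs)) (.of_forall fun y => ?_)).continuousWithinAt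
  · filter_upwards [prod_mem_nhds (Metric.ball_mem_nhds a one_pos)
      (Ioi_mem_nhds (half_lt_self hs))] with z hz
    refine .of_forall fun y => hD z.1 z.2 y ?_ (le_of_lt hz.2)
    have := abs_sub_abs_le_abs_sub z.1 a
    have h2 : |z.1 - a| < 1 := by simpa [Real.dist_eq] using hz.1
    linarith
  · fun_prop

/-- The moments are smooth: both partial derivatives of a moment are moments. -/
lemma contDiffOn_expMoment (hf : ExpBounded f) (k : ℕ) :
    ContDiffOn ℝ ∞ (fun z : ℝ × ℝ => expMoment f k z.1 z.2) (univ ×ˢ Ioi 0) := by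
  rw [contDiffOn_infty]
  intro n
  induction n generalizing k with
  | zero => exact contDiffOn_zero.2 (hf.continuousOn_expMoment k)
  | succ n ih =>
    exact contDiffOn_succ_of_partials
      (ft := fun a s => -expMoment f (k + 2) a s) (isOpen_univ.prod isOpen_Ioi)
      (fun z hz => hf.hasDerivAt_expMoment_fst k z.1 hz.2)
      (fun z hz => hf.hasDerivAt_expMoment_snd k z.1 hz.2) (ih (k + 1)) (ih (k + 2)).neg

end ExpBounded

section HeatFlow

variable {ε : ℝ} {f : ℝ → ℝ} {x t : ℝ}

lemma map_gaussian (hε : 0 < ε) (ht : 0 < t) :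
    (ProbabilityTheory.gaussianReal 0 1).map (fun z => x + √(ε * t) * z)
      = ProbabilityTheory.gaussianReal x (Real.toNNReal (ε * t)) := by
  have h : (fun z => x + √(ε * t) * z) = (x + ·) ∘ (√(ε * t) * ·) := rfl
  rw [h, ← Measure.map_map (by fun_prop) (by fun_prop),
    ProbabilityTheory.gaussianReal_map_const_mul, ProbabilityTheory.gaussianReal_map_const_add]
  congr 1
  · simp
  · ext
    simp [Real.sq_sqrt (mul_pos hε ht).le, (mul_pos hε ht).le]

lemma heatFlow_eq_integral (hε : 0 < ε) (ht : 0 < t) (hf : Measurable f) :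
    heatFlow ε f x t
      = ∫ y, (√(2 * Real.pi * (ε * t)))⁻¹ * Real.exp (-(y - x) ^ 2 / (2 * (ε * t))) * f y := by
  have hv : Real.toNNReal (ε * t) ≠ 0 := by simpa using mul_pos hε ht
  have h := integral_map (μ := ProbabilityTheory.gaussianReal 0 1)
    (φ := fun z => x + √(ε * t) * z) (by fun_prop) (f := f) hf.aestronglyMeasurable
  rw [heatFlow, ← h, map_gaussian hε ht,
    ProbabilityTheory.integral_gaussianReal_eq_integral_smul hv]
  simp [ProbabilityTheory.gaussianPDFReal, (mul_pos hε ht).le]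

lemma heatFlow_eq_expMoment (hε : 0 < ε) (ht : 0 < t) (hf : Measurable f) :
    heatFlow ε f x t = (√(2 * Real.pi * (ε * t)))⁻¹ * Real.exp (-(1 / (2 * ε * t)) * x ^ 2)
      * expMoment f 0 (2 * (1 / (2 * ε * t)) * x) (1 / (2 * ε * t)) := by
  rw [heatFlow_eq_integral hε ht hf, expMoment, ← integral_const_mul]
  congr 1; ext y
  have : -(y - x) ^ 2 / (2 * (ε * t)) = -(1 / (2 * ε * t)) * x ^ 2
      + (2 * (1 / (2 * ε * t)) * x * y - 1 / (2 * ε * t) * y ^ 2) := by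
    field_simp; ring
  rw [this, Real.exp_add]; ring

lemma contDiffOn_heatFlow (hε : 0 < ε) (hf : ExpBounded f) :
    ContDiffOn ℝ ∞ (fun z : ℝ × ℝ => heatFlow ε f z.1 z.2) (univ ×ˢ Ioi 0) := by
  have hs : ContDiffOn ℝ ∞ (fun z : ℝ × ℝ => 1 / (2 * ε * z.2)) (univ ×ˢ Ioi 0) := by
    refine contDiffOn_const.div (by fun_prop) fun z hz => ?_
    have : 0 < z.2 := hz.2
    positivity
  have h1 : ContDiffOn ℝ ∞ (fun z : ℝ × ℝ => (√(2 * Real.pi * (ε * z.2)))⁻¹) (univ ×ˢ Ioi 0) := by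
    refine ContDiffOn.inv (ContDiffOn.sqrt (by fun_prop) fun z hz => ?_) fun z hz => ?_
    all_goals
      have : 0 < z.2 := hz.2
      positivity
  have h2 := (hf.contDiffOn_expMoment 0).comp
    (f := fun z : ℝ × ℝ => (2 * (1 / (2 * ε * z.2)) * z.1, 1 / (2 * ε * z.2))) (s := univ ×ˢ Ioi 0)
    (((contDiffOn_const.mul hs).mul contDiffOn_fst).prodMk hs) (fun z hz => ⟨trivial, by
      have : 0 < z.2 := hz.2
      simp only [mem_Ioi]; positivity⟩)
  refine ((h1.mul ((hs.neg.mul (contDiffOn_fst.pow 2)).exp)).mul h2).congr fun z hz => ?_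
  exact heatFlow_eq_expMoment hε hz.2 hf.meas

lemma isSmooth_heatFlow (hε : 0 < ε) (hf : ExpBounded f) : IsSmooth (heatFlow ε f) :=
  (contDiffOn_heatFlow hε hf).mono fun _ hz => ⟨trivial, hz.2⟩

lemma continuousOn_heatFlow (hε : 0 < ε) (hf : ExpBounded f) :
    ContinuousOn (fun z : ℝ × ℝ => heatFlow ε f z.1 z.2) (Ici 0 ×ˢ Ioi 0) :=
  (contDiffOn_heatFlow hε hf).continuousOn.mono fun _ hz => ⟨trivial, hz.2⟩

lemma heatFlow_heat (hε : 0 < ε) (hf : ExpBounded f) (hx : 0 < x) (ht : 0 < t) :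
    dt (heatFlow ε f) x t = ε / 2 * dx (dx (heatFlow ε f)) x t := by
  set s : ℝ → ℝ := fun t => 1 / (2 * ε * t) with hs
  set K : ℝ → ℝ := fun t => (√(2 * Real.pi * (ε * t)))⁻¹ with hK
  have hst : 0 < s t := by positivity
  have hM : ∀ k y, HasDerivAt (fun y => expMoment f k (2 * s t * y) (s t))
      (expMoment f (k + 1) (2 * s t * y) (s t) * (2 * s t)) y := fun k y =>
    (hf.hasDerivAt_expMoment_fst k (2 * s t * y) hst).comp y
      (by simpa using (hasDerivAt_id y).const_mul (2 * s t))
  have hE : ∀ y, HasDerivAt (fun y => Real.exp (-s t * y ^ 2))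
      (-2 * s t * y * Real.exp (-s t * y ^ 2)) y := fun y =>
    (((hasDerivAt_id y).pow 2).const_mul (-s t)).exp.congr_deriv (by simp; ring)
  have h1 : ∀ y > 0, HasDerivAt (fun y => heatFlow ε f y t)
      (K t * Real.exp (-s t * y ^ 2) * (-2 * s t * y * expMoment f 0 (2 * s t * y) (s t)
        + 2 * s t * expMoment f 1 (2 * s t * y) (s t))) y := by
    intro y _
    have h : (fun y => heatFlow ε f y t) = fun y =>
        K t * Real.exp (-s t * y ^ 2) * expMoment f 0 (2 * s t * y) (s t) :=
      funext fun y => heatFlow_eq_expMoment hε ht hf.meas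
    rw [h]
    exact (((hE y).const_mul (K t)).mul (hM 0 y)).congr_deriv (by ring)
  have h2 := IsC21.dxx_eq (f := heatFlow ε f) (fx := fun y t => K t * Real.exp (-s t * y ^ 2) *
      (-2 * s t * y * expMoment f 0 (2 * s t * y) (s t)
        + 2 * s t * expMoment f 1 (2 * s t * y) (s t))) h1 hx
    (((hE x).const_mul (K t)).mul
      (((((hasDerivAt_id x).const_mul (-2 * s t))).mul (hM 0 x)).add
        ((hM 1 x).const_mul (2 * s t))))
  have hsd : HasDerivAt s (-(s t) / t) t := by
    have h : HasDerivAt (fun t => 2 * ε * t) (2 * ε) t := by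
      simpa using (hasDerivAt_id t).const_mul (2 * ε)
    have := (hasDerivAt_const t (1 : ℝ)).div h (by positivity)
    exact this.congr_deriv (by rw [hs]; field_simp; ring)
  have hKd : HasDerivAt K (-(K t) / (2 * t)) t := by
    have h : HasDerivAt (fun t => 2 * Real.pi * (ε * t)) (2 * Real.pi * ε) t := by
      simpa using ((hasDerivAt_id t).const_mul ε).const_mul (2 * Real.pi)
    have hp : 0 < 2 * Real.pi * (ε * t) := by positivity
    refine ((h.sqrt hp.ne').inv (Real.sqrt_pos.2 hp).ne').congr_deriv ?_
    have h3 := Real.sq_sqrt hp.le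
    simp only [hK]
    have h4 := (Real.sqrt_pos.2 hp).ne'
    rw [h3]
    field_simp
  have hMt : HasDerivAt (fun t => expMoment f 0 (2 * s t * x) (s t))
      (expMoment f 1 (2 * s t * x) (s t) * (2 * (-(s t) / t) * x)
        - expMoment f 2 (2 * s t * x) (s t) * (-(s t) / t)) t := by
    have hF := hasFDerivAt_of_partials (f := expMoment f 0)
      (ft := fun a s => -expMoment f 2 a s) (z := (2 * s t * x, s t))
      (isOpen_univ.prod isOpen_Ioi)
      (fun z hz => hf.hasDerivAt_expMoment_fst 0 z.1 hz.2)
      (fun z hz => hf.hasDerivAt_expMoment_snd 0 z.1 hz.2) (hf.continuousOn_expMoment 1)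
      (hf.continuousOn_expMoment 2).neg ⟨trivial, hst⟩
    have hc := hF.comp_hasDerivAt (f := fun t => (2 * s t * x, s t)) t
      (((hsd.const_mul 2).mul_const x).prodMk hsd)
    refine hc.congr_deriv ?_
    simp
    ring
  have hEt : HasDerivAt (fun t => Real.exp (-s t * x ^ 2))
      (Real.exp (-s t * x ^ 2) * (s t / t * x ^ 2)) t :=
    ((hsd.neg).mul_const (x ^ 2)).exp.congr_deriv (by simp; ring)
  have h3 : HasDerivAt (fun t => heatFlow ε f x t) _ t :=
    hasDerivAt_congr_pos (f := fun t => K t * Real.exp (-s t * x ^ 2) *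
      expMoment f 0 (2 * s t * x) (s t)) (fun t ht => (heatFlow_eq_expMoment hε ht hf.meas).symm) ht
      ((hKd.mul hEt).mul hMt)
  have hst2 : s t * (2 * ε * t) = 1 := by simp only [hs]; field_simp
  rw [h2, show dt (heatFlow ε f) x t = _ from h3.deriv]
  have hεt : ε = 1 / (2 * t * s t) := by simp only [hs]; field_simp
  rw [hεt]
  simp only [id, Pi.mul_apply]
  field_simp
  ring

end HeatFlow

section HeatFlowBounds

variable {ε : ℝ} {f g : ℝ → ℝ} {x t : ℝ}

lemma integrable_exp_abs_gaussian (C : ℝ) :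
    Integrable (fun z : ℝ => Real.exp (C * |z|)) (ProbabilityTheory.gaussianReal 0 1) := by
  refine ((ProbabilityTheory.integrable_exp_mul_gaussianReal C).add
    (ProbabilityTheory.integrable_exp_mul_gaussianReal (-C))).mono'
    (Continuous.aestronglyMeasurable (by fun_prop)) (.of_forall fun z => ?_)
  rw [Real.norm_eq_abs, Real.abs_exp]
  rcases abs_cases z with ⟨h, -⟩ | ⟨h, -⟩ <;> rw [h]
  · simpa using (Real.exp_pos (-C * z)).le
  · simpa using (Real.exp_pos (C * z)).le

lemma measurable_heatFlow_integrand (hf : Measurable f) :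
    AEStronglyMeasurable (fun z => f (x + √(ε * t) * z)) (ProbabilityTheory.gaussianReal 0 1) :=
  (hf.comp (by fun_prop)).aestronglyMeasurable

lemma heatFlow_integrand_bound {C X R : ℝ} (hC0 : 0 ≤ C)
    (hC : ∀ y, |f y| ≤ C * Real.exp (C * |y|)) (hx : |x| ≤ X) (ht : √(ε * t) ≤ R) (z : ℝ) :
    |f (x + √(ε * t) * z)| ≤ C * Real.exp (C * X) * Real.exp (C * R * |z|) := by
  have h1 : |x + √(ε * t) * z| ≤ X + R * |z| := by
    refine (abs_add_le _ _).trans (add_le_add hx ?_)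
    rw [abs_mul, abs_of_nonneg (Real.sqrt_nonneg _)]
    exact mul_le_mul_of_nonneg_right ht (abs_nonneg z)
  calc _ ≤ C * Real.exp (C * |x + √(ε * t) * z|) := hC _
    _ ≤ C * Real.exp (C * (X + R * |z|)) := by gcongr
    _ = _ := by rw [mul_add, Real.exp_add]; ring_nf

lemma integrable_heatFlow_integrand (hf : ExpBounded f) :
    Integrable (fun z => f (x + √(ε * t) * z)) (ProbabilityTheory.gaussianReal 0 1) := by
  obtain ⟨C, hC0, hC⟩ := hf.bound
  refine ((integrable_exp_abs_gaussian (C * √(ε * t))).const_mul (C * Real.exp (C * |x|))).mono'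
    (measurable_heatFlow_integrand hf.meas) (.of_forall fun z => ?_)
  rw [Real.norm_eq_abs]
  exact heatFlow_integrand_bound hC0 hC le_rfl le_rfl z

lemma heatFlow_add (hf : ExpBounded f) (hg : ExpBounded g) :
    heatFlow ε (fun y => f y + g y) x t = heatFlow ε f x t + heatFlow ε g x t :=
  integral_add (integrable_heatFlow_integrand hf) (integrable_heatFlow_integrand hg)

lemma heatFlow_const_mul (c : ℝ) : heatFlow ε (fun y => c * f y) x t = c * heatFlow ε f x t :=
  integral_const_mul _ _

lemma heatFlow_mono (hf : ExpBounded f) (hg : ExpBounded g) (h : ∀ y, f y ≤ g y) :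
    heatFlow ε f x t ≤ heatFlow ε g x t :=
  integral_mono (integrable_heatFlow_integrand hf) (integrable_heatFlow_integrand hg)
    fun _ => h _

lemma heatFlow_bound (hε : 0 < ε) (hf : ExpBounded f) (T : ℝ) :
    ∃ M, 0 ≤ M ∧ ∀ x, ∀ t ≤ T, |heatFlow ε f x t| ≤ M * Real.exp (M * |x|) := by
  obtain ⟨C, hC0, hC⟩ := hf.bound
  set I := ∫ z, Real.exp (C * √(ε * T) * |z|) ∂(ProbabilityTheory.gaussianReal 0 1) with hI
  have hI0 : 0 ≤ I := integral_nonneg fun z => (Real.exp_pos _).le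
  refine ⟨max (C * I) C, le_max_of_le_right hC0, fun x t ht => ?_⟩
  have h1 : |heatFlow ε f x t| ≤ C * Real.exp (C * |x|) * I := by
    rw [hI, ← integral_const_mul]
    refine norm_integral_le_of_norm_le (G := ℝ) (f := fun z => f (x + √(ε * t) * z))
      ((integrable_exp_abs_gaussian _).const_mul _)
      (.of_forall fun z => ?_)
    rw [Real.norm_eq_abs]
    refine heatFlow_integrand_bound hC0 hC le_rfl ?_ z
    exact Real.sqrt_le_sqrt (mul_le_mul_of_nonneg_left ht hε.le)
  refine h1.trans ?_
  calc C * Real.exp (C * |x|) * I = (C * I) * Real.exp (C * |x|) := by ring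
    _ ≤ _ := by
      gcongr
      · exact le_max_left _ _
      · exact le_max_right _ _

/-- The initial values are attained at every continuity point. -/
lemma continuousAt_heatFlow_init (hf : ExpBounded f) (hc : ContinuousAt f x) :
    ContinuousAt (fun z : ℝ × ℝ => heatFlow ε f z.1 z.2) (x, 0) := by
  obtain ⟨C, hC0, hC⟩ := hf.bound
  refine continuousAt_of_dominated (bound := fun z => C * Real.exp (C * (|x| + 1)) *
      Real.exp (C * 1 * |z|)) (.of_forall fun z => measurable_heatFlow_integrand hf.meas) ?_
    ((integrable_exp_abs_gaussian _).const_mul _) (.of_forall fun z => ?_)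
  · have h1 : ContinuousAt (fun v : ℝ × ℝ => |v.1|) (x, (0 : ℝ)) := by fun_prop
    have h2 : ContinuousAt (fun v : ℝ × ℝ => √(ε * v.2)) (x, (0 : ℝ)) := by fun_prop
    filter_upwards [h1.eventually (Iio_mem_nhds (show |x| < |x| + 1 by linarith)),
      h2.eventually (Iio_mem_nhds (show √(ε * 0) < 1 by simp))] with v hv1 hv2
    exact .of_forall fun z => heatFlow_integrand_bound hC0 hC (le_of_lt hv1) (le_of_lt hv2) z
  · have h1 : ContinuousAt (fun v : ℝ × ℝ => v.1 + √(ε * v.2) * z) (x, (0 : ℝ)) := by fun_prop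
    exact ContinuousAt.comp_of_eq hc h1 (by simp)

lemma heatFlow_init : heatFlow ε f x 0 = f x := by simp [heatFlow]

end HeatFlowBounds

/-! ### Odd data and the Dirichlet problem -/

/-- The odd extension of the restriction of `h` to `x > 0`. -/
noncomputable def oddExt (h : ℝ → ℝ) (y : ℝ) : ℝ := Real.sign y * (Ioi 0).indicator h |y|

/-- Data on the half-line `x > 0` which are measurable and of at most exponential growth. -/
structure HalfExpBounded (h : ℝ → ℝ) : Prop where
  meas : Measurable ((Ioi 0).indicator h)
  bound : ∃ C, 0 ≤ C ∧ ∀ y > 0, |h y| ≤ C * Real.exp (C * y)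

section OddExt

variable {ε : ℝ} {h k : ℝ → ℝ} {x t : ℝ}

lemma oddExt_of_pos {y : ℝ} (hy : 0 < y) : oddExt h y = h y := by
  simp [oddExt, Real.sign_of_pos hy, abs_of_pos hy, hy]

lemma oddExt_of_neg {y : ℝ} (hy : y < 0) : oddExt h y = -h (-y) := by
  simp [oddExt, Real.sign_of_neg hy, abs_of_neg hy, hy]

lemma oddExt_zero : oddExt h 0 = 0 := by simp [oddExt]

lemma oddExt_neg (y : ℝ) : oddExt h (-y) = -oddExt h y := by
  simp [oddExt, Real.sign_neg]

lemma measurable_sign_real : Measurable Real.sign := by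
  unfold Real.sign
  exact Measurable.ite measurableSet_Iio measurable_const
    (Measurable.ite measurableSet_Ioi measurable_const measurable_const)

lemma HalfExpBounded.expBounded_oddExt (hh : HalfExpBounded h) : ExpBounded (oddExt h) := by
  obtain ⟨C, hC0, hC⟩ := hh.bound
  refine ⟨measurable_sign_real.mul (hh.meas.comp measurable_id.abs), C, hC0, fun y => ?_⟩
  rcases lt_trichotomy y 0 with hy | rfl | hy
  · rw [oddExt_of_neg hy, abs_neg, abs_of_neg hy]; exact hC _ (by linarith)
  · rw [oddExt_zero]; simpa using hC0
  · rw [oddExt_of_pos hy, abs_of_pos hy]; exact hC _ hy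

lemma HalfExpBounded.add (hh : HalfExpBounded h) (hk : HalfExpBounded k) :
    HalfExpBounded fun y => h y + k y := by
  obtain ⟨C, hC0, hC⟩ := hh.bound
  obtain ⟨D, hD0, hD⟩ := hk.bound
  refine ⟨by simpa [indicator_add, Pi.add_def] using hh.meas.add hk.meas,
    C + D, by positivity, fun y hy => ?_⟩
  calc |h y + k y| ≤ |h y| + |k y| := abs_add_le _ _
    _ ≤ C * Real.exp ((C + D) * y) + D * Real.exp ((C + D) * y) := by
        refine add_le_add ((hC y hy).trans ?_) ((hD y hy).trans ?_) <;> gcongr <;> linarith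
    _ = _ := by ring

lemma HalfExpBounded.mul (hh : HalfExpBounded h) (hk : HalfExpBounded k) :
    HalfExpBounded fun y => h y * k y := by
  obtain ⟨C, hC0, hC⟩ := hh.bound
  obtain ⟨D, hD0, hD⟩ := hk.bound
  refine ⟨by simpa [indicator_mul, Pi.mul_def] using hh.meas.mul hk.meas,
    C * D + (C + D), by positivity,
    fun y hy => ?_⟩
  have h1 : 0 ≤ C * D := by positivity
  calc |h y * k y| = |h y| * |k y| := abs_mul _ _
    _ ≤ (C * Real.exp (C * y)) * (D * Real.exp (D * y)) :=
        mul_le_mul (hC y hy) (hD y hy) (abs_nonneg _) (by positivity)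
    _ = (C * D) * Real.exp ((C + D) * y) := by rw [add_mul, Real.exp_add]; ring
    _ ≤ _ := by
        have h2 : (C + D) * y ≤ (C * D + (C + D)) * y :=
          mul_le_mul_of_nonneg_right (by linarith) (le_of_lt hy)
        exact mul_le_mul (by linarith) (Real.exp_le_exp.2 h2) (Real.exp_pos _).le (by positivity)

lemma HalfExpBounded.of_continuousOn (hc : ContinuousOn h (Ioi 0)) {C : ℝ} (hC0 : 0 ≤ C)
    (hC : ∀ y > 0, |h y| ≤ C * Real.exp (C * y)) : HalfExpBounded h :=
  ⟨by
    rw [← piecewise_eq_indicator]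
    exact hc.measurable_piecewise (g := 0) continuousOn_const measurableSet_Ioi, C, hC0, hC⟩

lemma HalfExpBounded.const (c : ℝ) : HalfExpBounded fun _ => c := by
  refine ⟨measurable_const.indicator measurableSet_Ioi, |c|, abs_nonneg c, fun y hy => ?_⟩
  have h1 : 1 ≤ Real.exp (|c| * y) := Real.one_le_exp (mul_nonneg (abs_nonneg c) (le_of_lt hy))
  nlinarith [abs_nonneg c]

lemma heatFlow_oddExt_zero : heatFlow ε (oddExt h) 0 t = 0 := by
  have h1 : heatFlow ε (oddExt h) 0 t = -heatFlow ε (oddExt h) 0 t := by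
    conv_lhs => rw [heatFlow]
    rw [heatFlow, ← integral_neg]
    have h2 := integral_map_equiv (μ := ProbabilityTheory.gaussianReal 0 1) (MeasurableEquiv.neg ℝ)
      (fun z => oddExt h (0 + √(ε * t) * z))
    rw [show (⇑(MeasurableEquiv.neg ℝ) : ℝ → ℝ) = fun z => -z from rfl,
      ProbabilityTheory.gaussianReal_map_neg, neg_zero] at h2
    rw [h2]
    congr 1; ext z
    rw [← oddExt_neg]; congr 1; ring
  linarith

/-- Reflection formula: on odd data the heat flow has the Dirichlet kernel of the half-line. -/
lemma heatFlow_oddExt_eq (hε : 0 < ε) (hh : HalfExpBounded h) (ht : 0 < t) :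
    IntegrableOn (fun y => (Real.exp (-(y - x) ^ 2 / (2 * (ε * t)))
        - Real.exp (-(y + x) ^ 2 / (2 * (ε * t)))) * h y) (Ioi 0) ∧
    heatFlow ε (oddExt h) x t = (√(2 * Real.pi * (ε * t)))⁻¹ *
      ∫ y in Ioi 0, (Real.exp (-(y - x) ^ 2 / (2 * (ε * t)))
        - Real.exp (-(y + x) ^ 2 / (2 * (ε * t)))) * h y := by
  have hf := hh.expBounded_oddExt
  set F : ℝ → ℝ := fun y => Real.exp (-(y - x) ^ 2 / (2 * (ε * t))) * oddExt h y with hF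
  have hs : 0 < 1 / (2 * ε * t) := by positivity
  have hFi : Integrable F := by
    refine ((hf.integrable_moment 0 (2 * (1 / (2 * ε * t)) * x) hs).const_mul
      (Real.exp (-(1 / (2 * ε * t)) * x ^ 2))).congr (.of_forall fun y => ?_)
    have : -(y - x) ^ 2 / (2 * (ε * t)) = -(1 / (2 * ε * t)) * x ^ 2
        + (2 * (1 / (2 * ε * t)) * x * y - 1 / (2 * ε * t) * y ^ 2) := by
      field_simp; ring
    simp only [hF]
    rw [this, Real.exp_add]; ring
  have hFn : Integrable fun y => F (-y) := hFi.comp_neg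
  have e : EqOn (fun y => F y + F (-y)) (fun y => (Real.exp (-(y - x) ^ 2 / (2 * (ε * t)))
        - Real.exp (-(y + x) ^ 2 / (2 * (ε * t)))) * h y) (Ioi 0) := by
    intro y hy
    have h1 : (-y - x) ^ 2 = (y + x) ^ 2 := by ring
    simp only [hF, oddExt_neg, oddExt_of_pos hy, h1]
    ring
  refine ⟨((hFi.add hFn).integrableOn).congr_fun e measurableSet_Ioi, ?_⟩
  rw [heatFlow_eq_integral hε ht hf.meas, ← setIntegral_congr_fun measurableSet_Ioi e,
    integral_add hFi.integrableOn hFn.integrableOn, integral_comp_neg_Ioi 0 F, neg_zero, add_comm,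
    intervalIntegral.integral_Iic_add_Ioi hFi.integrableOn hFi.integrableOn, ← integral_const_mul]
  congr 1; ext y
  simp only [hF]; ring

lemma dirichletKernel_nonneg (hε : 0 < ε) (ht : 0 < t) (hx : 0 ≤ x) {y : ℝ} (hy : 0 < y) :
    0 ≤ Real.exp (-(y - x) ^ 2 / (2 * (ε * t))) - Real.exp (-(y + x) ^ 2 / (2 * (ε * t))) := by
  rw [sub_nonneg, Real.exp_le_exp]
  gcongr ?_ / _
  nlinarith [mul_nonneg hx hy.le]

lemma dirichletKernel_pos (hε : 0 < ε) (ht : 0 < t) (hx : 0 < x) {y : ℝ} (hy : 0 < y) :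
    0 < Real.exp (-(y - x) ^ 2 / (2 * (ε * t))) - Real.exp (-(y + x) ^ 2 / (2 * (ε * t))) := by
  rw [sub_pos, Real.exp_lt_exp]
  gcongr ?_ / _
  nlinarith [mul_pos hx hy]

lemma heatFlow_oddExt_mono (hε : 0 < ε) (hh : HalfExpBounded h) (hk : HalfExpBounded k)
    (hle : ∀ y > 0, h y ≤ k y) (hx : 0 ≤ x) (ht : 0 < t) :
    heatFlow ε (oddExt h) x t ≤ heatFlow ε (oddExt k) x t := by
  obtain ⟨i1, e1⟩ := heatFlow_oddExt_eq (x := x) hε hh ht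
  obtain ⟨i2, e2⟩ := heatFlow_oddExt_eq (x := x) hε hk ht
  rw [e1, e2]
  refine mul_le_mul_of_nonneg_left (setIntegral_mono_on i1 i2 measurableSet_Ioi fun y hy => ?_)
    (by positivity)
  exact mul_le_mul_of_nonneg_left (hle y hy) (dirichletKernel_nonneg hε ht hx hy)

lemma heatFlow_oddExt_pos (hε : 0 < ε) (hh : HalfExpBounded h) (hpos : ∀ y > 0, 0 < h y)
    (hx : 0 < x) (ht : 0 < t) : 0 < heatFlow ε (oddExt h) x t := by
  obtain ⟨i1, e1⟩ := heatFlow_oddExt_eq (x := x) hε hh ht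
  rw [e1]
  refine mul_pos (by positivity) ?_
  have hp : ∀ y ∈ Ioi (0 : ℝ), 0 < (Real.exp (-(y - x) ^ 2 / (2 * (ε * t)))
        - Real.exp (-(y + x) ^ 2 / (2 * (ε * t)))) * h y := fun y hy =>
    mul_pos (dirichletKernel_pos hε ht hx hy) (hpos y hy)
  rw [setIntegral_pos_iff_support_of_nonneg_ae
    ((ae_restrict_iff' measurableSet_Ioi).2 (.of_forall fun y hy => (hp y hy).le)) i1]
  have : Function.support (fun y => (Real.exp (-(y - x) ^ 2 / (2 * (ε * t)))
        - Real.exp (-(y + x) ^ 2 / (2 * (ε * t)))) * h y) ∩ Ioi 0 = Ioi 0 :=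
    inter_eq_right.2 fun y hy => (hp y hy).ne'
  rw [this]; simp

lemma heatFlow_oddExt_add (hh : HalfExpBounded h) (hk : HalfExpBounded k) :
    heatFlow ε (oddExt fun y => h y + k y) x t
      = heatFlow ε (oddExt h) x t + heatFlow ε (oddExt k) x t := by
  rw [← heatFlow_add hh.expBounded_oddExt hk.expBounded_oddExt]
  congr 1; ext y
  simp only [oddExt, indicator_add]
  ring

lemma heatFlow_oddExt_const_mul (c : ℝ) :
    heatFlow ε (oddExt fun y => c * h y) x t = c * heatFlow ε (oddExt h) x t := by
  rw [← heatFlow_const_mul]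
  congr 1; ext y
  simp only [oddExt, indicator_mul_right]
  by_cases hy : 0 < |y| <;> simp [hy]; ring

lemma continuousAt_oddExt (hx : 0 < x) (hc : ContinuousAt h x) : ContinuousAt (oddExt h) x := by
  refine hc.congr ?_
  filter_upwards [Ioi_mem_nhds hx] with y hy using (oddExt_of_pos hy).symm

lemma tendsto_heatFlow_oddExt (hh : HalfExpBounded h) (hx : 0 < x) (hc : ContinuousAt h x) :
    Tendsto (fun z : ℝ × ℝ => heatFlow ε (oddExt h) z.1 z.2) (𝓝 (x, 0)) (𝓝 (h x)) := by
  have := continuousAt_heatFlow_init (ε := ε) hh.expBounded_oddExt (continuousAt_oddExt hx hc)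
  rwa [ContinuousAt, heatFlow_init, oddExt_of_pos hx] at this

end OddExt

/-! ### The double layer potential of Dirichlet boundary data -/

/-- Boundary data on `t > 0` which are continuous and bounded on each `(0, T]`. -/
structure BoundaryData (β : ℝ → ℝ) : Prop where
  cont : ContinuousOn β (Ioi 0)
  bound : ∀ T, ∃ M, ∀ t ∈ Ioc 0 T, |β t| ≤ M

/-- The solution of `v_t = (ε/2) v_xx` in the quarter plane with boundary values `β` and zero
initial values. The hitting time of the origin by a Brownian motion of variance `ε` started at
`x` is distributed as `x² / (ε Z²)` for a standard Gaussian `Z`. -/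
noncomputable def doubleLayer (ε : ℝ) (β : ℝ → ℝ) (x t : ℝ) : ℝ :=
  ∫ z, (Ioi 0).indicator β (t - x ^ 2 / (ε * z ^ 2)) ∂(ProbabilityTheory.gaussianReal 0 1)

/-- The functions `τ ^ (-j - 1/2) exp (-x² / (2 ε τ))`, extended by zero to `τ ≤ 0`; the case
`j = 1` is the double layer kernel up to the factor `x / √(2 π ε)`. -/
noncomputable def layerKernel (ε : ℝ) (j : ℕ) (x τ : ℝ) : ℝ :=
  if τ ≤ 0 then 0 else (√τ)⁻¹ * τ⁻¹ ^ j * Real.exp (-(x ^ 2 / (2 * ε)) / τ)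

/-- Convolution in time of `layerKernel` with boundary data. -/
noncomputable def layerIntegral (ε : ℝ) (β : ℝ → ℝ) (j : ℕ) (x t : ℝ) : ℝ :=
  ∫ s, layerKernel ε j x (t - s) * (Ioi 0).indicator β s

section LayerKernel

variable {ε x τ : ℝ} {j : ℕ}

lemma layerKernel_of_nonpos (h : τ ≤ 0) : layerKernel ε j x τ = 0 := by simp [layerKernel, h]

lemma layerKernel_of_pos (h : 0 < τ) :
    layerKernel ε j x τ = (√τ)⁻¹ * τ⁻¹ ^ j * Real.exp (-(x ^ 2 / (2 * ε)) / τ) := by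
  simp [layerKernel, h.not_ge]

lemma layerKernel_nonneg : 0 ≤ layerKernel ε j x τ := by
  unfold layerKernel
  split_ifs with h
  · rfl
  · push Not at h; positivity

lemma sq_mul_layerKernel : layerKernel ε j x τ = τ ^ 2 * layerKernel ε (j + 2) x τ := by
  rcases le_or_gt τ 0 with h | h
  · simp [layerKernel_of_nonpos h]
  · rw [layerKernel_of_pos h, layerKernel_of_pos h, pow_add]
    field_simp

lemma pow_mul_exp_neg_le {b y : ℝ} (hb : 0 < b) (hy : 0 ≤ y) (n : ℕ) :
    y ^ n * Real.exp (-(b * y)) ≤ n.factorial / b ^ n := by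
  have h := Real.pow_div_factorial_le_exp (b * y) (by positivity) n
  rw [div_le_iff₀ (by positivity), mul_pow] at h
  rw [Real.exp_neg, ← div_eq_mul_inv, div_le_div_iff₀ (Real.exp_pos _) (by positivity)]
  linarith

/-- The kernels are bounded, uniformly in `τ`, away from `x = 0`. -/
lemma exists_layerKernel_bound (hε : 0 < ε) (j : ℕ) {c : ℝ} (hc : 0 < c) :
    ∃ C, 0 ≤ C ∧ ∀ x ≥ c, ∀ τ, |layerKernel ε j x τ| ≤ C := by
  set b := c ^ 2 / (2 * ε) with hb
  have hb0 : 0 < b := by positivity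
  refine ⟨j.factorial / b ^ j + (j + 1).factorial / b ^ (j + 1), by positivity,
    fun x hx τ => ?_⟩
  rcases le_or_gt τ 0 with h | h
  · rw [layerKernel_of_nonpos h, abs_zero]; positivity
  · rw [abs_of_nonneg layerKernel_nonneg, layerKernel_of_pos h]
    have h1 : (√τ)⁻¹ ≤ 1 + τ⁻¹ := by
      rw [← Real.sqrt_inv]
      have h2 := Real.sq_sqrt (inv_pos.2 h).le
      nlinarith [sq_nonneg (√τ⁻¹ - 1), Real.sqrt_nonneg τ⁻¹]
    have h3 : Real.exp (-(x ^ 2 / (2 * ε)) / τ) ≤ Real.exp (-(b * τ⁻¹)) := by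
      rw [Real.exp_le_exp, div_eq_mul_inv, neg_mul, neg_le_neg_iff]
      have : c ^ 2 ≤ x ^ 2 := by gcongr
      rw [hb]; gcongr
    calc (√τ)⁻¹ * τ⁻¹ ^ j * Real.exp (-(x ^ 2 / (2 * ε)) / τ)
        ≤ (1 + τ⁻¹) * τ⁻¹ ^ j * Real.exp (-(b * τ⁻¹)) := by gcongr
      _ = τ⁻¹ ^ j * Real.exp (-(b * τ⁻¹)) + τ⁻¹ ^ (j + 1) * Real.exp (-(b * τ⁻¹)) := by ring
      _ ≤ _ := add_le_add (pow_mul_exp_neg_le hb0 (by positivity) j)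
          (pow_mul_exp_neg_le hb0 (by positivity) (j + 1))

lemma hasDerivAt_layerKernel_x (hε : 0 < ε) :
    HasDerivAt (fun x => layerKernel ε j x τ) (-(x / ε) * layerKernel ε (j + 1) x τ) x := by
  rcases le_or_gt τ 0 with h | h
  · simp only [layerKernel_of_nonpos h, mul_zero]; exact hasDerivAt_const _ _
  · simp only [layerKernel_of_pos h]
    have h1 : HasDerivAt (fun x : ℝ => -(x ^ 2 / (2 * ε)) / τ) (-(x / ε) * τ⁻¹) x :=
      (((hasDerivAt_pow 2 x).div_const (2 * ε)).neg.div_const τ).congr_deriv (by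
        simp; field_simp)
    exact (h1.exp.const_mul ((√τ)⁻¹ * τ⁻¹ ^ j)).congr_deriv (by ring)

lemma hasDerivAt_layerKernel_of_pos (h : 0 < τ) :
    HasDerivAt (layerKernel ε j x) (-(j + 1 / 2) * layerKernel ε (j + 1) x τ
      + x ^ 2 / (2 * ε) * layerKernel ε (j + 2) x τ) τ := by
  refine hasDerivAt_congr_pos (f := fun τ => (√τ)⁻¹ * τ⁻¹ ^ j *
    Real.exp (-(x ^ 2 / (2 * ε)) / τ)) (fun τ h => (layerKernel_of_pos h).symm) h ?_
  rw [layerKernel_of_pos h, layerKernel_of_pos h]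
  have h4 := Real.sq_sqrt h.le
  have h5 := (Real.sqrt_pos.2 h).ne'
  have h1 : HasDerivAt (fun τ => (√τ)⁻¹) (-(1 / 2) * (√τ)⁻¹ * τ⁻¹) τ :=
    ((Real.hasDerivAt_sqrt h.ne').inv h5).congr_deriv (by rw [h4]; field_simp)
  have h2 : HasDerivAt (fun τ => τ⁻¹ ^ j) (-j * τ⁻¹ ^ (j + 1)) τ := by
    refine ((hasDerivAt_inv h.ne').pow j).congr_deriv ?_
    rcases j with _ | j
    · simp
    · simp only [Nat.add_sub_cancel, inv_pow]
      field_simp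
      ring
  have h3 : HasDerivAt (fun τ => Real.exp (-(x ^ 2 / (2 * ε)) / τ))
      (Real.exp (-(x ^ 2 / (2 * ε)) / τ) * (x ^ 2 / (2 * ε) * τ⁻¹ ^ 2)) τ :=
    ((hasDerivAt_const τ (-(x ^ 2 / (2 * ε)))).div (hasDerivAt_id τ) h.ne').exp.congr_deriv
      (by simp; field_simp)
  exact ((h1.mul h2).mul h3).congr_deriv (by simp only [Pi.mul_apply]; ring)

lemma hasDerivAt_layerKernel (hε : 0 < ε) (hx : 0 < x) :
    HasDerivAt (layerKernel ε j x) (-(j + 1 / 2) * layerKernel ε (j + 1) x τ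
      + x ^ 2 / (2 * ε) * layerKernel ε (j + 2) x τ) τ := by
  rcases lt_trichotomy τ 0 with h | rfl | h
  · rw [layerKernel_of_nonpos h.le, layerKernel_of_nonpos h.le]
    simp only [mul_zero, add_zero]
    refine (hasDerivAt_const τ (0 : ℝ)).congr_of_eventuallyEq ?_
    filter_upwards [Iio_mem_nhds h] with s hs using layerKernel_of_nonpos (le_of_lt hs)
  · -- at `τ = 0` the kernel is flat, being `τ²` times a bounded function
    obtain ⟨C, hC0, hC⟩ := exists_layerKernel_bound hε (j + 2) hx
    rw [layerKernel_of_nonpos le_rfl, layerKernel_of_nonpos le_rfl]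
    simp only [mul_zero, add_zero]
    rw [hasDerivAt_iff_isLittleO_nhds_zero]
    have h1 : (fun h : ℝ => layerKernel ε j x (0 + h) - layerKernel ε j x 0 - h • (0 : ℝ))
        =O[𝓝 0] fun h : ℝ => h ^ 2 := by
      refine Asymptotics.IsBigO.of_bound C (.of_forall fun h => ?_)
      rw [layerKernel_of_nonpos le_rfl, zero_add, smul_zero, sub_zero, sub_zero,
        sq_mul_layerKernel, norm_mul, mul_comm]
      exact mul_le_mul_of_nonneg_right (hC x le_rfl h) (norm_nonneg _)
    exact h1.trans_isLittleO (Asymptotics.isLittleO_pow_id one_lt_two)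
  · exact hasDerivAt_layerKernel_of_pos h

lemma continuous_layerKernel (hε : 0 < ε) (hx : 0 < x) : Continuous (layerKernel ε j x) :=
  continuous_iff_continuousAt.2 fun _ => (hasDerivAt_layerKernel hε hx).continuousAt

lemma continuousAt_layerKernel (h : τ ≠ 0) :
    ContinuousAt (fun z : ℝ × ℝ => layerKernel ε j z.1 z.2) (x, τ) := by
  rcases lt_or_gt_of_ne h with h | h
  · refine (continuousAt_const (y := (0 : ℝ))).congr ?_
    filter_upwards [continuousAt_snd.eventually (Iio_mem_nhds h)] with z hz
    exact (layerKernel_of_nonpos (le_of_lt hz)).symm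
  · have h1 : ContinuousAt (fun z : ℝ × ℝ => (√z.2)⁻¹ * z.2⁻¹ ^ j *
        Real.exp (-(z.1 ^ 2 / (2 * ε)) / z.2)) (x, τ) := by
      have h0 : (x, τ).2 ≠ 0 := h.ne'
      have hs : √(x, τ).2 ≠ 0 := (Real.sqrt_pos.2 h).ne'
      fun_prop (disch := assumption)
    refine h1.congr ?_
    filter_upwards [continuousAt_snd.eventually (Ioi_mem_nhds h)] with z hz
    exact (layerKernel_of_pos hz).symm

end LayerKernel

section LayerIntegral

variable {ε x t : ℝ} {β : ℝ → ℝ} {j : ℕ}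

namespace BoundaryData

lemma measurable_indicator (hβ : BoundaryData β) : Measurable ((Ioi 0).indicator β) := by
  rw [← piecewise_eq_indicator]
  exact hβ.cont.measurable_piecewise (g := 0) continuousOn_const measurableSet_Ioi

lemma indicator_bound (hβ : BoundaryData β) (T : ℝ) :
    ∃ M, 0 ≤ M ∧ ∀ t ≤ T, |(Ioi 0).indicator β t| ≤ M := by
  obtain ⟨M, hM⟩ := hβ.bound T
  refine ⟨|M|, abs_nonneg M, fun t ht => ?_⟩
  by_cases h : 0 < t
  · simpa [h] using (hM t ⟨h, ht⟩).trans (le_abs_self M)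
  · simp [h]

lemma continuousAt_indicator (hβ : BoundaryData β) (ht : t ≠ 0) :
    ContinuousAt ((Ioi 0).indicator β) t := by
  rcases lt_or_gt_of_ne ht with h | h
  · refine (continuousAt_const (y := (0 : ℝ))).congr ?_
    filter_upwards [Iio_mem_nhds h] with s hs
    have : ¬ 0 < s := not_lt.2 (le_of_lt hs)
    simp [this]
  · refine (hβ.cont.continuousAt (Ioi_mem_nhds h)).congr ?_
    filter_upwards [Ioi_mem_nhds h] with s hs
    simp [show 0 < s from hs]

/-- Domination of the integrands of `layerIntegral`: the kernel is bounded away from `x = 0`, and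
only the times `s ∈ (0, T]` contribute. -/
lemma exists_layer_bound (hβ : BoundaryData β) (hε : 0 < ε) (j : ℕ) {c : ℝ} (hc : 0 < c) (T : ℝ) :
    ∃ C, ∀ x ≥ c, ∀ t ≤ T, ∀ s,
      |layerKernel ε j x (t - s) * (Ioi 0).indicator β s| ≤ (Ioc 0 T).indicator (fun _ => C) s := by
  obtain ⟨C, hC0, hC⟩ := exists_layerKernel_bound hε j hc
  obtain ⟨M, hM0, hM⟩ := hβ.indicator_bound T
  refine ⟨C * M, fun x hx t ht s => ?_⟩
  by_cases hs : s ∈ Ioc 0 T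
  · rw [indicator_of_mem hs, abs_mul]
    exact mul_le_mul (hC x hx _) (hM s hs.2) (abs_nonneg _) hC0
  · rw [indicator_of_notMem hs]
    rcases le_or_gt s 0 with h | h
    · have : ¬ 0 < s := not_lt.2 h
      simp [this]
    · have : T < s := by
        by_contra! h'
        exact hs ⟨h, h'⟩
      rw [layerKernel_of_nonpos (by linarith), zero_mul, abs_zero]

lemma integrable_layer_bound (C T : ℝ) : Integrable ((Ioc 0 T).indicator fun _ : ℝ => C) :=
  (integrable_indicator_iff measurableSet_Ioc).2 (integrableOn_const (by simp))

lemma layer_meas (hβ : BoundaryData β) (hε : 0 < ε) (hx : 0 < x) (j : ℕ) (t : ℝ) :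
    AEStronglyMeasurable (fun s => layerKernel ε j x (t - s) * (Ioi 0).indicator β s) volume :=
  ((continuous_layerKernel hε hx).comp
    (continuous_const.sub continuous_id)).aestronglyMeasurable.mul
    hβ.measurable_indicator.aestronglyMeasurable

lemma layer_integrable (hβ : BoundaryData β) (hε : 0 < ε) (hx : 0 < x) (j : ℕ) (t : ℝ) :
    Integrable fun s => layerKernel ε j x (t - s) * (Ioi 0).indicator β s := by
  obtain ⟨C, hC⟩ := hβ.exists_layer_bound hε j hx t
  exact (integrable_layer_bound C t).mono' (hβ.layer_meas hε hx j t)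
    (.of_forall fun s => hC x le_rfl t le_rfl s)

lemma hasDerivAt_layerIntegral_x (hβ : BoundaryData β) (hε : 0 < ε) (hx : 0 < x) (j : ℕ) (t : ℝ) :
    HasDerivAt (fun x => layerIntegral ε β j x t) (-(x / ε) * layerIntegral ε β (j + 1) x t) x := by
  obtain ⟨C, hC⟩ := hβ.exists_layer_bound hε (j + 1) (half_pos hx) t
  have h := (hasDerivAt_integral_of_dominated_loc_of_deriv_le
    (Ioo_mem_nhds (half_lt_self hx) (lt_two_mul_self hx))
    (by filter_upwards [Ioi_mem_nhds hx] with y hy using hβ.layer_meas hε hy j t)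
    (hβ.layer_integrable hε hx j t)
    (F' := fun y s => -(y / ε) * (layerKernel ε (j + 1) y (t - s) * (Ioi 0).indicator β s))
    ((hβ.layer_meas hε hx (j + 1) t).const_mul _)
    (bound := fun s => 2 * x / ε * (Ioc 0 t).indicator (fun _ => C) s)
    (.of_forall fun s y hy => ?_) ((integrable_layer_bound C t).const_mul _)
    (.of_forall fun s y hy => ?_)).2
  · rwa [integral_const_mul] at h
  · rw [norm_mul, norm_neg]
    refine mul_le_mul ?_ (hC y hy.1.le t le_rfl s) (norm_nonneg _) (by positivity)
    have hy0 : 0 < y := (half_pos hx).trans hy.1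
    rw [Real.norm_eq_abs, abs_of_pos (by positivity)]
    gcongr
    exact hy.2.le
  · exact ((hasDerivAt_layerKernel_x hε).mul_const _).congr_deriv (by ring)

lemma hasDerivAt_layerIntegral_t (hβ : BoundaryData β) (hε : 0 < ε) (hx : 0 < x) (j : ℕ) (t : ℝ) :
    HasDerivAt (fun t => layerIntegral ε β j x t) (-(j + 1 / 2) * layerIntegral ε β (j + 1) x t
      + x ^ 2 / (2 * ε) * layerIntegral ε β (j + 2) x t) t := by
  obtain ⟨C, hC⟩ := hβ.exists_layer_bound hε (j + 1) hx (t + 1)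
  obtain ⟨D, hD⟩ := hβ.exists_layer_bound hε (j + 2) hx (t + 1)
  have i1 := (hβ.layer_integrable hε hx (j + 1) t).const_mul (-((j : ℝ) + 1 / 2))
  have i2 := (hβ.layer_integrable hε hx (j + 2) t).const_mul (x ^ 2 / (2 * ε))
  have h := (hasDerivAt_integral_of_dominated_loc_of_deriv_le
    (Iio_mem_nhds (show t < t + 1 by linarith))
    (.of_forall fun r => hβ.layer_meas hε hx j r) (hβ.layer_integrable hε hx j t)
    (F' := fun r s => -(j + 1 / 2) * (layerKernel ε (j + 1) x (r - s) * (Ioi 0).indicator β s)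
      + x ^ 2 / (2 * ε) * (layerKernel ε (j + 2) x (r - s) * (Ioi 0).indicator β s))
    (i1.add i2).aestronglyMeasurable
    (bound := fun s => (j + 1 / 2) * (Ioc 0 (t + 1)).indicator (fun _ => C) s
      + x ^ 2 / (2 * ε) * (Ioc 0 (t + 1)).indicator (fun _ => D) s)
    (.of_forall fun s r hr => ?_)
    (((integrable_layer_bound C _).const_mul _).add ((integrable_layer_bound D _).const_mul _))
    (.of_forall fun s r hr => ?_)).2
  · rwa [integral_add i1 i2, integral_const_mul, integral_const_mul] at h
  · refine (norm_add_le _ _).trans (add_le_add ?_ ?_)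
    · rw [norm_mul, norm_neg, Real.norm_eq_abs, abs_of_pos (by positivity)]
      exact mul_le_mul_of_nonneg_left (hC x le_rfl r (le_of_lt hr) s) (by positivity)
    · rw [norm_mul, Real.norm_eq_abs, abs_of_pos (by positivity)]
      exact mul_le_mul_of_nonneg_left (hD x le_rfl r (le_of_lt hr) s) (by positivity)
  · have h1 := (hasDerivAt_layerKernel (j := j) hε hx (τ := r - s)).comp_sub_const r s
    exact (h1.mul_const _).congr_deriv (by ring)

lemma continuousOn_layerIntegral (hβ : BoundaryData β) (hε : 0 < ε) (j : ℕ) :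
    ContinuousOn (fun z : ℝ × ℝ => layerIntegral ε β j z.1 z.2) (Ioi 0 ×ˢ univ) := by
  rintro ⟨x, t⟩ ⟨hx, -⟩
  have hx : 0 < x := hx
  obtain ⟨C, hC⟩ := hβ.exists_layer_bound hε j (half_pos hx) (t + 1)
  refine (continuousAt_of_dominated (F := fun (z : ℝ × ℝ) s =>
    layerKernel ε j z.1 (z.2 - s) * (Ioi 0).indicator β s) ?_ ?_
    (integrable_layer_bound C (t + 1)) ?_).continuousWithinAt
  · filter_upwards [continuousAt_fst.eventually (Ioi_mem_nhds hx)] with z hz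
    exact hβ.layer_meas hε hz j z.2
  · filter_upwards [continuousAt_fst.eventually (Ioi_mem_nhds (half_lt_self hx)),
      continuousAt_snd.eventually (Iio_mem_nhds (show t < t + 1 by linarith))] with z hz1 hz2
    exact .of_forall fun s => hC z.1 (le_of_lt hz1) z.2 (le_of_lt hz2) s
  · filter_upwards [(countable_singleton t).ae_notMem volume] with s hs
    have h : t - s ≠ 0 := sub_ne_zero.2 fun h => hs h.symm
    refine ContinuousAt.mul ?_ continuousAt_const
    exact ContinuousAt.comp_of_eq (f := fun z : ℝ × ℝ => (z.1, z.2 - s))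
      (continuousAt_layerKernel (x := x) h) (by fun_prop) rfl

/-- The integrals are smooth for `x > 0`: both partial derivatives are of the same form. -/
lemma contDiffOn_layerIntegral (hβ : BoundaryData β) (hε : 0 < ε) (j : ℕ) :
    ContDiffOn ℝ ∞ (fun z : ℝ × ℝ => layerIntegral ε β j z.1 z.2) (Ioi 0 ×ˢ univ) := by
  rw [contDiffOn_infty]
  intro n
  induction n generalizing j with
  | zero => exact contDiffOn_zero.2 (hβ.continuousOn_layerIntegral hε j)
  | succ n ih =>
    refine contDiffOn_succ_of_partials
      (fx := fun x t => -(x / ε) * layerIntegral ε β (j + 1) x t)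
      (ft := fun x t => -(j + 1 / 2) * layerIntegral ε β (j + 1) x t
        + x ^ 2 / (2 * ε) * layerIntegral ε β (j + 2) x t) (isOpen_Ioi.prod isOpen_univ)
      (fun z hz => hβ.hasDerivAt_layerIntegral_x hε hz.1 j z.2)
      (fun z hz => hβ.hasDerivAt_layerIntegral_t hε hz.1 j z.2) ?_ ?_
    · exact ((contDiffOn_fst.div_const ε).neg).mul (ih (j + 1))
    · exact (contDiffOn_const.mul (ih (j + 1))).add
        (((contDiffOn_fst.pow 2).div_const (2 * ε)).mul (ih (j + 2)))

end BoundaryData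

/-- The double layer potential as a time convolution: substitute `z = x / √(ε τ)`. -/
lemma doubleLayer_eq (hβ : BoundaryData β) (hε : 0 < ε) (hx : 0 < x) :
    doubleLayer ε β x t = (√(2 * Real.pi * ε))⁻¹ * x * layerIntegral ε β 1 x t := by
  set F := (Ioi 0).indicator β with hF
  set φ : ℝ → ℝ := fun z => (√(2 * Real.pi))⁻¹ * Real.exp (-z ^ 2 / 2) *
    F (t - x ^ 2 / (ε * z ^ 2)) with hφ
  obtain ⟨M, hM0, hM⟩ := hβ.indicator_bound t
  have h1 : doubleLayer ε β x t = ∫ z, φ z := by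
    rw [doubleLayer, ProbabilityTheory.integral_gaussianReal_eq_integral_smul one_ne_zero]
    simp [ProbabilityTheory.gaussianPDFReal, hφ, hF]
  have hφi : Integrable φ := by
    have hg := (integrable_exp_neg_mul_sq (b := 1 / 2) (by norm_num)).const_mul
      ((√(2 * Real.pi))⁻¹ * M)
    refine hg.mono' ?_ (.of_forall fun z => ?_)
    · refine AEStronglyMeasurable.mul (Continuous.aestronglyMeasurable (by fun_prop)) ?_
      exact (hβ.measurable_indicator.comp (by fun_prop)).aestronglyMeasurable
    · have h2 : t - x ^ 2 / (ε * z ^ 2) ≤ t := by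
        have : 0 ≤ x ^ 2 / (ε * z ^ 2) := by positivity
        linarith
      rw [norm_mul, Real.norm_eq_abs, Real.norm_eq_abs, abs_of_pos (by positivity)]
      calc (√(2 * Real.pi))⁻¹ * Real.exp (-z ^ 2 / 2) * |F (t - x ^ 2 / (ε * z ^ 2))|
          ≤ (√(2 * Real.pi))⁻¹ * Real.exp (-z ^ 2 / 2) * M := by gcongr; exact hM _ h2
        _ = _ := by rw [show -z ^ 2 / 2 = -(1 / 2) * z ^ 2 by ring]; ring
  -- the integrand is even, so it suffices to substitute on the half-line
  have hφe : ∀ z, φ (-z) = φ z := fun z => by simp [hφ]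
  have h2 : ∫ z, φ z = 2 * ∫ z in Ioi 0, φ z := by
    rw [← intervalIntegral.integral_Iic_add_Ioi (b := 0) hφi.integrableOn hφi.integrableOn]
    have := integral_comp_neg_Ioi 0 φ
    simp only [hφe, neg_zero] at this
    rw [← this]; ring
  set ζ : ℝ → ℝ := fun τ => x / √ε * (√τ)⁻¹ with hζ
  have hsε := Real.sqrt_pos.2 hε
  have hζi : ζ '' Ioi 0 = Ioi 0 := by
    ext z
    constructor
    · rintro ⟨τ, hτ, rfl⟩
      have := Real.sqrt_pos.2 (show 0 < τ from hτ)
      simp only [hζ, mem_Ioi]; positivity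
    · intro hz
      have hz : 0 < z := hz
      refine ⟨(x / √ε / z) ^ 2, by simp only [mem_Ioi]; positivity, ?_⟩
      simp only [hζ]
      rw [Real.sqrt_sq (by positivity)]
      field_simp
  have hζd : ∀ τ ∈ Ioi (0 : ℝ),
      HasDerivWithinAt ζ (x / √ε * (-(1 / 2) * (√τ)⁻¹ * τ⁻¹)) (Ioi 0) τ := by
    intro τ hτ
    have hτ : 0 < τ := hτ
    have h3 := ((Real.hasDerivAt_sqrt hτ.ne').inv (Real.sqrt_pos.2 hτ).ne').const_mul (x / √ε)
    refine (h3.congr_deriv ?_).hasDerivWithinAt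
    have h4 := Real.sq_sqrt hτ.le
    have h5 := (Real.sqrt_pos.2 hτ).ne'
    rw [h4]; field_simp
  have hζinj : InjOn ζ (Ioi 0) := by
    intro a ha b hb hab
    have hne : x / √ε ≠ 0 := by positivity
    have h3 := inv_injective (mul_left_cancel₀ hne hab)
    exact (Real.sqrt_inj (le_of_lt ha) (le_of_lt hb)).1 h3
  have h3 := integral_image_eq_integral_abs_deriv_smul measurableSet_Ioi hζd hζinj φ
  rw [hζi] at h3
  have h4 : ∀ τ ∈ Ioi (0 : ℝ), |x / √ε * (-(1 / 2) * (√τ)⁻¹ * τ⁻¹)| • φ (ζ τ)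
      = (√(2 * Real.pi * ε))⁻¹ * x / 2 * (layerKernel ε 1 x τ * F (t - τ)) := by
    intro τ hτ
    have hτ : 0 < τ := hτ
    have hs := Real.sqrt_pos.2 hτ
    have e1 : |x / √ε * (-(1 / 2) * (√τ)⁻¹ * τ⁻¹)| = x / √ε * (1 / 2 * (√τ)⁻¹ * τ⁻¹) := by
      rw [← abs_neg, abs_of_pos] <;> ring_nf; positivity
    have e2 : ζ τ ^ 2 = x ^ 2 / (ε * τ) := by
      simp only [hζ]
      rw [mul_pow, div_pow, inv_pow, Real.sq_sqrt hε.le, Real.sq_sqrt hτ.le]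
      field_simp
    have e3 : x ^ 2 / (ε * (x ^ 2 / (ε * τ))) = τ := by field_simp
    have e4 : -(x ^ 2 / (ε * τ)) / 2 = -(x ^ 2 / (2 * ε)) / τ := by field_simp
    simp only [hφ, e1, e2, e3, e4, smul_eq_mul, layerKernel_of_pos hτ, pow_one]
    rw [Real.sqrt_mul (by positivity) ε, mul_inv]
    field_simp
  have h5 : ∫ τ in Ioi 0, layerKernel ε 1 x τ * F (t - τ) = layerIntegral ε β 1 x t := by
    have h6 : ∫ τ in Ioi 0, layerKernel ε 1 x τ * F (t - τ)
        = ∫ τ, layerKernel ε 1 x τ * F (t - τ) := by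
      refine setIntegral_eq_integral_of_forall_compl_eq_zero fun τ hτ => ?_
      rw [layerKernel_of_nonpos (not_lt.1 hτ), zero_mul]
    rw [h6, layerIntegral, ← integral_sub_left_eq_self _ volume t]
    simp [hF]
  rw [h1, h2, h3, setIntegral_congr_fun measurableSet_Ioi h4, integral_const_mul, h5]
  ring

lemma isSmooth_doubleLayer (hβ : BoundaryData β) (hε : 0 < ε) : IsSmooth (doubleLayer ε β) := by
  have h : ContDiffOn ℝ ∞ (fun z : ℝ × ℝ => (√(2 * Real.pi * ε))⁻¹ * z.1 *
      layerIntegral ε β 1 z.1 z.2) quarter :=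
    (contDiffOn_const.mul contDiffOn_fst).mul
      ((hβ.contDiffOn_layerIntegral hε 1).mono fun z hz => ⟨hz.1, trivial⟩)
  exact h.congr fun z hz => doubleLayer_eq hβ hε hz.1

lemma doubleLayer_heat (hβ : BoundaryData β) (hε : 0 < ε) (hx : 0 < x) :
    dt (doubleLayer ε β) x t = ε / 2 * dx (dx (doubleLayer ε β)) x t := by
  set c := (√(2 * Real.pi * ε))⁻¹ with hc
  have h1 : ∀ y > 0, HasDerivAt (fun y => doubleLayer ε β y t)
      (c * (layerIntegral ε β 1 y t - y ^ 2 / ε * layerIntegral ε β 2 y t)) y := by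
    intro y hy
    refine hasDerivAt_congr_pos (f := fun y => c * y * layerIntegral ε β 1 y t)
      (fun y hy => (doubleLayer_eq hβ hε hy).symm) hy ?_
    exact (((hasDerivAt_id y).const_mul c).mul
      (hβ.hasDerivAt_layerIntegral_x hε hy 1 t)).congr_deriv (by simp only [id]; ring)
  have h2 := IsC21.dxx_eq (f := doubleLayer ε β) (fx := fun y t =>
    c * (layerIntegral ε β 1 y t - y ^ 2 / ε * layerIntegral ε β 2 y t)) h1 hx
    (((hβ.hasDerivAt_layerIntegral_x hε hx 1 t).sub (((hasDerivAt_pow 2 x).div_const ε).mul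
      (hβ.hasDerivAt_layerIntegral_x hε hx 2 t))).const_mul c)
  have h3 := (hβ.hasDerivAt_layerIntegral_t hε hx 1 t).const_mul (c * x)
  have h4 : (fun t => doubleLayer ε β x t) = fun t => c * x * layerIntegral ε β 1 x t :=
    funext fun t => doubleLayer_eq hβ hε hx
  rw [h2, dt, h4, h3.deriv]
  norm_num
  field_simp
  ring

lemma doubleLayer_bound (hβ : BoundaryData β) (hε : 0 < ε) (T : ℝ) :
    ∃ M, 0 ≤ M ∧ ∀ x, ∀ t ≤ T, |doubleLayer ε β x t| ≤ M := by
  obtain ⟨M, hM0, hM⟩ := hβ.indicator_bound T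
  refine ⟨M, hM0, fun x t ht => ?_⟩
  have h := norm_integral_le_of_norm_le_const (μ := ProbabilityTheory.gaussianReal 0 1)
    (f := fun z => (Ioi 0).indicator β (t - x ^ 2 / (ε * z ^ 2))) (C := M)
    (.of_forall fun z => hM _ (by
      have : 0 ≤ x ^ 2 / (ε * z ^ 2) := by positivity
      linarith))
  simpa [doubleLayer] using h

lemma doubleLayer_zero (ht : 0 < t) : doubleLayer ε β 0 t = β t := by
  simp [doubleLayer, ht]

/-- The double layer potential is continuous on the closed quarter plane except at the corner. -/
lemma continuousAt_doubleLayer (hβ : BoundaryData β) (hε : 0 < ε) (h : x ≠ 0 ∨ t ≠ 0) :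
    ContinuousAt (fun z : ℝ × ℝ => doubleLayer ε β z.1 z.2) (x, t) := by
  obtain ⟨M, hM0, hM⟩ := hβ.indicator_bound (t + 1)
  refine continuousAt_of_dominated (F := fun (v : ℝ × ℝ) z =>
    (Ioi 0).indicator β (v.2 - v.1 ^ 2 / (ε * z ^ 2))) (bound := fun _ => M) ?_ ?_
    (integrable_const M) ?_
  · exact .of_forall fun v => (hβ.measurable_indicator.comp (by fun_prop)).aestronglyMeasurable
  · filter_upwards [continuousAt_snd.eventually (Iio_mem_nhds (show t < t + 1 by linarith))]
      with v hv
    refine .of_forall fun z => hM _ ?_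
    have : 0 ≤ v.1 ^ 2 / (ε * z ^ 2) := by positivity
    have hv : v.2 < t + 1 := hv
    linarith
  · -- the integrand is discontinuous only where the hitting time `x² / (ε z²)` equals `t`
    have hne : ∀ a : ℝ, ∀ᵐ z ∂(ProbabilityTheory.gaussianReal 0 1), z ≠ a := fun a =>
      (ProbabilityTheory.gaussianReal_absolutelyContinuous 0 one_ne_zero).ae_le
        (by filter_upwards [(countable_singleton a).ae_notMem volume] with z hz using hz)
    filter_upwards [hne 0, hne (√(x ^ 2 / (ε * t))), hne (-√(x ^ 2 / (ε * t)))] with z h0 h1 h2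
    have h3 : t - x ^ 2 / (ε * z ^ 2) ≠ 0 := by
      intro h3
      have h4 : t * (ε * z ^ 2) = x ^ 2 := by
        rw [sub_eq_zero] at h3
        rw [h3, div_mul_cancel₀ _ (by positivity)]
      have ht : t ≠ 0 := by
        rintro rfl
        rcases h with h | h
        · exact h (by simpa using h4.symm)
        · exact h rfl
      have h5 : z ^ 2 = x ^ 2 / (ε * t) := by
        rw [← h4]; field_simp
      rw [← h5, Real.sqrt_sq_eq_abs] at h1 h2
      rcases abs_choice z with h6 | h6 <;> rw [h6] at h1 h2
      · exact h1 rfl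
      · exact h2 (by ring)
    exact ContinuousAt.comp_of_eq (f := fun v : ℝ × ℝ => v.2 - v.1 ^ 2 / (ε * z ^ 2))
      (hβ.continuousAt_indicator h3) (by fun_prop) rfl

lemma doubleLayer_init (hε : 0 < ε) : doubleLayer ε β x 0 = 0 := by
  have h : ∀ z : ℝ, ¬ 0 < 0 - x ^ 2 / (ε * z ^ 2) := fun z => by
    have : 0 ≤ x ^ 2 / (ε * z ^ 2) := by positivity
    linarith
  simp only [doubleLayer, indicator, mem_Ioi, h, if_false, integral_zero]

end LayerIntegral

/-! ### From Dirichlet solutions to Robin solutions -/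

/-- Smooth solutions `r` of the heat equation in the quarter plane, continuous up to `x = 0`, of
exponential growth, whose initial values `r₀` are attained almost everywhere. -/
structure IsHeatFlow (ε : ℝ) (r₀ : ℝ → ℝ) (r : ℝ → ℝ → ℝ) : Prop where
  smooth : IsSmooth r
  heat : ∀ x > 0, ∀ t > 0, dt r x t = ε / 2 * dx (dx r) x t
  cont : ContinuousOn (fun z : ℝ × ℝ => r z.1 z.2) (Ici 0 ×ˢ Ioi 0)
  bound : ∀ T, ∃ M, 0 ≤ M ∧ ∀ x ≥ 0, ∀ t ∈ Ioc 0 T, |r x t| ≤ M * Real.exp (M * x)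
  init : ∀ᵐ x, 0 < x → Tendsto (fun t => r x t) (𝓝[>] 0) (𝓝 (r₀ x))

lemma tendsto_prodMk_nhdsGT (x : ℝ) :
    Tendsto (fun t : ℝ => (x, t)) (𝓝[>] 0) (𝓝 (x, 0)) :=
  (Continuous.prodMk continuous_const continuous_id).continuousAt.mono_left nhdsWithin_le_nhds

lemma isHeatFlow_oddExt {ε : ℝ} (hε : 0 < ε) {h : ℝ → ℝ} (hh : HalfExpBounded h)
    (hc : ∀ᵐ x, 0 < x → ContinuousAt h x) : IsHeatFlow ε h (heatFlow ε (oddExt h)) where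
  smooth := isSmooth_heatFlow hε hh.expBounded_oddExt
  heat _ hx _ ht := heatFlow_heat hε hh.expBounded_oddExt hx ht
  cont := continuousOn_heatFlow hε hh.expBounded_oddExt
  bound T := by
    obtain ⟨M, hM0, hM⟩ := heatFlow_bound hε hh.expBounded_oddExt T
    refine ⟨M, hM0, fun x hx t ht => ?_⟩
    simpa [abs_of_nonneg hx] using hM x t ht.2
  init := by
    filter_upwards [hc] with x hx h0
    exact (tendsto_heatFlow_oddExt hh h0 (hx h0)).comp (tendsto_prodMk_nhdsGT x)

lemma isHeatFlow_doubleLayer {ε : ℝ} (hε : 0 < ε) {β : ℝ → ℝ} (hβ : BoundaryData β) :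
    IsHeatFlow ε (fun _ => 0) (doubleLayer ε β) where
  smooth := isSmooth_doubleLayer hβ hε
  heat _ hx _ _ := doubleLayer_heat hβ hε hx
  cont := fun z hz => (continuousAt_doubleLayer hβ hε (Or.inr (ne_of_gt hz.2))).continuousWithinAt
  bound T := by
    obtain ⟨M, hM0, hM⟩ := doubleLayer_bound hβ hε T
    refine ⟨M, hM0, fun x hx t ht => (hM x t ht.2).trans ?_⟩
    have : 1 ≤ Real.exp (M * x) := Real.one_le_exp (by positivity)
    nlinarith
  init := .of_forall fun x hx => by
    have h := (continuousAt_doubleLayer hβ hε (x := x) (t := 0) (Or.inl hx.ne')).tendsto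
    simp only [doubleLayer_init hε] at h
    exact h.comp (tendsto_prodMk_nhdsGT x)

lemma IsHeatFlow.add {ε : ℝ} {r₀ s₀ : ℝ → ℝ} {r s : ℝ → ℝ → ℝ} (hr : IsHeatFlow ε r₀ r)
    (hs : IsHeatFlow ε s₀ s) :
    IsHeatFlow ε (fun x => r₀ x + s₀ x) (fun x t => r x t + s x t) where
  smooth := hr.smooth.add hs.smooth
  heat x hx t ht := by
    have h1 := IsC21.dxx_eq (f := fun x t => r x t + s x t) (fx := fun x t => dx r x t + dx s x t)
      (fun y hy => (hr.smooth.hasDerivAt_x hy ht).add (hs.smooth.hasDerivAt_x hy ht)) hx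
      ((hr.smooth.dx.hasDerivAt_x hx ht).add (hs.smooth.dx.hasDerivAt_x hx ht))
    have h2 : dt (fun x t => r x t + s x t) x t = dt r x t + dt s x t :=
      ((hr.smooth.hasDerivAt_t hx ht).add (hs.smooth.hasDerivAt_t hx ht)).deriv
    rw [h1, h2, hr.heat x hx t ht, hs.heat x hx t ht, mul_add]
  cont := hr.cont.add hs.cont
  bound T := by
    obtain ⟨M, hM0, hM⟩ := hr.bound T
    obtain ⟨L, hL0, hL⟩ := hs.bound T
    refine ⟨M + L, by positivity, fun x hx t ht => ?_⟩
    calc |r x t + s x t| ≤ |r x t| + |s x t| := abs_add_le _ _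
      _ ≤ M * Real.exp ((M + L) * x) + L * Real.exp ((M + L) * x) := by
          refine add_le_add ((hM x hx t ht).trans ?_) ((hL x hx t ht).trans ?_) <;>
            gcongr <;> linarith
      _ = _ := by ring
  init := by
    filter_upwards [hr.init, hs.init] with x h1 h2 hx using (h1 hx).add (h2 hx)

lemma exp_le_gaussian {M C : ℝ} (hM : 0 ≤ M) (hC : 0 ≤ C) :
    ∃ L, 0 ≤ L ∧ ∀ x ≥ 0, M * Real.exp (C * x) ≤ L * Real.exp (L * x ^ 2) := by
  refine ⟨M * Real.exp C + C, by positivity, fun x hx => ?_⟩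
  have h1 : C * x ≤ C + C * x ^ 2 := by nlinarith [sq_nonneg (x - 1), sq_nonneg x]
  have h2 : C ≤ M * Real.exp C + C := by have := Real.exp_pos C; nlinarith
  calc M * Real.exp (C * x) ≤ M * Real.exp (C + C * x ^ 2) := by gcongr
    _ = M * Real.exp C * Real.exp (C * x ^ 2) := by rw [Real.exp_add]; ring
    _ ≤ _ := by
      have h3 : C * x ^ 2 ≤ (M * Real.exp C + C) * x ^ 2 := by gcongr
      exact mul_le_mul (by linarith) (Real.exp_le_exp.2 h3) (Real.exp_pos _).le (by positivity)

/-- A heat flow `r` yields a Robin solution `q` with `q_x + (b/ε) q = r`: the function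
`exp ((b/ε) x - λ t) q` is a potential of an explicit closed form built from `r`. -/
theorem exists_robin_of_heatFlow {ε : ℝ} (hε : 0 < ε) (b : ℝ) {r₀ G : ℝ → ℝ} {r : ℝ → ℝ → ℝ}
    (hr : IsHeatFlow ε r₀ r)
    (hG : ∀ x ≥ 0, Real.exp (b / ε * x) * G x
      = G 0 + ∫ y in (0 : ℝ)..x, Real.exp (b / ε * y) * r₀ y) :
    ∃ q : ℝ → ℝ → ℝ, IsSmooth q ∧ IsRobinHeatSolution ε b G (fun t => ε * r 0 t) q ∧
      (∀ x ≥ 0, q x 0 = G x) ∧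
      ∀ x ≥ 0, ∀ t > 0,
        HasDerivWithinAt (fun y => q y t) (r x t - b / ε * q x t) (Ici 0) x := by
  set κ := b / ε with hκ
  -- `l` is chosen such that `exp (-κ x + l t)` solves the heat equation
  set l := ε / 2 * κ ^ 2 with hl
  have hl0 : 0 ≤ l := by positivity
  set e : ℝ → ℝ → ℝ := fun x t => Real.exp (κ * x - l * t) with he
  have hes : IsSmooth e := by
    have : ContDiff ℝ ∞ fun z : ℝ × ℝ => e z.1 z.2 := by simp only [he]; fun_prop
    exact this.contDiffOn
  have hex : ∀ x t, HasDerivAt (fun y => e y t) (κ * e x t) x := fun x t => by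
    have h : HasDerivAt (fun y => κ * y - l * t) κ x := by
      simpa using ((hasDerivAt_id x).const_mul κ).sub_const (l * t)
    exact h.exp.congr_deriv (by simp only [he]; ring)
  have het : ∀ x t, HasDerivAt (fun s => e x s) (-l * e x t) t := fun x t => by
    have h : HasDerivAt (fun s => κ * x - l * s) (-l) t := by
      simpa using ((hasDerivAt_id t).const_mul l).const_sub (κ * x)
    exact h.exp.congr_deriv (by simp only [he]; ring)
  have hepos : ∀ x t, 0 < e x t := fun x t => Real.exp_pos _
  -- `A = (e q)_x` for the function `q` sought, and `(e q)_t = (ε/2) A_x - ε κ A`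
  set A : ℝ → ℝ → ℝ := fun x t => e x t * r x t with hA
  have hAs : IsSmooth A := hes.mul hr.smooth
  have hAx : ∀ x > 0, ∀ t > 0, dx A x t = e x t * (dx r x t + κ * r x t) := fun x hx t ht =>
    dx_eq hx (((hex x t).mul (hr.smooth.hasDerivAt_x hx ht)).congr_deriv (by ring))
  have hAxx : ∀ x > 0, ∀ t > 0,
      dx (dx A) x t = e x t * (dx (dx r) x t + 2 * κ * dx r x t + κ ^ 2 * r x t) := by
    intro x hx t ht
    rw [dx_congr_pos (g := fun x t => e x t * (dx r x t + κ * r x t))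
      (fun y hy => hAx y hy t ht) hx]
    exact dx_eq hx (((hex x t).mul ((hr.smooth.dx.hasDerivAt_x hx ht).add
      ((hr.smooth.hasDerivAt_x hx ht).const_mul κ))).congr_deriv (by
        simp only [Pi.add_apply]; ring))
  have hAt : ∀ x > 0, ∀ t > 0, dt A x t = e x t * (dt r x t - l * r x t) := fun x hx t ht =>
    ((((het x t).mul (hr.smooth.hasDerivAt_t hx ht))).congr_deriv (by ring)).deriv
  have hbA : ∀ T, ∃ M, 0 ≤ M ∧ ∀ x ≥ 0, ∀ t ∈ Ioc 0 T, |A x t| ≤ M * Real.exp ((M + |κ|) * x) := by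
    intro T
    obtain ⟨M, hM0, hM⟩ := hr.bound T
    refine ⟨M, hM0, fun x hx t ht => ?_⟩
    have h1 : e x t ≤ Real.exp (|κ| * x) := by
      refine Real.exp_le_exp.2 ?_
      have h2 : κ * x ≤ |κ| * x := mul_le_mul_of_nonneg_right (le_abs_self κ) hx
      have h3 : 0 ≤ l * t := mul_nonneg hl0 ht.1.le
      linarith
    calc |A x t| = e x t * |r x t| := by rw [hA, abs_mul, abs_of_pos (hepos x t)]
      _ ≤ Real.exp (|κ| * x) * (M * Real.exp (M * x)) :=
          mul_le_mul h1 (hM x hx t ht) (abs_nonneg _) (Real.exp_pos _).le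
      _ = _ := by rw [add_mul, Real.exp_add]; ring
  have hbA' : ∀ X T : ℝ, ∃ M, ∀ x ∈ Ioc 0 X, ∀ t ∈ Ioc 0 T, |A x t| ≤ M := by
    intro X T
    obtain ⟨M, hM0, hM⟩ := hbA T
    refine ⟨M * Real.exp ((M + |κ|) * X), fun x hx t ht => (hM x hx.1.le t ht).trans ?_⟩
    have := hx.2
    gcongr
  have hec : Continuous fun z : ℝ × ℝ => e z.1 z.2 := by simp only [he]; fun_prop
  obtain ⟨Φ, hΦc, hΦx, hΦt, hΦ0, hΦi⟩ := exists_potential (ε := ε) (A := A)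
    (N := fun x t => -ε * κ * A x t) (Nx := fun x t => -ε * κ * dx A x t)
    (A₀ := fun x => Real.exp (κ * x) * r₀ x) hAs.isC21
    (hec.continuousOn.mul hr.cont) (continuousOn_const.mul hAs.continuousOn)
    (fun x hx t ht => (hAs.hasDerivAt_x hx ht).const_mul _)
    (fun x hx t ht => by
      rw [hAt x hx t ht, hAxx x hx t ht, hAx x hx t ht, hr.heat x hx t ht, hl]; ring)
    hbA' (fun X T => by
      obtain ⟨M, hM⟩ := hbA' X T
      refine ⟨|-ε * κ| * M, fun x hx t ht => ?_⟩
      rw [abs_mul]; exact mul_le_mul_of_nonneg_left (hM x hx t ht) (abs_nonneg _))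
    (by
      filter_upwards [hr.init] with x hx h0
      refine Tendsto.mul ?_ (hx h0)
      have h1 : ContinuousAt (fun t => e x t) 0 := (het x 0).continuousAt
      have h2 := h1.tendsto.mono_left (nhdsWithin_le_nhds (s := Ioi 0))
      simpa [he] using h2)
  have hΦs : IsSmooth Φ := contDiffOn_infty_of_partials (fx := A)
    (ft := fun x t => ε / 2 * dx A x t + -ε * κ * A x t) isOpen_quarter
    (fun z hz => (hΦx z.1 (le_of_lt hz.1) z.2 hz.2).hasDerivAt (Ici_mem_nhds hz.1))
    (fun z hz => hΦt z.1 hz.1 z.2 hz.2) hAs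
    ((hAs.dx.const_mul (ε / 2)).add (hAs.const_mul (-ε * κ)))
  set e' : ℝ → ℝ → ℝ := fun x t => Real.exp (-κ * x + l * t) with he'
  have hee' : ∀ x t, e' x t * e x t = 1 := fun x t => by
    rw [he, he', ← Real.exp_add]; simp
  have he's : IsSmooth e' := by
    have : ContDiff ℝ ∞ fun z : ℝ × ℝ => e' z.1 z.2 := by simp only [he']; fun_prop
    exact this.contDiffOn
  have hec' : Continuous fun z : ℝ × ℝ => e' z.1 z.2 := by simp only [he']; fun_prop
  have hex' : ∀ x t, HasDerivAt (fun y => e' y t) (-κ * e' x t) x := fun x t => by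
    have h : HasDerivAt (fun y => -κ * y + l * t) (-κ) x := by
      simpa using ((hasDerivAt_id x).const_mul (-κ)).add_const (l * t)
    exact h.exp.congr_deriv (by simp only [he']; ring)
  have het' : ∀ x t, HasDerivAt (fun s => e' x s) (l * e' x t) t := fun x t => by
    have h : HasDerivAt (fun s => -κ * x + l * s) l t := by
      simpa using ((hasDerivAt_id t).const_mul l).const_add (-κ * x)
    exact h.exp.congr_deriv (by simp only [he']; ring)
  set q : ℝ → ℝ → ℝ := fun x t => e' x t * (G 0 + Φ x t) with hq
  have hqs : IsSmooth q := he's.mul (contDiffOn_const.add hΦs)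
  have hqx : ∀ x ≥ 0, ∀ t > 0,
      HasDerivWithinAt (fun y => q y t) (r x t - κ * q x t) (Ici 0) x := by
    intro x hx t ht
    refine ((hex' x t).hasDerivWithinAt.mul ((hΦx x hx t ht).const_add (G 0))).congr_deriv ?_
    have h1 : e' x t * A x t = r x t := by rw [hA]; simp only; rw [← mul_assoc, hee', one_mul]
    rw [h1]; simp only [hq]; ring
  have hdx : ∀ x ≥ 0, ∀ t > 0, dx q x t = r x t - κ * q x t := fun x hx t ht =>
    dx_eq_of_within hx (hqx x hx t ht)
  have hqc : ContinuousOn (fun z : ℝ × ℝ => q z.1 z.2) (Ici 0 ×ˢ Ici 0) :=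
    hec'.continuousOn.mul (continuousOn_const.add hΦc)
  have hq0 : ∀ x ≥ 0, q x 0 = G x := by
    intro x hx
    simp only [hq, hΦ0 x hx, ← hG x hx, he']
    rw [← mul_assoc, ← Real.exp_add]; simp
  refine ⟨q, hqs, ?_, hq0, hqx⟩
  refine
  { cont := hqc
    diff_bdry := fun t ht => (hqx 0 le_rfl t ht).differentiableWithinAt
    cont_x_bdry := ?_
    c21 := hqs.isC21
    heat := ?_
    init := fun x hx => hq0 x (le_of_lt hx)
    bdry := ?_
    growth := ?_ }
  · refine (hr.cont.sub (continuousOn_const.mul (hqc.mono ?_))).congr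
      fun z hz => hdx z.1 hz.1 z.2 hz.2
    exact prod_mono le_rfl Ioi_subset_Ici_self
  · intro x hx t ht
    have h1 : dx (dx q) x t = dx r x t - κ * (r x t - κ * q x t) := by
      rw [dx_congr_pos (g := fun x t => r x t - κ * q x t)
        (fun y hy => hdx y (le_of_lt hy) t ht) hx]
      exact dx_eq hx ((hr.smooth.hasDerivAt_x hx ht).sub
        (((hqx x (le_of_lt hx) t ht).hasDerivAt (Ici_mem_nhds hx)).const_mul κ))
    have h2 : dt q x t = l * q x t + e' x t * (ε / 2 * dx A x t + -ε * κ * A x t) := by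
      refine HasDerivAt.deriv (((het' x t).mul ((hΦt x hx t ht).const_add (G 0))).congr_deriv ?_)
      simp only [hq]; ring
    have h3 : e' x t * (ε / 2 * dx A x t + -ε * κ * A x t)
        = (e' x t * e x t) * (ε / 2 * (dx r x t - κ * r x t)) := by
      rw [hAx x hx t ht, hA]; ring
    rw [h1, h2, h3, hee', hl]; ring
  · intro t ht
    rw [hdx 0 le_rfl t ht, hκ]
    field_simp
    ring
  · intro T hT
    obtain ⟨M, hM0, hM⟩ := hbA T
    obtain ⟨B, hB⟩ := (isCompact_Icc (a := (0 : ℝ)) (b := T)).exists_bound_of_continuousOn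
      (f := fun t => Φ 0 t)
      (hΦc.comp (f := fun t : ℝ => ((0 : ℝ), t)) (by fun_prop)
        fun t ht => ⟨show (0 : ℝ) ≤ 0 from le_rfl, ht.1⟩)
    set C := M + |κ| with hC
    have hC0 : 0 ≤ C := by positivity
    have hΦb : ∀ x ≥ 0, ∀ t ∈ Ioc 0 T, |Φ x t| ≤ |B| + M * Real.exp ((C + 1) * x) := by
      intro x hx t ht
      rw [hΦi x hx t ht.1]
      refine (abs_add_le _ _).trans (add_le_add ?_ ?_)
      · exact (hB t ⟨ht.1.le, ht.2⟩).trans (le_abs_self B)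
      · have h1 : ‖∫ y in (0 : ℝ)..x, A y t‖ ≤ M * Real.exp (C * x) * |x - 0| := by
          refine intervalIntegral.norm_integral_le_of_norm_le_const fun y hy => ?_
          rw [uIoc_of_le hx] at hy
          refine (hM y hy.1.le t ht).trans ?_
          have := hy.2
          gcongr
        refine h1.trans ?_
        rw [sub_zero, abs_of_nonneg hx, show (C + 1) * x = C * x + x by ring, Real.exp_add,
          ← mul_assoc]
        have h2 : x ≤ Real.exp x := by linarith [Real.add_one_le_exp x]
        gcongr
    have hΦb' : ∀ x ≥ 0, ∀ t ∈ Icc 0 T, |Φ x t| ≤ |B| + M * Real.exp ((C + 1) * x) := by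
      intro x hx t ht
      rcases eq_or_lt_of_le ht.1 with h0 | h0
      · subst h0
        have h1 : ContinuousWithinAt (fun t => Φ x t) (Ioi 0) 0 :=
          ((hΦc.comp (f := fun t : ℝ => (x, t)) (s := Ici 0) (by fun_prop)
            fun t ht => ⟨hx, ht⟩) 0 self_mem_Ici).mono Ioi_subset_Ici_self
        refine le_of_tendsto h1.tendsto.abs ?_
        filter_upwards [Ioc_mem_nhdsGT hT] with s hs using hΦb x hx s hs
      · exact hΦb x hx t ⟨h0, ht.2⟩
    obtain ⟨L, hL0, hL⟩ := exp_le_gaussian (M := Real.exp (l * T) * (|G 0| + |B| + M))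
      (C := |κ| + (C + 1)) (by positivity) (by positivity)
    refine ⟨L, fun x hx t ht => le_trans ?_ (hL x hx)⟩
    have h1 : e' x t ≤ Real.exp (|κ| * x) * Real.exp (l * T) := by
      rw [← Real.exp_add]
      refine Real.exp_le_exp.2 ?_
      have h2 : -κ * x ≤ |κ| * x := mul_le_mul_of_nonneg_right (neg_le_abs κ) hx
      have h3 : l * t ≤ l * T := mul_le_mul_of_nonneg_left ht.2 hl0
      linarith
    have h4 : |G 0 + Φ x t| ≤ (|G 0| + |B| + M) * Real.exp ((C + 1) * x) := by
      have h5 : 1 ≤ Real.exp ((C + 1) * x) := Real.one_le_exp (by positivity)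
      have h6 := hΦb' x hx t ht
      have h7 := abs_add_le (G 0) (Φ x t)
      nlinarith [abs_nonneg (G 0), abs_nonneg B]
    calc |q x t| = e' x t * |G 0 + Φ x t| := by
          rw [hq, abs_mul, abs_of_pos (Real.exp_pos _)]
      _ ≤ (Real.exp (|κ| * x) * Real.exp (l * T)) *
          ((|G 0| + |B| + M) * Real.exp ((C + 1) * x)) := by
          gcongr
      _ = _ := by rw [add_mul |κ|, Real.exp_add]; ring

/-! ### Data of bounded variation -/

/-- Bounded measurable data on the half-line `x > 0` with countably many discontinuities; the
only consequences of bounded variation that matter here. -/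
structure HalfLineData (f : ℝ → ℝ) : Prop where
  meas : Measurable ((Ioi 0).indicator f)
  bound : ∃ C, 0 ≤ C ∧ ∀ y > 0, |f y| ≤ C
  countable : {x | 0 < x ∧ ¬ ContinuousAt f x}.Countable

lemma measurable_indicator_of_monotoneOn {f : ℝ → ℝ} (hf : MonotoneOn f (Ioi 0)) :
    Measurable ((Ioi 0).indicator f) := by
  refine measurable_of_restrict_of_restrict_compl (s := Ioi (0 : ℝ)) measurableSet_Ioi ?_ ?_
  · have h1 : (Ioi (0 : ℝ)).domRestrict ((Ioi 0).indicator f) = (Ioi (0 : ℝ)).domRestrict f := by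
      ext ⟨x, hx⟩; simp [show 0 < x from hx]
    rw [h1]
    exact Monotone.measurable fun x y hxy => hf x.2 y.2 hxy
  · have h1 : (Ioi (0 : ℝ))ᶜ.domRestrict ((Ioi 0).indicator f) = fun _ => 0 := by
      ext ⟨x, hx⟩; exact indicator_of_notMem hx f
    rw [h1]; exact measurable_const

lemma HalfLineData.of_boundedVariationOn {f : ℝ → ℝ} (hf : BoundedVariationOn f (Ioi 0)) :
    HalfLineData f := by
  obtain ⟨p, q, hp, hq, rfl⟩ := hf.locallyBoundedVariationOn.exists_monotoneOn_sub_monotoneOn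
  refine ⟨?_, ?_, ?_⟩
  · have h := (measurable_indicator_of_monotoneOn hp).sub (measurable_indicator_of_monotoneOn hq)
    rwa [← indicator_sub'] at h
  · refine ⟨(eVariationOn (p - q) (Ioi 0)).toReal + |(p - q) 1|, by positivity, fun y hy => ?_⟩
    have h := hf.dist_le (x := y) (y := 1) hy (mem_Ioi.2 one_pos)
    rw [Real.dist_eq] at h
    have := abs_sub_abs_le_abs_sub ((p - q) y) ((p - q) 1)
    linarith
  · refine (hp.countable_not_continuousWithinAt.union hq.countable_not_continuousWithinAt).mono ?_
    rintro x ⟨hx, hc⟩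
    by_contra h
    simp only [mem_union, mem_ofPred_eq, not_or, not_and, not_not] at h
    exact hc (((h.1 hx).continuousAt (Ioi_mem_nhds hx)).sub
      ((h.2 hx).continuousAt (Ioi_mem_nhds hx)))

namespace HalfLineData

variable {f : ℝ → ℝ}

lemma ae_continuousAt (hf : HalfLineData f) : ∀ᵐ x, 0 < x → ContinuousAt f x := by
  filter_upwards [hf.countable.ae_notMem volume] with x hx h0
  by_contra h
  exact hx ⟨h0, h⟩

lemma halfExpBounded (hf : HalfLineData f) : HalfExpBounded f := by
  obtain ⟨C, hC0, hC⟩ := hf.bound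
  refine ⟨hf.meas, C, hC0, fun y hy => (hC y hy).trans ?_⟩
  have : 1 ≤ Real.exp (C * y) := Real.one_le_exp (mul_nonneg hC0 (le_of_lt hy))
  nlinarith

lemma intervalIntegrable_of_half {h : ℝ → ℝ} (hm : Measurable ((Ioi 0).indicator h)) {C : ℝ}
    {a b : ℝ} (ha : 0 ≤ a) (hb : 0 ≤ b) (hC : ∀ y ∈ uIoc a b, |h y| ≤ C) :
    IntervalIntegrable h volume a b := by
  rw [intervalIntegrable_iff]
  have hpos : ∀ y ∈ uIoc a b, 0 < y := fun y hy => (le_min ha hb).trans_lt hy.1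
  refine Integrable.mono' (g := fun _ => C) (intervalIntegrable_iff.1 intervalIntegrable_const)
    ?_ ?_
  · refine (hm.aestronglyMeasurable.restrict (s := uIoc a b)).congr ?_
    rw [Filter.EventuallyEq, ae_restrict_iff' measurableSet_uIoc]
    exact .of_forall fun y hy => indicator_of_mem (hpos y hy) h
  · rw [ae_restrict_iff' measurableSet_uIoc]
    exact .of_forall hC

lemma intervalIntegrable (hf : HalfLineData f) {a b : ℝ} (ha : 0 ≤ a) (hb : 0 ≤ b) :
    IntervalIntegrable f volume a b := by
  obtain ⟨C, hC0, hC⟩ := hf.bound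
  exact intervalIntegrable_of_half hf.meas ha hb fun y hy => hC y ((le_min ha hb).trans_lt hy.1)

lemma primitive_bound (hf : HalfLineData f) :
    ∃ C, 0 ≤ C ∧ ∀ x ≥ 0, |primitive f x| ≤ C * x := by
  obtain ⟨C, hC0, hC⟩ := hf.bound
  refine ⟨C, hC0, fun x hx => ?_⟩
  have h := intervalIntegral.norm_integral_le_of_norm_le_const (a := 0) (b := x) (f := f) (C := C)
    fun y hy => hC y (by rw [uIoc_of_le hx] at hy; exact hy.1)
  simpa [primitive, abs_of_nonneg hx] using h

lemma continuousOn_primitive (hf : HalfLineData f) : ContinuousOn (primitive f) (Ici 0) := by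
  intro T hT
  have hT : 0 ≤ T := hT
  have h1 := intervalIntegral.continuousOn_primitive_interval'
    (hf.intervalIntegrable le_rfl (show 0 ≤ T + 1 by linarith)) (a := 0) left_mem_uIcc
  have h2 := h1 T (by rw [uIcc_of_le (by linarith)]; exact ⟨hT, by linarith⟩)
  refine h2.mono_of_mem_nhdsWithin ?_
  rw [uIcc_of_le (by linarith)]
  filter_upwards [self_mem_nhdsWithin, mem_nhdsWithin_of_mem_nhds
    (Iio_mem_nhds (show T < T + 1 by linarith))] with s hs1 hs2 using ⟨hs1, le_of_lt hs2⟩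

lemma hasDerivAt_primitive (hf : HalfLineData f) {x : ℝ} (hx : 0 < x) (hc : ContinuousAt f x) :
    HasDerivAt (primitive f) (f x) x := by
  refine intervalIntegral.integral_hasDerivAt_right (hf.intervalIntegrable le_rfl hx.le) ?_ hc
  refine ⟨Ioi 0, Ioi_mem_nhds hx, ?_⟩
  refine (hf.meas.aestronglyMeasurable.restrict (s := Ioi 0)).congr ?_
  rw [Filter.EventuallyEq, ae_restrict_iff' measurableSet_Ioi]
  exact .of_forall fun y hy => indicator_of_mem hy f

lemma halfExpBounded_primitive (hf : HalfLineData f) : HalfExpBounded (primitive f) := by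
  obtain ⟨C, hC0, hC⟩ := hf.primitive_bound
  refine .of_continuousOn (hf.continuousOn_primitive.mono Ioi_subset_Ici_self)
    (C := C + 1) (by positivity) fun y hy => (hC y (le_of_lt hy)).trans ?_
  have hy : 0 < y := hy
  have h1 : y ≤ Real.exp ((C + 1) * y) := by
    have := Real.add_one_le_exp ((C + 1) * y)
    nlinarith
  exact mul_le_mul (by linarith) h1 hy.le (by positivity)

end HalfLineData

/-! ### Uniqueness for the Robin problem -/

lemma IsC21.sub {f g : ℝ → ℝ → ℝ} (hf : IsC21 f) (hg : IsC21 g) :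
    IsC21 (fun x t => f x t - g x t) :=
  .of_hasDerivAt (fun _ hx _ ht => (hf.hasDerivAt_x hx ht).sub (hg.hasDerivAt_x hx ht))
    (fx := fun x t => dx f x t - dx g x t) (fxx := fun x t => dx (dx f) x t - dx (dx g) x t)
    (ft := fun x t => dt f x t - dt g x t)
    (fun _ hx _ ht => (hf.hasDerivAt_xx hx ht).sub (hg.hasDerivAt_xx hx ht))
    (fun _ hx _ ht => (hf.hasDerivAt_t hx ht).sub (hg.hasDerivAt_t hx ht))
    (hf.cont_x.sub hg.cont_x) (hf.cont_xx.sub hg.cont_xx) (hf.cont_t.sub hg.cont_t)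

lemma heat_sub {ε : ℝ} {f g : ℝ → ℝ → ℝ} (hf : IsC21 f) (hg : IsC21 g)
    (ef : ∀ x > 0, ∀ t > 0, dt f x t = ε / 2 * dx (dx f) x t)
    (eg : ∀ x > 0, ∀ t > 0, dt g x t = ε / 2 * dx (dx g) x t) :
    ∀ x > 0, ∀ t > 0, dt (fun x t => f x t - g x t) x t
      = ε / 2 * dx (dx fun x t => f x t - g x t) x t := by
  intro x hx t ht
  have h1 := IsC21.dxx_eq (f := fun x t => f x t - g x t) (fx := fun x t => dx f x t - dx g x t)
    (fun y hy => (hf.hasDerivAt_x hy ht).sub (hg.hasDerivAt_x hy ht)) hx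
    ((hf.hasDerivAt_xx hx ht).sub (hg.hasDerivAt_xx hx ht))
  have h2 : dt (fun x t => f x t - g x t) x t = dt f x t - dt g x t :=
    ((hf.hasDerivAt_t hx ht).sub (hg.hasDerivAt_t hx ht)).deriv
  rw [h1, h2, ef x hx t ht, eg x hx t ht, mul_sub]

lemma tendsto_init_of_continuousOn {f : ℝ → ℝ → ℝ}
    (hf : ContinuousOn (fun z : ℝ × ℝ => f z.1 z.2) (Ici 0 ×ˢ Ici 0)) {x : ℝ} (hx : 0 ≤ x) :
    Tendsto (fun z : ℝ × ℝ => f z.1 z.2) (𝓝[Ici 0 ×ˢ Ioi 0] (x, 0)) (𝓝 (f x 0)) :=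
  ((hf (x, 0) ⟨hx, self_mem_Ici⟩).mono (prod_mono le_rfl Ioi_subset_Ici_self)).tendsto

namespace IsRobinHeatSolution

variable {ε b : ℝ} {g h : ℝ → ℝ} {p p' : ℝ → ℝ → ℝ}

lemma cont_pos (hp : IsRobinHeatSolution ε b g h p) :
    ContinuousOn (fun z : ℝ × ℝ => p z.1 z.2) (Ici 0 ×ˢ Ioi 0) :=
  hp.cont.mono (prod_mono le_rfl Ioi_subset_Ici_self)

lemma hasDerivWithinAt_bdry (hp : IsRobinHeatSolution ε b g h p) {t : ℝ} (ht : 0 < t) :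
    HasDerivWithinAt (fun y => p y t) (dx p 0 t) (Ici 0) 0 :=
  (hp.diff_bdry t ht).hasDerivWithinAt

lemma init_eq (hp : IsRobinHeatSolution ε b g h p) (hp' : IsRobinHeatSolution ε b g h p')
    {x : ℝ} (hx : 0 ≤ x) : p x 0 = p' x 0 := by
  have hc : ∀ {f : ℝ → ℝ → ℝ}, IsRobinHeatSolution ε b g h f →
      ContinuousOn (fun x => f x 0) (Ici 0) := fun hf =>
    hf.cont.comp (f := fun x : ℝ => (x, (0 : ℝ))) (by fun_prop) fun x hx => ⟨hx, self_mem_Ici⟩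
  have he : EqOn (fun x => p x 0) (fun x => p' x 0) (closure (Ioi 0)) :=
    EqOn.of_subset_closure (s := Ioi 0) (fun x hx => (hp.init x hx).trans (hp'.init x hx).symm)
      (by rw [closure_Ioi]; exact hc hp) (by rw [closure_Ioi]; exact hc hp')
      subset_closure le_rfl
  exact he (by rw [closure_Ioi]; exact hx)

lemma le (hε : 0 < ε) (hp : IsRobinHeatSolution ε b g h p)
    (hp' : IsRobinHeatSolution ε b g h p') : ∀ x ≥ 0, ∀ t > 0, p x t ≤ p' x t := by
  have key := heat_nonpos (b := b) hε (hp.c21.sub hp'.c21)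
    (heat_sub hp.c21 hp'.c21 hp.heat hp'.heat)
    (hp.cont_pos.sub hp'.cont_pos) (fun t ht => Or.inr ⟨_, (hp.hasDerivWithinAt_bdry ht).sub
      (hp'.hasDerivWithinAt_bdry ht), by
        have h1 := hp.bdry t ht
        have h2 := hp'.bdry t ht
        linarith⟩) ?_ ?_
  · intro x hx t ht
    linarith [key x hx t ht]
  · intro T hT
    obtain ⟨M, hM⟩ := hp.growth T hT
    obtain ⟨L, hL⟩ := hp'.growth T hT
    refine ⟨|M| + |L|, fun x hx t ht => ?_⟩
    have h1 := (le_abs_self _).trans (hM x hx t ⟨ht.1.le, ht.2⟩)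
    have h2 := (neg_le_abs _).trans (hL x hx t ⟨ht.1.le, ht.2⟩)
    have h3 : M * Real.exp (M * x ^ 2) ≤ |M| * Real.exp ((|M| + |L|) * x ^ 2) := by
      have := le_abs_self M
      have := abs_nonneg L
      gcongr
      linarith
    have h4 : L * Real.exp (L * x ^ 2) ≤ |L| * Real.exp ((|M| + |L|) * x ^ 2) := by
      have := le_abs_self L
      have := abs_nonneg M
      gcongr
      linarith
    linarith
  · intro x hx η hη
    have h1 := (tendsto_init_of_continuousOn hp.cont hx).sub
      (tendsto_init_of_continuousOn hp'.cont hx)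
    rw [init_eq hp hp' hx, sub_self] at h1
    exact (h1.eventually (Iio_mem_nhds hη)).mono fun z hz => le_of_lt hz

/-- Uniqueness for the Robin problem in the class of solutions of Gaussian growth. -/
theorem eq (hε : 0 < ε) (hp : IsRobinHeatSolution ε b g h p)
    (hp' : IsRobinHeatSolution ε b g h p') : ∀ x ≥ 0, ∀ t ≥ 0, p x t = p' x t := by
  intro x hx t ht
  rcases eq_or_lt_of_le ht with h0 | h0
  · rw [← h0]; exact init_eq hp hp' hx
  · exact le_antisymm (le hε hp hp' x hx t h0) (le hε hp' hp x hx t h0)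

end IsRobinHeatSolution

/-! ### The positive solution `p` -/

/-- The initial value `exp (-U₀ / ε)` of the Cole–Hopf transform. -/
noncomputable def colehopfInit (ε : ℝ) (u₀ : ℝ → ℝ) (x : ℝ) : ℝ :=
  Real.exp (-primitive u₀ x / ε)

/-- The initial value of `p_x + (b/ε) p`. -/
noncomputable def dirichletInit (ε b : ℝ) (u₀ : ℝ → ℝ) (x : ℝ) : ℝ :=
  (b - u₀ x) / ε * colehopfInit ε u₀ x

section ColeHopf

variable {ε b : ℝ} {u₀ : ℝ → ℝ}

lemma colehopfInit_pos (x : ℝ) : 0 < colehopfInit ε u₀ x := Real.exp_pos _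

lemma continuousOn_colehopfInit (hu : HalfLineData u₀) :
    ContinuousOn (colehopfInit ε u₀) (Ici 0) :=
  (hu.continuousOn_primitive.neg.div_const ε).rexp

lemma colehopfInit_bound (hε : 0 < ε) (hu : HalfLineData u₀) :
    ∃ C, 0 ≤ C ∧ ∀ x ≥ 0, colehopfInit ε u₀ x ≤ Real.exp (C * x) := by
  obtain ⟨C, hC0, hC⟩ := hu.primitive_bound
  refine ⟨C / ε, by positivity, fun x hx => Real.exp_le_exp.2 ?_⟩
  rw [div_mul_eq_mul_div]
  gcongr
  exact (neg_le_abs _).trans (hC x hx)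

lemma halfExpBounded_colehopfInit (hε : 0 < ε) (hu : HalfLineData u₀) :
    HalfExpBounded (colehopfInit ε u₀) := by
  obtain ⟨C, hC0, hC⟩ := colehopfInit_bound hε hu
  refine .of_continuousOn ((continuousOn_colehopfInit hu).mono Ioi_subset_Ici_self)
    (C := C + 1) (by positivity) fun y hy => ?_
  have hy : 0 < y := hy
  rw [abs_of_pos (colehopfInit_pos y)]
  refine (hC y hy.le).trans ?_
  have h1 : Real.exp (C * y) ≤ Real.exp ((C + 1) * y) := by gcongr; linarith
  nlinarith [Real.exp_pos ((C + 1) * y)]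

lemma expBounded_even_colehopfInit (hε : 0 < ε) (hu : HalfLineData u₀) :
    ExpBounded fun y => colehopfInit ε u₀ |y| := by
  obtain ⟨C, hC0, hC⟩ := colehopfInit_bound hε hu
  refine .of_bound (C := 1) (D := C) ?_ fun y => ?_
  · exact ((continuousOn_colehopfInit hu).comp_continuous continuous_abs abs_nonneg).measurable
  · rw [abs_of_pos (colehopfInit_pos _), one_mul]; exact hC _ (abs_nonneg y)

lemma halfExpBounded_dirichletInit (hε : 0 < ε) (hu : HalfLineData u₀) :
    HalfExpBounded (dirichletInit ε b u₀) := by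
  have h1 : HalfExpBounded fun x => (b - u₀ x) / ε := by
    have := ((HalfExpBounded.const b).add
      ((HalfExpBounded.const (-1)).mul hu.halfExpBounded)).mul (HalfExpBounded.const (1 / ε))
    refine cast (congrArg _ (funext fun x => ?_)) this
    ring
  exact h1.mul (halfExpBounded_colehopfInit hε hu)

lemma hasDerivAt_colehopfInit (hu : HalfLineData u₀) {x : ℝ} (hx : 0 < x)
    (hc : ContinuousAt u₀ x) :
    HasDerivAt (colehopfInit ε u₀) (-u₀ x / ε * colehopfInit ε u₀ x) x :=
  (((hu.hasDerivAt_primitive hx hc).neg.div_const ε).exp).congr_deriv (by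
    simp only [colehopfInit, Pi.neg_apply]; ring)

lemma continuousAt_dirichletInit (hu : HalfLineData u₀) {x : ℝ} (hx : 0 < x)
    (hc : ContinuousAt u₀ x) : ContinuousAt (dirichletInit ε b u₀) x :=
  ((continuousAt_const.sub hc).div_const ε).mul (hasDerivAt_colehopfInit hu hx hc).continuousAt

/-- Data with an almost everywhere derivative (off a countable set) in integrated form. -/
lemma exp_mul_eq_integral {G r₀ : ℝ → ℝ} {κ : ℝ} {s : Set ℝ} (hs : s.Countable)
    (hG : ContinuousOn G (Ici 0)) (hr : HalfExpBounded r₀)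
    (hd : ∀ x > 0, x ∉ s → HasDerivAt G (r₀ x - κ * G x) x) :
    ∀ x ≥ 0, Real.exp (κ * x) * G x
      = G 0 + ∫ y in (0 : ℝ)..x, Real.exp (κ * y) * r₀ y := by
  intro x hx
  obtain ⟨C, hC0, hC⟩ := hr.bound
  have h := integral_eq_of_hasDerivAt_off_countable_of_le
    (fun y => Real.exp (κ * y) * G y) (fun y => Real.exp (κ * y) * r₀ y) hx hs
    ((by fun_prop : Continuous fun y => Real.exp (κ * y)).continuousOn.mul
      (hG.mono Icc_subset_Ici_self)) ?_ ?_
  · rw [h]; simp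
  · rintro y ⟨hy, hys⟩
    have h1 : HasDerivAt (fun y => Real.exp (κ * y)) (Real.exp (κ * y) * κ) y := by
      simpa using ((hasDerivAt_id y).const_mul κ).exp
    exact (h1.mul (hd y hy.1 hys)).congr_deriv (by ring)
  · have h1 : IntervalIntegrable r₀ volume 0 x := by
      refine HalfLineData.intervalIntegrable_of_half hr.meas le_rfl hx
        (C := C * Real.exp (C * x)) fun y hy => ?_
      rw [uIoc_of_le hx] at hy
      refine (hC y hy.1).trans ?_
      have := hy.2
      gcongr
    exact h1.continuousOn_mul (by fun_prop)

set_option maxHeartbeats 400000 in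
/-- The Cole–Hopf solution `p`. The bound `|p_x + (b/ε) p| ≤ C p` comes from comparing `p` with
the heat flow of the odd extension of its initial values. -/
theorem exists_colehopf (hε : 0 < ε) (hu : HalfLineData u₀) (b : ℝ) :
    ∃ p : ℝ → ℝ → ℝ, IsSmooth p ∧
      IsRobinHeatSolution ε b (colehopfInit ε u₀) (fun _ => 0) p ∧
      (∀ x ≥ 0, p x 0 = colehopfInit ε u₀ x) ∧
      (∀ x ≥ 0, ∀ t > 0, HasDerivWithinAt (fun y => p y t)
        (heatFlow ε (oddExt (dirichletInit ε b u₀)) x t - b / ε * p x t) (Ici 0) x) ∧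
      (∀ x ≥ 0, ∀ t ≥ 0, 0 < p x t) ∧
      (∃ C, 0 ≤ C ∧ ∀ x ≥ 0, ∀ t > 0,
        |heatFlow ε (oddExt (dirichletInit ε b u₀)) x t| ≤ C * p x t) ∧
      (∀ T > 0, ∃ c > 0, ∃ K ≥ 0, ∀ x ≥ 0, ∀ t ∈ Ioc 0 T, c * Real.exp (-K * x) ≤ p x t) := by
  set g := colehopfInit ε u₀ with hg
  set r₀ := dirichletInit ε b u₀ with hr₀
  set r := heatFlow ε (oddExt r₀) with hr
  set v := heatFlow ε (oddExt g) with hv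
  have hgb := halfExpBounded_colehopfInit hε hu
  have hrb : HalfExpBounded r₀ := halfExpBounded_dirichletInit hε hu
  have hrf : IsHeatFlow ε r₀ r := isHeatFlow_oddExt hε hrb (by
    filter_upwards [hu.ae_continuousAt] with x hx h0
    exact continuousAt_dirichletInit hu h0 (hx h0))
  obtain ⟨p, hps, hpr, hp0, hpx⟩ := exists_robin_of_heatFlow hε b (G := g) hrf
    (exp_mul_eq_integral hu.countable (continuousOn_colehopfInit hu) hrb fun x hx hxs => by
      have hc : ContinuousAt u₀ x := by
        by_contra h
        exact hxs ⟨hx, h⟩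
      refine (hasDerivAt_colehopfInit hu hx hc).congr_deriv ?_
      simp only [hr₀, dirichletInit, hg]; ring)
  have hbd0 : (fun t => ε * r 0 t) = fun _ => (0 : ℝ) := by
    funext t; rw [hr, heatFlow_oddExt_zero, mul_zero]
  rw [hbd0] at hpr
  have hpinit : ∀ x ≥ 0, Tendsto (fun z : ℝ × ℝ => p z.1 z.2)
      (𝓝[Ici 0 ×ˢ Ioi 0] (x, 0)) (𝓝 (g x)) :=
    fun x hx => hp0 x hx ▸ tendsto_init_of_continuousOn hpr.cont hx
  -- `p` is nonnegative
  have hpn : ∀ x ≥ 0, ∀ t > 0, 0 ≤ p x t := by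
    have hz : IsC21 fun _ _ : ℝ => (0 : ℝ) := IsSmooth.isC21 contDiffOn_const
    have key := heat_nonpos (b := b) hε (hz.sub hpr.c21) (heat_sub hz hpr.c21 (fun x hx t _ => by
        have h1 : dt (fun _ _ : ℝ => (0 : ℝ)) x t = 0 := (hasDerivAt_const t (0 : ℝ)).deriv
        have h2 := IsC21.dxx_eq (f := fun _ _ : ℝ => (0 : ℝ)) (fx := fun _ _ => 0) (t := t)
          (fun y _ => hasDerivAt_const y (0 : ℝ)) hx (hasDerivAt_const x (0 : ℝ))
        rw [h1, h2, mul_zero]) hpr.heat)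
      (continuousOn_const.sub hpr.cont_pos) (fun t ht => Or.inr
        ⟨_, (hasDerivWithinAt_const 0 _ (0 : ℝ)).sub (hpr.hasDerivWithinAt_bdry ht), by
          have h1 := hpr.bdry t ht
          linarith⟩) (fun T hT => by
        obtain ⟨M, hM⟩ := hpr.growth T hT
        refine ⟨M, fun x hx t ht => ?_⟩
        rw [zero_sub]
        exact (neg_le_abs _).trans (hM x hx t ⟨ht.1.le, ht.2⟩)) (fun x hx η hη => by
        filter_upwards [(hpinit x hx).eventually (Ioi_mem_nhds (colehopfInit_pos x))] with z hz
        have hz : 0 < p z.1 z.2 := hz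
        linarith)
    intro x hx t ht
    linarith [key x hx t ht]
  -- `p` dominates the Dirichlet solution `v` with the same initial values
  have hvs : IsSmooth v := isSmooth_heatFlow hε hgb.expBounded_oddExt
  have hvE : ∀ x t, v x t ≤ heatFlow ε (fun y => g |y|) x t := fun x t => by
    refine heatFlow_mono hgb.expBounded_oddExt (expBounded_even_colehopfInit hε hu) fun y => ?_
    rcases lt_trichotomy y 0 with hy | rfl | hy
    · rw [oddExt_of_neg hy, abs_of_neg hy]
      linarith [colehopfInit_pos (ε := ε) (u₀ := u₀) (-y)]
    · rw [oddExt_zero]; exact (colehopfInit_pos _).le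
    · rw [oddExt_of_pos hy, abs_of_pos hy]
  have hvp : ∀ x ≥ 0, ∀ t > 0, v x t ≤ p x t := by
    have key := heat_nonpos (b := b) hε (hvs.isC21.sub hpr.c21)
      (heat_sub hvs.isC21 hpr.c21
        (fun x hx t ht => heatFlow_heat hε hgb.expBounded_oddExt hx ht) hpr.heat)
      ((continuousOn_heatFlow hε hgb.expBounded_oddExt).sub hpr.cont_pos) (fun t ht => Or.inl (by
        have h1 : v 0 t = 0 := heatFlow_oddExt_zero
        simp only [h1]
        linarith [hpn 0 le_rfl t ht])) (fun T hT => by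
        obtain ⟨M, hM0, hM⟩ := heatFlow_bound hε hgb.expBounded_oddExt T
        obtain ⟨L, hL0, hL⟩ := exp_le_gaussian hM0 hM0
        refine ⟨L, fun x hx t ht => ?_⟩
        have h1 := (le_abs_self _).trans (hM x t ht.2)
        rw [abs_of_nonneg hx] at h1
        linarith [hpn x hx t ht.1, hL x hx]) (fun x hx η hη => by
        have hc : ContinuousAt (fun y => g |y|) x :=
          ((continuousOn_colehopfInit hu).comp_continuous continuous_abs abs_nonneg).continuousAt
        have h1 := (continuousAt_heatFlow_init (ε := ε) (expBounded_even_colehopfInit hε hu)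
          hc).tendsto.mono_left (nhdsWithin_le_nhds (s := Ici 0 ×ˢ Ioi 0))
        have h2 := h1.sub (hpinit x hx)
        simp only [heatFlow_init, abs_of_nonneg hx, hg, sub_self] at h2
        filter_upwards [h2.eventually (Iio_mem_nhds hη)] with z hz
        have hz : heatFlow ε (fun y => g |y|) z.1 z.2 - p z.1 z.2 < η := hz
        linarith [hvE z.1 z.2])
    intro x hx t ht
    linarith [key x hx t ht]
  obtain ⟨Cu, hCu0, hCu⟩ := hu.bound
  set C := (|b| + Cu) / ε with hC
  have hC0 : 0 ≤ C := by positivity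
  have hrg : ∀ y > 0, |r₀ y| ≤ C * g y := by
    intro y hy
    rw [hr₀, dirichletInit, abs_mul, abs_of_pos (colehopfInit_pos y), abs_div, abs_of_pos hε]
    refine mul_le_mul_of_nonneg_right ?_ (colehopfInit_pos y).le
    rw [hC]
    gcongr
    exact (abs_sub _ _).trans (by linarith [hCu y hy])
  have hrp : ∀ x ≥ 0, ∀ t > 0, |r x t| ≤ C * p x t := by
    intro x hx t ht
    have hCg : ∀ c : ℝ, HalfExpBounded fun y => c * g y := fun c => (HalfExpBounded.const c).mul hgb
    have h1 := heatFlow_oddExt_mono hε hrb (hCg C)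
      (fun y hy => (le_abs_self _).trans (hrg y hy)) hx ht
    have h2 := heatFlow_oddExt_mono hε (hCg (-C)) hrb
      (fun y hy => by linarith [neg_abs_le (r₀ y), hrg y hy]) hx ht
    rw [heatFlow_oddExt_const_mul] at h1 h2
    have h3 := mul_le_mul_of_nonneg_left (hvp x hx t ht) hC0
    rw [abs_le]
    constructor <;> linarith
  -- hence `|p_x| ≤ K p`, so that `exp (± K x) p` is monotone in `x`
  set K := C + |b / ε| with hK
  have hpK : ∀ x ≥ 0, ∀ t > 0, |r x t - b / ε * p x t| ≤ K * p x t := by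
    intro x hx t ht
    calc |r x t - b / ε * p x t| ≤ |r x t| + |b / ε * p x t| := abs_sub _ _
      _ ≤ C * p x t + |b / ε| * p x t := by
          rw [abs_mul, abs_of_nonneg (hpn x hx t ht)]
          exact add_le_add_left (hrp x hx t ht) _
      _ = _ := by ring
  have hexpd : ∀ (c x t : ℝ), 0 ≤ x → 0 < t →
      HasDerivWithinAt (fun y => Real.exp (c * y) * p y t)
        (Real.exp (c * x) * (c * p x t + (r x t - b / ε * p x t))) (Ici 0) x := by
    intro c x t hx ht
    have h1 : HasDerivAt (fun y => Real.exp (c * y)) (Real.exp (c * x) * c) x := by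
      simpa using ((hasDerivAt_id x).const_mul c).exp
    exact (h1.hasDerivWithinAt.mul (hpx x hx t ht)).congr_deriv (by ring)
  have hlow : ∀ x ≥ 0, ∀ t > 0, p 0 t ≤ Real.exp (K * x) * p x t := by
    intro x hx t ht
    have hm : MonotoneOn (fun y => Real.exp (K * y) * p y t) (Ici 0) := by
      refine monotoneOn_of_deriv_nonneg (convex_Ici 0)
        (fun y hy => (hexpd K y t hy ht).continuousWithinAt) (fun y hy => ?_) (fun y hy => ?_)
      all_goals rw [interior_Ici] at hy
      · exact ((hexpd K y t (le_of_lt hy) ht).mono interior_subset).differentiableWithinAt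
      · rw [((hexpd K y t (le_of_lt hy) ht).hasDerivAt (Ici_mem_nhds hy)).deriv]
        have := (abs_le.1 (hpK y (le_of_lt hy) t ht)).1
        exact mul_nonneg (Real.exp_pos _).le (by linarith)
    simpa using hm self_mem_Ici hx hx
  have hup : ∀ x ≥ 0, ∀ t > 0, Real.exp (-K * x) * p x t ≤ p 0 t := by
    intro x hx t ht
    have hm : AntitoneOn (fun y => Real.exp (-K * y) * p y t) (Ici 0) := by
      refine antitoneOn_of_deriv_nonpos (convex_Ici 0)
        (fun y hy => (hexpd (-K) y t hy ht).continuousWithinAt) (fun y hy => ?_) (fun y hy => ?_)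
      all_goals rw [interior_Ici] at hy
      · exact ((hexpd (-K) y t (le_of_lt hy) ht).mono interior_subset).differentiableWithinAt
      · rw [((hexpd (-K) y t (le_of_lt hy) ht).hasDerivAt (Ici_mem_nhds hy)).deriv]
        have := (abs_le.1 (hpK y (le_of_lt hy) t ht)).2
        exact mul_nonpos_of_nonneg_of_nonpos (Real.exp_pos _).le (by linarith)
    simpa using hm self_mem_Ici hx hx
  have hppos : ∀ x ≥ 0, ∀ t ≥ 0, 0 < p x t := by
    intro x hx t ht
    rcases eq_or_lt_of_le ht with h0 | h0
    · rw [← h0, hp0 x hx]; exact colehopfInit_pos x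
    have hin : ∀ y > 0, 0 < p y t := fun y hy =>
      (heatFlow_oddExt_pos hε hgb (fun y _ => colehopfInit_pos y) hy h0).trans_le
        (hvp y (le_of_lt hy) t h0)
    rcases eq_or_lt_of_le hx with h1 | h1
    · rw [← h1]
      exact (mul_pos (Real.exp_pos _) (hin 1 one_pos)).trans_le (hup 1 zero_le_one t h0)
    · exact hin x h1
  refine ⟨p, hps, hpr, hp0, hpx, hppos, ⟨C, hC0, hrp⟩, fun T hT => ?_⟩
  obtain ⟨t₀, ht₀, hmin⟩ := (isCompact_Icc (a := (0 : ℝ)) (b := T)).exists_isMinOn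
    ⟨0, le_rfl, hT.le⟩ (f := fun t => p 0 t)
    (hpr.cont.comp (f := fun t : ℝ => ((0 : ℝ), t)) (by fun_prop) fun t ht => ⟨self_mem_Ici, ht.1⟩)
  refine ⟨p 0 t₀, hppos 0 le_rfl t₀ ht₀.1, K, by positivity, fun x hx t ht => ?_⟩
  have h1 : p 0 t₀ ≤ p 0 t := hmin ⟨ht.1.le, ht.2⟩
  have h2 := h1.trans (hlow x hx t ht.1)
  have h3 : Real.exp (-K * x) * Real.exp (K * x) = 1 := by rw [← Real.exp_add]; simp
  calc p 0 t₀ * Real.exp (-K * x) ≤ Real.exp (K * x) * p x t * Real.exp (-K * x) := by gcongr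
    _ = (Real.exp (-K * x) * Real.exp (K * x)) * p x t := by ring
    _ = p x t := by rw [h3, one_mul]

end ColeHopf

/-! ### The adhesion system from the heat equation -/

lemma IsSmooth.dt_dx_of_eq {φ F : ℝ → ℝ → ℝ} (hφ : IsSmooth φ)
    (h : ∀ x > 0, ∀ t > 0, Adhesion.dt φ x t = F x t) {x t : ℝ} (hx : 0 < x) (ht : 0 < t) :
    Adhesion.dt (Adhesion.dx φ) x t = Adhesion.dx F x t := by
  rw [hφ.dt_dx hx ht]
  exact dx_congr_pos (fun y hy => h y hy t ht) hx

section System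

variable {ε b : ℝ} {p q r s : ℝ → ℝ → ℝ}

lemma isSmooth_velocity (hp : IsSmooth p) (hpos : ∀ x > 0, ∀ t > 0, 0 < p x t) :
    IsSmooth (velocity ε p) :=
  (hp.dx.div hp fun x hx t ht => (hpos x hx t ht).ne').const_mul (-ε)

lemma isSmooth_density (hp : IsSmooth p) (hq : IsSmooth q) (hpos : ∀ x > 0, ∀ t > 0, 0 < p x t) :
    IsSmooth (density p q) :=
  (hq.div hp fun x hx t ht => (hpos x hx t ht).ne').dx

/-- The viscous Burgers equation is the `x`-derivative of `φ_t + φ_x² / 2 = (ε/2) φ_xx`, satisfied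
by `φ = -ε log p`. -/
lemma velocity_eq (hp : IsSmooth p) (hpos : ∀ x > 0, ∀ t > 0, 0 < p x t)
    (heat : ∀ x > 0, ∀ t > 0, dt p x t = ε / 2 * dx (dx p) x t) {x t : ℝ} (hx : 0 < x)
    (ht : 0 < t) :
    dt (velocity ε p) x t + dx (fun y s => velocity ε p y s ^ 2 / 2) x t
      = ε / 2 * dx (dx (velocity ε p)) x t := by
  set u := velocity ε p with hu
  have hus : IsSmooth u := isSmooth_velocity hp hpos
  have hφ : IsSmooth fun x t => -ε * Real.log (p x t) :=
    contDiffOn_const.mul (ContDiffOn.log hp fun z hz => (hpos z.1 hz.1 z.2 hz.2).ne')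
  have hφx : ∀ y > 0, ∀ s > 0, dx (fun x t => -ε * Real.log (p x t)) y s = u y s :=
    fun y hy s hs => dx_eq hy (((hp.hasDerivAt_x hy hs).log (hpos y hy s hs).ne').const_mul (-ε))
  have hux : ∀ y > 0, ∀ s > 0, dx u y s
      = -ε * ((dx (dx p) y s * p y s - dx p y s * dx p y s) / p y s ^ 2) := fun y hy s hs =>
    dx_eq hy (((hp.dx.hasDerivAt_x hy hs).div (hp.hasDerivAt_x hy hs)
      (hpos y hy s hs).ne').const_mul (-ε))
  have hφt : ∀ y > 0, ∀ s > 0, dt (fun x t => -ε * Real.log (p x t)) y s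
      = ε / 2 * dx u y s - u y s ^ 2 / 2 := fun y hy s hs => by
    have h0 := (hpos y hy s hs).ne'
    have h1 : dt (fun x t => -ε * Real.log (p x t)) y s = -ε * (dt p y s / p y s) :=
      (((hp.hasDerivAt_t hy hs).log h0).const_mul (-ε)).deriv
    rw [h1, heat y hy s hs, hux y hy s hs, hu, velocity]
    field_simp
    ring
  have h1 : dt u x t = dx (fun y s => ε / 2 * dx u y s - u y s ^ 2 / 2) x t := by
    rw [← hφ.dt_dx_of_eq hφt hx ht]
    exact dt_congr_pos (fun s hs => (hφx x hx s hs).symm) ht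
  have h2 := ((hus.hasDerivAt_x hx ht).pow 2).div_const 2
  rw [h1, dx_eq (f := fun y s => ε / 2 * dx u y s - u y s ^ 2 / 2) hx
    (((hus.dx.hasDerivAt_x hx ht).const_mul (ε / 2)).sub h2),
    dx_eq (f := fun y s => u y s ^ 2 / 2) hx h2]
  ring

/-- The continuity equation is the `x`-derivative of `w_t + u w_x = (ε/2) w_xx`, satisfied by
`w = q / p`. -/
lemma density_eq (hp : IsSmooth p) (hq : IsSmooth q) (hpos : ∀ x > 0, ∀ t > 0, 0 < p x t)
    (heat : ∀ x > 0, ∀ t > 0, dt p x t = ε / 2 * dx (dx p) x t)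
    (heat' : ∀ x > 0, ∀ t > 0, dt q x t = ε / 2 * dx (dx q) x t) {x t : ℝ} (hx : 0 < x)
    (ht : 0 < t) :
    dt (density p q) x t + dx (fun y s => density p q y s * velocity ε p y s) x t
      = ε / 2 * dx (dx (density p q)) x t := by
  have hus : IsSmooth (velocity ε p) := isSmooth_velocity hp hpos
  set w : ℝ → ℝ → ℝ := fun x t => q x t / p x t with hw
  have hws : IsSmooth w := hq.div hp fun x hx t ht => (hpos x hx t ht).ne'
  have hρ : density p q = dx w := rfl
  have hqw : ∀ y > 0, ∀ s > 0, q y s = w y s * p y s := fun y hy s hs =>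
    (div_mul_cancel₀ _ (hpos y hy s hs).ne').symm
  have hwt : ∀ y > 0, ∀ s > 0, dt w y s = ε / 2 * dx (dx w) y s - dx w y s * velocity ε p y s := by
    intro y hy s hs
    have h0 := (hpos y hy s hs).ne'
    have h1 : dt q y s = dt w y s * p y s + w y s * dt p y s :=
      (dt_congr_pos (g := fun y s => w y s * p y s) (fun τ hτ => hqw y hy τ hτ) hs).trans
        ((hws.hasDerivAt_t hy hs).mul (hp.hasDerivAt_t hy hs)).deriv
    have h2 : dx (dx q) y s = dx (dx w) y s * p y s + dx w y s * dx p y s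
        + (dx w y s * dx p y s + w y s * dx (dx p) y s) :=
      IsC21.dxx_eq (fx := fun y s => dx w y s * p y s + w y s * dx p y s)
        (fun z hz => hasDerivAt_congr_pos (fun v hv => (hqw v hv s hs).symm) hz
          ((hws.hasDerivAt_x hz hs).mul (hp.hasDerivAt_x hz hs))) hy
        (((hws.dx.hasDerivAt_x hy hs).mul (hp.hasDerivAt_x hy hs)).add
          ((hws.hasDerivAt_x hy hs).mul (hp.dx.hasDerivAt_x hy hs)))
    have h3 := heat' y hy s hs
    rw [h1, h2, heat y hy s hs] at h3
    have h4 : dt w y s * p y s = (ε / 2 * dx (dx w) y s - dx w y s * velocity ε p y s) * p y s := by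
      have h5 : velocity ε p y s * p y s = -ε * dx p y s := by rw [velocity]; field_simp
      linear_combination h3 + dx w y s * h5
    exact mul_right_cancel₀ h0 h4
  have h1 : dt (dx w) x t
      = dx (fun y s => ε / 2 * dx (dx w) y s - dx w y s * velocity ε p y s) x t :=
    hws.dt_dx_of_eq hwt hx ht
  have h2 := (hws.dx.hasDerivAt_x hx ht).mul (hus.hasDerivAt_x hx ht)
  rw [hρ, h1, dx_eq (f := fun y s => ε / 2 * dx (dx w) y s - dx w y s * velocity ε p y s) hx
    (((hws.dx.dx.hasDerivAt_x hx ht).const_mul (ε / 2)).sub h2),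
    dx_eq (f := fun y s => dx w y s * velocity ε p y s) hx h2]
  ring

variable {x t : ℝ}

lemma velocity_eq_of_robin (hε : ε ≠ 0) (hx : 0 ≤ x) (h0 : p x t ≠ 0)
    (hp : HasDerivWithinAt (fun y => p y t) (r x t - b / ε * p x t) (Ici 0) x) :
    velocity ε p x t = b - ε * (r x t / p x t) := by
  rw [velocity, dx_eq_of_within hx hp]
  field_simp
  ring

lemma density_eq_of_robin (hx : 0 ≤ x) (h0 : p x t ≠ 0)
    (hp : HasDerivWithinAt (fun y => p y t) (r x t - b / ε * p x t) (Ici 0) x)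
    (hq : HasDerivWithinAt (fun y => q y t) (s x t - b / ε * q x t) (Ici 0) x) :
    density p q x t = (s x t - q x t / p x t * r x t) / p x t := by
  rw [density, dx_eq_of_within (f := fun x t => q x t / p x t) hx (hq.div hp h0)]
  field_simp
  ring

end System

/-! ### Existence for the adhesion system -/

lemma BoundaryData.mul_of_lipschitz {β ρB : ℝ → ℝ} (hβ : ContinuousOn β (Ici 0))
    (hρB : ∃ K, LipschitzOnWith K ρB (Ioi 0)) : BoundaryData fun t => β t * ρB t where
  cont := (hβ.mono Ioi_subset_Ici_self).mul hρB.choose_spec.continuousOn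
  bound T := by
    obtain ⟨K, hK⟩ := hρB
    obtain ⟨M, hM⟩ := (isCompact_Icc (a := (0 : ℝ)) (b := T)).exists_bound_of_continuousOn
      (hβ.mono Icc_subset_Ici_self)
    refine ⟨M * (|ρB 1| + K * (T + 1)), fun t ht => ?_⟩
    have h1 : |β t| ≤ M := hM t ⟨ht.1.le, ht.2⟩
    have h2 := hK.dist_le_mul t ht.1 1 (mem_Ioi.2 one_pos)
    rw [Real.dist_eq, Real.dist_eq] at h2
    have h3 : |t - 1| ≤ T + 1 := abs_le.2 ⟨by linarith [ht.1, ht.2], by linarith [ht.2]⟩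
    have h4 : (K : ℝ) * |t - 1| ≤ K * (T + 1) := by gcongr
    have h5 := abs_sub_abs_le_abs_sub (ρB t) (ρB 1)
    rw [abs_mul]
    exact mul_le_mul h1 (by linarith) (abs_nonneg _) ((abs_nonneg _).trans h1)

section Existence

variable {ε b : ℝ} {u₀ ρ₀ ρB : ℝ → ℝ}

lemma mul_exp_sq_le {a k : ℝ} (ha : 0 ≤ a) (hk : 0 ≤ k) (x : ℝ) :
    a * Real.exp (k * x ^ 2) ≤ (a + k) * Real.exp ((a + k) * x ^ 2) := by
  have h1 : k * x ^ 2 ≤ (a + k) * x ^ 2 := by nlinarith [sq_nonneg x]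
  exact mul_le_mul (by linarith) (Real.exp_le_exp.2 h1) (Real.exp_pos _).le (by linarith)

lemma density_growth {p q r s : ℝ → ℝ → ℝ} {c C K L M T : ℝ} (hc : 0 < c) (hC : 0 ≤ C)
    (hK : 0 ≤ K) (hL : 0 ≤ L) (hM : 0 ≤ M)
    (hp : ∀ x ≥ 0, ∀ t ∈ Ioc 0 T, c * Real.exp (-K * x) ≤ p x t)
    (hr : ∀ x ≥ 0, ∀ t ∈ Ioc 0 T, |r x t| ≤ C * p x t)
    (hs : ∀ x ≥ 0, ∀ t ∈ Ioc 0 T, |s x t| ≤ L * Real.exp (L * x ^ 2))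
    (hq : ∀ x ≥ 0, ∀ t ∈ Ioc 0 T, |q x t| ≤ M * Real.exp (M * x ^ 2)) :
    ∃ N : ℝ, ∀ x ≥ 0, ∀ t ∈ Ioc 0 T,
      |(s x t - q x t / p x t * r x t) / p x t| ≤ N * Real.exp (N * x ^ 2) := by
  refine ⟨(L + C * M) * Real.exp K / c + (L + M + K), fun x hx t ht => ?_⟩
  have hp0 : 0 < p x t := (by positivity : 0 < c * Real.exp (-K * x)).trans_le (hp x hx t ht)
  have h1 : |s x t - q x t / p x t * r x t| ≤ (L + C * M) * Real.exp ((L + M) * x ^ 2) := by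
    calc |s x t - q x t / p x t * r x t| ≤ |s x t| + |q x t / p x t * r x t| := abs_sub _ _
      _ = |s x t| + |q x t| / p x t * |r x t| := by rw [abs_mul, abs_div, abs_of_pos hp0]
      _ ≤ L * Real.exp (L * x ^ 2) + M * Real.exp (M * x ^ 2) / p x t * (C * p x t) := by
          gcongr
          exacts [hs x hx t ht, hq x hx t ht, hr x hx t ht]
      _ = L * Real.exp (L * x ^ 2) + C * M * Real.exp (M * x ^ 2) := by field_simp
      _ ≤ L * Real.exp ((L + M) * x ^ 2) + C * M * Real.exp ((L + M) * x ^ 2) := by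
          gcongr <;> linarith
      _ = _ := by ring
  have h2 : (p x t)⁻¹ ≤ Real.exp K / c * Real.exp (K * x ^ 2) := by
    have h3 : c * Real.exp (-(K + K * x ^ 2)) ≤ p x t := by
      refine le_trans ?_ (hp x hx t ht)
      gcongr
      nlinarith [sq_nonneg (x - 1), sq_nonneg x]
    refine (inv_anti₀ (by positivity) h3).trans (le_of_eq ?_)
    rw [Real.exp_neg, mul_inv, inv_inv, Real.exp_add]
    ring
  rw [abs_div, abs_of_pos hp0, div_eq_mul_inv]
  calc _ ≤ (L + C * M) * Real.exp ((L + M) * x ^ 2) * (Real.exp K / c * Real.exp (K * x ^ 2)) := by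
        gcongr
    _ = (L + C * M) * Real.exp K / c * Real.exp ((L + M + K) * x ^ 2) := by
        rw [add_mul (L + M) K, Real.exp_add]; ring
    _ ≤ _ := by
        exact mul_exp_sq_le (by positivity) (by positivity) x

/-- The function `q` together with the initial and boundary behaviour of `(q / p)_x`. With
`s = q_x + (b/ε) q` and `r = p_x + (b/ε) p` one has `(q / p)_x = (s - (q / p) r) / p`; although
`s` and `r` do not converge at jumps of `u₀`, the combination `s - R₀ r` does. -/
theorem exists_adhesion (hε : 0 < ε) (hu : HalfLineData u₀) (hρ : HalfLineData ρ₀)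
    (hρB : ∃ K, LipschitzOnWith K ρB (Ioi 0)) (b : ℝ) :
    ∃ p q : ℝ → ℝ → ℝ, IsSmooth p ∧ IsSmooth q ∧
      IsRobinHeatSolution ε b (colehopfInit ε u₀) (fun _ => 0) p ∧
      IsRobinHeatSolution ε b (fun x => primitive ρ₀ x * colehopfInit ε u₀ x)
        (fun t => ε * p 0 t * ρB t) q ∧
      (∀ x ≥ 0, ∀ t ≥ 0, 0 < p x t) ∧
      IsAdhesionSolution ε u₀ ρ₀ (fun _ => b) ρB (velocity ε p) (density p q) := by
  obtain ⟨p, hps, hpr, hp0, hpx, hpos, ⟨C, hC0, hrC⟩, hlow⟩ := exists_colehopf hε hu b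
  set g := colehopfInit ε u₀ with hg
  set r₀ := dirichletInit ε b u₀ with hr₀
  set r := heatFlow ε (oddExt r₀) with hr
  have hgb : HalfExpBounded g := halfExpBounded_colehopfInit hε hu
  have hrb : HalfExpBounded r₀ := halfExpBounded_dirichletInit hε hu
  have hgc : ∀ x > 0, ContinuousAt g x := fun x hx =>
    (continuousOn_colehopfInit hu).continuousAt (Ici_mem_nhds hx)
  have hRc : ∀ x > 0, ContinuousAt (primitive ρ₀) x := fun x hx =>
    hρ.continuousOn_primitive.continuousAt (Ici_mem_nhds hx)
  have hrc : ContinuousOn (fun z : ℝ × ℝ => r z.1 z.2) (Ici 0 ×ˢ Ioi 0) :=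
    continuousOn_heatFlow hε hrb.expBounded_oddExt
  -- the Dirichlet solution `s`
  set β : ℝ → ℝ := fun t => p 0 t * ρB t with hβdef
  have hβ : BoundaryData β := BoundaryData.mul_of_lipschitz (β := fun t => p 0 t)
    (hpr.cont.comp (f := fun t : ℝ => ((0 : ℝ), t)) (by fun_prop)
      fun t ht => ⟨self_mem_Ici, ht⟩) hρB
  have hb1 : HalfExpBounded fun x => ρ₀ x * g x := hρ.halfExpBounded.mul hgb
  have hb2 : HalfExpBounded fun x => primitive ρ₀ x * r₀ x := hρ.halfExpBounded_primitive.mul hrb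
  have hf1 := isHeatFlow_oddExt hε hb1 (by
    filter_upwards [hρ.ae_continuousAt] with x hx h0 using (hx h0).mul (hgc x h0))
  have hf2 := isHeatFlow_oddExt hε hb2 (by
    filter_upwards [hu.ae_continuousAt] with x hx h0 using
      (hRc x h0).mul (continuousAt_dirichletInit hu h0 (hx h0)))
  have hsf := hf1.add (hf2.add (isHeatFlow_doubleLayer hε hβ))
  obtain ⟨q, hqs, hqr, hq0, hqx⟩ := exists_robin_of_heatFlow hε b
    (G := fun x => primitive ρ₀ x * g x) hsf
    (exp_mul_eq_integral (hu.countable.union hρ.countable)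
      (hρ.continuousOn_primitive.mul (continuousOn_colehopfInit hu))
      (hb1.add (hb2.add (HalfExpBounded.const 0))) fun x hx hxs => by
        rw [mem_union, not_or] at hxs
        have hc : ContinuousAt u₀ x := by
          by_contra h
          exact hxs.1 ⟨hx, h⟩
        have hc' : ContinuousAt ρ₀ x := by
          by_contra h
          exact hxs.2 ⟨hx, h⟩
        refine ((hρ.hasDerivAt_primitive hx hc').mul
          (hasDerivAt_colehopfInit hu hx hc)).congr_deriv ?_
        simp only [hr₀, dirichletInit, hg]; ring)
  set H₁ := heatFlow ε (oddExt fun x => ρ₀ x * g x) with hH₁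
  set H₂ := heatFlow ε (oddExt fun x => primitive ρ₀ x * r₀ x) with hH₂
  set s : ℝ → ℝ → ℝ := fun x t => H₁ x t + (H₂ x t + doubleLayer ε β x t) with hs
  have hs0 : ∀ t > 0, s 0 t = β t := fun t ht => by
    simp only [hs, hH₁, hH₂, heatFlow_oddExt_zero, doubleLayer_zero ht, zero_add]
  have hqr' : IsRobinHeatSolution ε b (fun x => primitive ρ₀ x * g x)
      (fun t => ε * p 0 t * ρB t) q :=
    { hqr with
      bdry := fun t ht => by
        rw [hqr.bdry t ht]
        change ε * s 0 t = _
        rw [hs0 t ht, hβdef, mul_assoc] }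
  have hne : ∀ x ≥ 0, ∀ t > 0, p x t ≠ 0 := fun x hx t ht => (hpos x hx t (le_of_lt ht)).ne'
  have hu_eq : ∀ x ≥ 0, ∀ t > 0, velocity ε p x t = b - ε * (r x t / p x t) := fun x hx t ht =>
    velocity_eq_of_robin hε.ne' hx (hne x hx t ht) (hpx x hx t ht)
  have hρ_eq : ∀ x ≥ 0, ∀ t > 0,
      density p q x t = (s x t - q x t / p x t * r x t) / p x t := fun x hx t ht =>
    density_eq_of_robin (s := s) hx (hne x hx t ht) (hpx x hx t ht) (hqx x hx t ht)
  have hpos' : ∀ x > 0, ∀ t > 0, 0 < p x t := fun x hx t ht => hpos x (le_of_lt hx) t (le_of_lt ht)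
  have hsub : quarter ⊆ Ici 0 ×ˢ Ioi 0 := prod_mono Ioi_subset_Ici_self le_rfl
  -- behaviour at the initial line
  have hpt : ∀ x > 0, Tendsto (fun z : ℝ × ℝ => p z.1 z.2) (𝓝[quarter] (x, 0)) (𝓝 (g x)) :=
    fun x hx => hp0 x (le_of_lt hx) ▸
      (tendsto_init_of_continuousOn hpr.cont (le_of_lt hx)).mono_left
      (nhdsWithin_mono _ hsub)
  have hqt : ∀ x > 0, Tendsto (fun z : ℝ × ℝ => q z.1 z.2) (𝓝[quarter] (x, 0))
      (𝓝 (primitive ρ₀ x * g x)) :=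
    fun x hx => hq0 x (le_of_lt hx) ▸
      (tendsto_init_of_continuousOn hqr.cont (le_of_lt hx)).mono_left
      (nhdsWithin_mono _ hsub)
  have hgne : ∀ x, g x ≠ 0 := fun x => (colehopfInit_pos x).ne'
  refine ⟨p, q, hps, hqs, hpr, hqr', hpos, ?_⟩
  exact
  { u_c21 := (isSmooth_velocity hps hpos').isC21
    rho_c21 := (isSmooth_density hps hqs hpos').isC21
    u_eq := fun x hx t ht => velocity_eq hps hpos' hpr.heat hx ht
    rho_eq := fun x hx t ht => density_eq hps hqs hpos' hpr.heat hqr.heat hx ht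
    u_cont := (continuousOn_const.sub (continuousOn_const.mul
      (hrc.div hpr.cont_pos fun z hz => hne z.1 hz.1 z.2 hz.2))).congr
        fun z hz => hu_eq z.1 hz.1 z.2 hz.2
    rho_cont := ((hsf.cont.sub ((hqr.cont_pos.div hpr.cont_pos
      fun z hz => hne z.1 hz.1 z.2 hz.2).mul hrc)).div hpr.cont_pos
        fun z hz => hne z.1 hz.1 z.2 hz.2).congr fun z hz => hρ_eq z.1 hz.1 z.2 hz.2
    u_bdry := fun t ht => by
      rw [hu_eq 0 le_rfl t ht, hr, heatFlow_oddExt_zero, zero_div, mul_zero, sub_zero]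
    rho_bdry := fun t ht => by
      rw [hρ_eq 0 le_rfl t ht, hs0 t ht, hr, heatFlow_oddExt_zero, mul_zero, sub_zero, hβdef]
      exact mul_div_cancel_left₀ _ (hne 0 le_rfl t ht)
    u_init := fun x hx hc => by
      have h1 := (tendsto_heatFlow_oddExt (ε := ε) hrb hx
        (continuousAt_dirichletInit hu hx hc)).mono_left (nhdsWithin_le_nhds (s := quarter))
      have h2 := ((h1.div (hpt x hx) (hgne x)).const_mul ε).const_sub b
      have h3 : b - ε * (r₀ x / g x) = u₀ x := by
        have := hgne x
        simp only [hr₀, dirichletInit]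
        rw [mul_div_assoc, div_self this]
        field_simp
        ring
      rw [h3] at h2
      refine h2.congr' ?_
      filter_upwards [self_mem_nhdsWithin] with z hz
      exact (hu_eq z.1 (hsub hz).1 z.2 hz.2).symm
    rho_init := fun x hx hc => by
      have hle := nhdsWithin_le_nhds (a := (x, (0 : ℝ))) (s := quarter)
      have h1 := (tendsto_heatFlow_oddExt (ε := ε) hb1 hx (hc.mul (hgc x hx))).mono_left hle
      -- the data `(R₀ - R₀ x) r₀` vanish at `x` continuously, whether or not `u₀` jumps there
      have h2 : Tendsto (fun z : ℝ × ℝ => H₂ z.1 z.2 - primitive ρ₀ x * r z.1 z.2)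
          (𝓝[quarter] (x, 0)) (𝓝 0) := by
        have hb3 : HalfExpBounded fun y => -primitive ρ₀ x * r₀ y :=
          (HalfExpBounded.const _).mul hrb
        have hc3 : ContinuousAt (fun y => primitive ρ₀ y * r₀ y + -primitive ρ₀ x * r₀ y) x := by
          obtain ⟨M, hM0, hM⟩ := hrb.bound
          have h4 : Tendsto (fun y => |primitive ρ₀ y - primitive ρ₀ x| * (M * Real.exp (M * y)))
              (𝓝 x) (𝓝 (|primitive ρ₀ x - primitive ρ₀ x| * (M * Real.exp (M * x)))) :=
            ((hRc x hx).sub continuousAt_const).abs.mul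
              (by fun_prop : Continuous fun y => M * Real.exp (M * y)).continuousAt
          rw [sub_self, abs_zero, zero_mul] at h4
          have h5 : primitive ρ₀ x * r₀ x + -primitive ρ₀ x * r₀ x = 0 := by ring
          rw [ContinuousAt, h5]
          refine squeeze_zero_norm' ?_ h4
          filter_upwards [Ioi_mem_nhds hx] with y hy
          rw [Real.norm_eq_abs, ← add_mul, ← sub_eq_add_neg, abs_mul]
          gcongr
          exact hM y hy
        have h4 := (tendsto_heatFlow_oddExt (ε := ε) (hb2.add hb3) hx hc3).mono_left hle
        have h5 : primitive ρ₀ x * r₀ x + -primitive ρ₀ x * r₀ x = 0 := by ring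
        rw [h5] at h4
        refine h4.congr fun z => ?_
        rw [heatFlow_oddExt_add hb2 hb3, heatFlow_oddExt_const_mul]
        ring
      have h3 : Tendsto (fun z : ℝ × ℝ => doubleLayer ε β z.1 z.2) (𝓝[quarter] (x, 0)) (𝓝 0) := by
        have h := (continuousAt_doubleLayer hβ hε (x := x) (t := 0) (Or.inl hx.ne')).tendsto
        simp only [doubleLayer_init hε] at h
        exact h.mono_left hle
      have h4 : Tendsto (fun z : ℝ × ℝ => (primitive ρ₀ x - q z.1 z.2 / p z.1 z.2) * r z.1 z.2)
          (𝓝[quarter] (x, 0)) (𝓝 0) := by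
        have h5 := ((((hpt x hx).const_mul (primitive ρ₀ x)).sub (hqt x hx)).abs).const_mul C
        rw [sub_self, abs_zero, mul_zero] at h5
        refine squeeze_zero_norm' ?_ h5
        filter_upwards [self_mem_nhdsWithin] with z hz
        have hz0 := hpos' z.1 hz.1 z.2 hz.2
        have h6 : primitive ρ₀ x * p z.1 z.2 - q z.1 z.2
            = (primitive ρ₀ x - q z.1 z.2 / p z.1 z.2) * p z.1 z.2 := by field_simp
        rw [Real.norm_eq_abs, h6, abs_mul, abs_mul, abs_of_pos hz0]
        calc _ ≤ |primitive ρ₀ x - q z.1 z.2 / p z.1 z.2| * (C * p z.1 z.2) := by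
              gcongr
              exact hrC z.1 (hsub hz).1 z.2 hz.2
          _ = _ := by ring
      have h5 := ((h1.add (h2.add (h3.add h4))).div (hpt x hx) (hgne x))
      simp only [add_zero] at h5
      rw [mul_div_cancel_right₀ _ (hgne x)] at h5
      refine h5.congr' ?_
      filter_upwards [self_mem_nhdsWithin] with z hz
      rw [Pi.div_apply, hρ_eq z.1 (hsub hz).1 z.2 hz.2]
      congr 1
      simp only [hs]
      ring
    u_bdd := fun T hT => by
      refine ⟨|b| + ε * C, fun x hx t ht => ?_⟩
      have h0 := hpos x hx t ht.1.le
      rw [hu_eq x hx t ht.1]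
      refine (abs_sub _ _).trans ?_
      rw [abs_mul, abs_div, abs_of_pos hε, abs_of_pos h0]
      gcongr
      rw [div_le_iff₀ h0]
      exact hrC x hx t ht.1
    rho_growth := fun T hT => by
      obtain ⟨c, hc, K, hK, hcK⟩ := hlow T hT
      obtain ⟨M, hM⟩ := hqr.growth T hT
      obtain ⟨L₀, hL₀, hsL⟩ := hsf.bound T
      obtain ⟨L, hL, hL'⟩ := exp_le_gaussian hL₀ hL₀
      obtain ⟨N, hN⟩ := density_growth (p := p) (q := q) (r := r) (s := s) (M := |M|) hc hC0 hK hL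
        (abs_nonneg M) hcK (fun x hx t ht => hrC x hx t ht.1)
        (fun x hx t ht => (hsL x hx t ht).trans (hL' x hx))
        (fun x hx t ht => (hM x hx t ⟨ht.1.le, ht.2⟩).trans (by
          have := le_abs_self M
          gcongr))
      refine ⟨N, fun x hx t ht => ?_⟩
      rw [hρ_eq x hx t ht.1]
      exact hN x hx t ht }

end Existence

/-! ### Uniqueness for the adhesion system -/

lemma tendsto_prodMk_quarter {x : ℝ} (hx : 0 < x) :
    Tendsto (fun t : ℝ => (x, t)) (𝓝[>] 0) (𝓝[quarter] (x, 0)) :=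
  tendsto_nhdsWithin_iff.2 ⟨tendsto_prodMk_nhdsGT x, by
    filter_upwards [self_mem_nhdsWithin] with t ht using mem_quarter.2 ⟨hx, ht⟩⟩

lemma exists_potential_bound {Φ A : ℝ → ℝ → ℝ} {A₀ : ℝ → ℝ} (hA₀ : HalfLineData A₀)
    (cont : ContinuousOn (fun z : ℝ × ℝ => Φ z.1 z.2) (Ici 0 ×ˢ Ici 0))
    (init : ∀ x ≥ 0, Φ x 0 = primitive A₀ x)
    (repr : ∀ x ≥ 0, ∀ t > 0, Φ x t = Φ 0 t + ∫ y in (0 : ℝ)..x, A y t) (T : ℝ) :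
    ∃ B, 0 ≤ B ∧ ∀ x ≥ 0, ∀ t ∈ Icc 0 T, ∀ m, 0 ≤ m →
      (0 < t → ∀ y ∈ Ioc 0 x, |A y t| ≤ m) → |Φ x t| ≤ B + (B + m) * x := by
  obtain ⟨C, hC0, hC⟩ := hA₀.primitive_bound
  obtain ⟨M, hM⟩ := (isCompact_Icc (a := (0 : ℝ)) (b := T)).exists_bound_of_continuousOn
    (cont.comp (f := fun t : ℝ => ((0 : ℝ), t)) (by fun_prop) fun t ht => ⟨self_mem_Ici, ht.1⟩)
  refine ⟨C + |M|, by positivity, fun x hx t ht m hm hA => ?_⟩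
  have hM0 := abs_nonneg M
  have hMx := mul_nonneg hM0 hx
  have hmx := mul_nonneg hm hx
  have hCx := mul_nonneg hC0 hx
  rcases eq_or_lt_of_le ht.1 with h0 | h0
  · rw [← h0, init x hx]
    linarith [hC x hx]
  · rw [repr x hx t h0]
    have h1 : |Φ 0 t| ≤ M := hM t ht
    have h2 := intervalIntegral.norm_integral_le_of_norm_le_const (a := 0) (b := x)
      (f := fun y => A y t) (C := m) fun y hy => hA h0 y (by rwa [uIoc_of_le hx] at hy)
    rw [Real.norm_eq_abs, sub_zero, abs_of_nonneg hx] at h2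
    linarith [abs_add_le (Φ 0 t) (∫ y in (0 : ℝ)..x, A y t), le_abs_self M]

namespace IsAdhesionSolution

variable {ε b : ℝ} {u₀ ρ₀ ρB : ℝ → ℝ} {u ρ : ℝ → ℝ → ℝ}

/-- Inverting the Cole–Hopf transform: a velocity field `u` has a potential `Φ` with
`Φ_t + Φ_x² / 2 = (ε/2) Φ_xx`, and `exp (-Φ / ε)` solves the Robin problem. -/
theorem exists_robin_of_velocity (hε : 0 < ε) (hu : HalfLineData u₀)
    (h : IsAdhesionSolution ε u₀ ρ₀ (fun _ => b) ρB u ρ) :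
    ∃ p : ℝ → ℝ → ℝ, IsRobinHeatSolution ε b (colehopfInit ε u₀) (fun _ => 0) p ∧
      ∀ x ≥ 0, ∀ t > 0, 0 < p x t ∧ dx p x t = -u x t / ε * p x t := by
  have hux := fun {x t : ℝ} (hx : 0 < x) (ht : 0 < t) => h.u_c21.hasDerivAt_x hx ht
  have hN : ∀ x > 0, ∀ t > 0,
      HasDerivAt (fun y => -(u y t ^ 2 / 2)) (-dx (fun y s => u y s ^ 2 / 2) x t) x := by
    intro x hx t ht
    have h1 := ((hux hx ht).pow 2).div_const 2
    rw [dx_eq (f := fun y s => u y s ^ 2 / 2) hx h1]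
    exact h1.neg
  have hbd : ∀ T : ℝ, ∃ M, 0 ≤ M ∧ ∀ x ≥ 0, ∀ t ∈ Ioc 0 T, |u x t| ≤ M := fun T => by
    obtain ⟨M, hM⟩ := h.u_bdd (max T 1) (by positivity)
    exact ⟨|M|, abs_nonneg M, fun x hx t ht =>
      (hM x hx t ⟨ht.1, ht.2.trans (le_max_left _ _)⟩).trans (le_abs_self M)⟩
  obtain ⟨Φ, hΦc, hΦx, hΦt, hΦ0, hΦr⟩ := exists_potential (ε := ε) (A₀ := u₀)
    (N := fun x t => -(u x t ^ 2 / 2)) h.u_c21 h.u_cont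
    (((h.u_c21.continuousOn.pow 2).div_const 2).neg) hN
    (fun x hx t ht => by linarith [h.u_eq x hx t ht])
    (fun X T => by
      obtain ⟨M, -, hM⟩ := hbd T
      exact ⟨M, fun x hx t ht => hM x hx.1.le t ht⟩)
    (fun X T => by
      obtain ⟨M, -, hM⟩ := hbd T
      refine ⟨M ^ 2 / 2, fun x hx t ht => ?_⟩
      rw [abs_neg, abs_of_nonneg (by positivity), ← sq_abs]
      gcongr
      exact hM x hx.1.le t ht)
    (by
      filter_upwards [hu.ae_continuousAt] with x hx h0
      exact (h.u_init x h0 (hx h0)).comp (tendsto_prodMk_quarter h0))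
  set p : ℝ → ℝ → ℝ := fun x t => Real.exp (-Φ x t / ε) with hp
  have hpc : ContinuousOn (fun z : ℝ × ℝ => p z.1 z.2) (Ici 0 ×ˢ Ici 0) :=
    (hΦc.neg.div_const ε).rexp
  have hpc' : ContinuousOn (fun z : ℝ × ℝ => p z.1 z.2) quarter :=
    hpc.mono (prod_mono Ioi_subset_Ici_self Ioi_subset_Ici_self)
  have hpx : ∀ x ≥ 0, ∀ t > 0,
      HasDerivWithinAt (fun y => p y t) (-u x t / ε * p x t) (Ici 0) x := fun x hx t ht =>
    (((hΦx x hx t ht).neg.div_const ε).exp).congr_deriv (by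
      simp only [hp, Pi.neg_apply]; ring)
  have hpx' : ∀ x > 0, ∀ t > 0, HasDerivAt (fun y => p y t) (-u x t / ε * p x t) x :=
    fun x hx t ht => (hpx x (le_of_lt hx) t ht).hasDerivAt (Ici_mem_nhds hx)
  have hpxx : ∀ x > 0, ∀ t > 0, HasDerivAt (fun y => -u y t / ε * p y t)
      (-dx u x t / ε * p x t + -u x t / ε * (-u x t / ε * p x t)) x := fun x hx t ht =>
    ((hux hx ht).neg.div_const ε).mul (hpx' x hx t ht)
  have hpt : ∀ x > 0, ∀ t > 0, HasDerivAt (fun s => p x s)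
      (-(ε / 2 * dx u x t - u x t ^ 2 / 2) / ε * p x t) t := fun x hx t ht =>
    (((hΦt x hx t ht).neg.div_const ε).exp).congr_deriv (by
      simp only [hp, Pi.neg_apply]; ring)
  have hdx : ∀ x ≥ 0, ∀ t > 0, dx p x t = -u x t / ε * p x t := fun x hx t ht =>
    dx_eq_of_within hx (hpx x hx t ht)
  refine ⟨p, ?_, fun x hx t ht => ⟨Real.exp_pos _, hdx x hx t ht⟩⟩
  exact
  { cont := hpc
    diff_bdry := fun t ht => (hpx 0 le_rfl t ht).differentiableWithinAt
    cont_x_bdry := ((h.u_cont.neg.div_const ε).mul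
      (hpc.mono (prod_mono le_rfl Ioi_subset_Ici_self))).congr fun z hz => hdx z.1 hz.1 z.2 hz.2
    c21 := .of_hasDerivAt hpx' hpxx hpt ((h.u_c21.continuousOn.neg.div_const ε).mul hpc')
      (((h.u_c21.cont_x.neg.div_const ε).mul hpc').add ((h.u_c21.continuousOn.neg.div_const ε).mul
        ((h.u_c21.continuousOn.neg.div_const ε).mul hpc')))
      ((((continuousOn_const.mul h.u_c21.cont_x).sub
        ((h.u_c21.continuousOn.pow 2).div_const 2)).neg.div_const ε).mul hpc')
    heat := fun x hx t ht => by
      rw [IsC21.dxx_eq (fx := fun x t => -u x t / ε * p x t) (fun y hy => hpx' y hy t ht) hx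
        (hpxx x hx t ht), dt, (hpt x hx t ht).deriv]
      field_simp
      ring
    init := fun x hx => by simp only [hp, hΦ0 x (le_of_lt hx), colehopfInit, primitive]
    bdry := fun t ht => by
      rw [hdx 0 le_rfl t ht, h.u_bdry t ht]
      field_simp
      ring
    growth := fun T hT => by
      obtain ⟨M, hM0, hM⟩ := hbd T
      obtain ⟨B, hB0, hB⟩ := exists_potential_bound hu hΦc hΦ0 hΦr T
      obtain ⟨L, -, hL⟩ := exp_le_gaussian (M := Real.exp (B / ε)) (C := (B + M) / ε)
        (Real.exp_pos _).le (by positivity)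
      refine ⟨L, fun x hx t ht => le_trans ?_ (hL x hx)⟩
      rw [hp, abs_of_pos (Real.exp_pos _), ← Real.exp_add]
      refine Real.exp_le_exp.2 ?_
      rw [div_mul_eq_mul_div, ← add_div]
      gcongr
      exact (neg_le_abs _).trans (hB x hx t ht M hM0 fun h0 y hy => hM y hy.1.le t ⟨h0, ht.2⟩) }

/-- The velocity of a solution of the adhesion system is given by the Cole–Hopf formula. -/
theorem velocity_unique (hε : 0 < ε) (hu : HalfLineData u₀)
    (h : IsAdhesionSolution ε u₀ ρ₀ (fun _ => b) ρB u ρ) {p : ℝ → ℝ → ℝ}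
    (hp : IsRobinHeatSolution ε b (colehopfInit ε u₀) (fun _ => 0) p) :
    ∀ x ≥ 0, ∀ t > 0, u x t = velocity ε p x t := by
  obtain ⟨p', hp', hpx⟩ := h.exists_robin_of_velocity hε hu
  have he := IsRobinHeatSolution.eq hε hp' hp
  intro x hx t ht
  obtain ⟨h0, h1⟩ := hpx x hx t ht
  rw [velocity, ← he x hx t (le_of_lt ht),
    ← dx_congr (fun y hy => he y hy t (le_of_lt ht)) hx, h1]
  field_simp

/-- The potential `R` of the density satisfies `R_t + u R_x = (ε/2) R_xx`, so that `R p` solves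
the inhomogeneous Robin problem. -/
theorem exists_robin_of_density (hε : 0 < ε) (hu : HalfLineData u₀) (hρ : HalfLineData ρ₀)
    (h : IsAdhesionSolution ε u₀ ρ₀ (fun _ => b) ρB u ρ) {p : ℝ → ℝ → ℝ}
    (hp : IsRobinHeatSolution ε b (colehopfInit ε u₀) (fun _ => 0) p)
    (hpos : ∀ x ≥ 0, ∀ t > 0, 0 < p x t) :
    ∃ R : ℝ → ℝ → ℝ, (∀ x ≥ 0, ∀ t > 0, dx R x t = ρ x t) ∧
      IsRobinHeatSolution ε b (fun x => primitive ρ₀ x * colehopfInit ε u₀ x)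
        (fun t => ε * p 0 t * ρB t) fun x t => R x t * p x t := by
  have hup : ∀ x ≥ 0, ∀ t > 0, ε * dx p x t = -(u x t * p x t) := by
    intro x hx t ht
    have := (hpos x hx t ht).ne'
    rw [h.velocity_unique hε hu hp x hx t ht, velocity]
    field_simp
  have hρx := fun {x t : ℝ} (hx : 0 < x) (ht : 0 < t) => h.rho_c21.hasDerivAt_x hx ht
  have hN : ∀ x > 0, ∀ t > 0,
      HasDerivAt (fun y => -(ρ y t * u y t)) (-dx (fun y s => ρ y s * u y s) x t) x := by
    intro x hx t ht
    have h1 := (hρx hx ht).mul (h.u_c21.hasDerivAt_x hx ht)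
    rw [dx_eq (f := fun y s => ρ y s * u y s) hx h1]
    exact h1.neg
  have hbd : ∀ T : ℝ, ∃ M, 0 ≤ M ∧ ∀ x ≥ 0, ∀ t ∈ Ioc 0 T, |ρ x t| ≤ M * Real.exp (M * x ^ 2) :=
    fun T => by
      obtain ⟨M, hM⟩ := h.rho_growth (max T 1) (by positivity)
      refine ⟨|M|, abs_nonneg M, fun x hx t ht =>
        (hM x hx t ⟨ht.1, ht.2.trans (le_max_left _ _)⟩).trans ?_⟩
      have := le_abs_self M
      gcongr
  have hbρ : ∀ X T : ℝ, ∃ M, ∀ x ∈ Ioc 0 X, ∀ t ∈ Ioc 0 T, |ρ x t| ≤ M := fun X T => by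
    obtain ⟨M, hM0, hM⟩ := hbd T
    refine ⟨M * Real.exp (M * X ^ 2), fun x hx t ht => (hM x hx.1.le t ht).trans ?_⟩
    have := hx.1.le
    have := hx.2
    gcongr
  obtain ⟨R, hRc, hRx, hRt, hR0, hRr⟩ := exists_potential (ε := ε) (A₀ := ρ₀)
    (N := fun x t => -(ρ x t * u x t)) h.rho_c21 h.rho_cont
    ((h.rho_c21.continuousOn.mul h.u_c21.continuousOn).neg) hN
    (fun x hx t ht => by linarith [h.rho_eq x hx t ht]) hbρ
    (fun X T => by
      obtain ⟨M, hM⟩ := hbρ X T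
      obtain ⟨L, hL⟩ := h.u_bdd (max T 1) (by positivity)
      refine ⟨M * L, fun x hx t ht => ?_⟩
      have h1 := hM x hx t ht
      rw [abs_neg, abs_mul]
      exact mul_le_mul h1 (hL x hx.1.le t ⟨ht.1, ht.2.trans (le_max_left _ _)⟩) (abs_nonneg _)
        ((abs_nonneg _).trans h1))
    (by
      filter_upwards [hρ.ae_continuousAt] with x hx h0
      exact (h.rho_init x h0 (hx h0)).comp (tendsto_prodMk_quarter h0))
  have hsub : quarter ⊆ Ici 0 ×ˢ Ici 0 := prod_mono Ioi_subset_Ici_self Ioi_subset_Ici_self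
  have hRc' := hRc.mono hsub
  have hpc' := hp.cont.mono hsub
  have hpx : ∀ x ≥ 0, ∀ t > 0, HasDerivWithinAt (fun y => p y t) (dx p x t) (Ici 0) x := by
    intro x hx t ht
    rcases eq_or_lt_of_le hx with h0 | h0
    · rw [← h0]; exact hp.hasDerivWithinAt_bdry ht
    · exact (hp.c21.hasDerivAt_x h0 ht).hasDerivWithinAt
  set q : ℝ → ℝ → ℝ := fun x t => R x t * p x t with hq
  have hqx : ∀ x ≥ 0, ∀ t > 0, HasDerivWithinAt (fun y => q y t)
      (ρ x t * p x t + R x t * dx p x t) (Ici 0) x := fun x hx t ht =>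
    (hRx x hx t ht).mul (hpx x hx t ht)
  have hRx' : ∀ x > 0, ∀ t > 0, HasDerivAt (fun y => R y t) (ρ x t) x :=
    fun x hx t ht => (hRx x (le_of_lt hx) t ht).hasDerivAt (Ici_mem_nhds hx)
  have hqx' : ∀ x > 0, ∀ t > 0, HasDerivAt (fun y => q y t)
      (ρ x t * p x t + R x t * dx p x t) x := fun x hx t ht =>
    (hRx' x hx t ht).mul (hp.c21.hasDerivAt_x hx ht)
  have hqxx : ∀ x > 0, ∀ t > 0, HasDerivAt (fun y => ρ y t * p y t + R y t * dx p y t)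
      (dx ρ x t * p x t + ρ x t * dx p x t + (ρ x t * dx p x t + R x t * dx (dx p) x t)) x :=
    fun x hx t ht => ((hρx hx ht).mul (hp.c21.hasDerivAt_x hx ht)).add
      ((hRx' x hx t ht).mul (hp.c21.hasDerivAt_xx hx ht))
  have hqt : ∀ x > 0, ∀ t > 0, HasDerivAt (fun s => q x s)
      ((ε / 2 * dx ρ x t + -(ρ x t * u x t)) * p x t + R x t * dt p x t) t := fun x hx t ht =>
    (hRt x hx t ht).mul (hp.c21.hasDerivAt_t hx ht)
  have hdx : ∀ x ≥ 0, ∀ t > 0, dx q x t = ρ x t * p x t + R x t * dx p x t := fun x hx t ht =>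
    dx_eq_of_within hx (hqx x hx t ht)
  have hρc := h.rho_c21.continuousOn
  refine ⟨R, fun x hx t ht => dx_eq_of_within hx (hRx x hx t ht), ?_⟩
  exact
  { cont := hRc.mul hp.cont
    diff_bdry := fun t ht => (hqx 0 le_rfl t ht).differentiableWithinAt
    cont_x_bdry := ((h.rho_cont.mul hp.cont_pos).add
      ((hRc.mono (prod_mono le_rfl Ioi_subset_Ici_self)).mul hp.cont_x_bdry)).congr
        fun z hz => hdx z.1 hz.1 z.2 hz.2
    c21 := .of_hasDerivAt hqx' hqxx hqt
      ((hρc.mul hpc').add (hRc'.mul hp.c21.cont_x))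
      (((h.rho_c21.cont_x.mul hpc').add (hρc.mul hp.c21.cont_x)).add
        ((hρc.mul hp.c21.cont_x).add (hRc'.mul hp.c21.cont_xx)))
      ((((continuousOn_const.mul h.rho_c21.cont_x).add
        (hρc.mul h.u_c21.continuousOn).neg).mul hpc').add (hRc'.mul hp.c21.cont_t))
    heat := fun x hx t ht => by
      rw [IsC21.dxx_eq (fx := fun x t => ρ x t * p x t + R x t * dx p x t)
        (fun y hy => hqx' y hy t ht) hx (hqxx x hx t ht), dt, (hqt x hx t ht).deriv,
        hp.heat x hx t ht]
      linear_combination -ρ x t * hup x (le_of_lt hx) t ht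
    init := fun x hx => by
      simp only [hR0 x (le_of_lt hx), hp.init x hx, primitive]
    bdry := fun t ht => by
      rw [hdx 0 le_rfl t ht, h.rho_bdry t ht]
      linear_combination R 0 t * hp.bdry t ht
    growth := fun T hT => by
      obtain ⟨M, hM0, hM⟩ := hbd T
      obtain ⟨L, hL⟩ := hp.growth T hT
      obtain ⟨B, hB0, hB⟩ := exists_potential_bound hρ hRc hR0 hRr T
      refine ⟨(2 * B + M) * |L| + (1 + M + |L|), fun x hx t ht => ?_⟩
      have h1 : |R x t| ≤ (2 * B + M) * Real.exp ((1 + M) * x ^ 2) := by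
        refine (hB x hx t ht (M * Real.exp (M * x ^ 2)) (by positivity) fun h0 y hy => ?_).trans ?_
        · refine (hM y hy.1.le t ⟨h0, ht.2⟩).trans ?_
          have := hy.1.le
          have := hy.2
          gcongr
        · have h2 : x ≤ Real.exp (x ^ 2) := by
            have := Real.add_one_le_exp (x ^ 2)
            nlinarith [sq_nonneg (x - 1)]
          have h3 : 1 ≤ Real.exp (M * x ^ 2) := Real.one_le_exp (by positivity)
          have h4 : 1 ≤ Real.exp (x ^ 2) := Real.one_le_exp (by positivity)
          calc B + (B + M * Real.exp (M * x ^ 2)) * x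
              ≤ B * (Real.exp (x ^ 2) * Real.exp (M * x ^ 2))
                + (B * Real.exp (M * x ^ 2) + M * Real.exp (M * x ^ 2)) * Real.exp (x ^ 2) := by
                gcongr
                · exact le_mul_of_one_le_right hB0 (one_le_mul_of_one_le_of_one_le h4 h3)
                · exact le_mul_of_one_le_right hB0 h3
            _ = (2 * B + M) * (Real.exp (x ^ 2) * Real.exp (M * x ^ 2)) := by ring
            _ = _ := by rw [← Real.exp_add]; ring_nf
      have h2 : |p x t| ≤ |L| * Real.exp (|L| * x ^ 2) := (hL x hx t ht).trans (by
        have := le_abs_self L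
        gcongr)
      rw [abs_mul]
      calc |R x t| * |p x t| ≤ (2 * B + M) * Real.exp ((1 + M) * x ^ 2)
            * (|L| * Real.exp (|L| * x ^ 2)) := by gcongr
        _ = (2 * B + M) * |L| * Real.exp ((1 + M + |L|) * x ^ 2) := by
            rw [add_mul (1 + M) |L|, Real.exp_add]; ring
        _ ≤ _ := mul_exp_sq_le (by positivity) (by positivity) x }

/-- The density of a solution of the adhesion system is determined by the two heat problems. -/
theorem density_unique (hε : 0 < ε) (hu : HalfLineData u₀) (hρ : HalfLineData ρ₀)
    (h : IsAdhesionSolution ε u₀ ρ₀ (fun _ => b) ρB u ρ) {p q : ℝ → ℝ → ℝ}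
    (hp : IsRobinHeatSolution ε b (colehopfInit ε u₀) (fun _ => 0) p)
    (hpos : ∀ x ≥ 0, ∀ t > 0, 0 < p x t)
    (hq : IsRobinHeatSolution ε b (fun x => primitive ρ₀ x * colehopfInit ε u₀ x)
      (fun t => ε * p 0 t * ρB t) q) :
    ∀ x ≥ 0, ∀ t > 0, ρ x t = density p q x t := by
  obtain ⟨R, hRx, hR⟩ := h.exists_robin_of_density hε hu hρ hp hpos
  intro x hx t ht
  rw [← hRx x hx t ht]
  refine dx_congr (fun y hy => ?_) hx
  rw [← IsRobinHeatSolution.eq hε hR hq y hy t (le_of_lt ht)]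
  exact (mul_div_cancel_right₀ _ (hpos y hy t ht).ne').symm

end IsAdhesionSolution

end Adhesion


theorem theorem2p2 (ε : ℝ) (hε : 0 < ε) (u₀ ρ₀ ρB : ℝ → ℝ) (uB : ℝ)
    (hu₀ : BoundedVariationOn u₀ (Ioi 0)) (hρ₀ : BoundedVariationOn ρ₀ (Ioi 0))
    (hρB : ∃ K, LipschitzOnWith K ρB (Ioi 0)) :
    ∃ p q : ℝ → ℝ → ℝ,
      -- `p` is the unique classical solution of its heat problem
      Adhesion.IsRobinHeatSolution ε uB
        (fun x => Real.exp (-Adhesion.primitive u₀ x / ε)) (fun _ => 0) p ∧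
      (∀ p' : ℝ → ℝ → ℝ, Adhesion.IsRobinHeatSolution ε uB
          (fun x => Real.exp (-Adhesion.primitive u₀ x / ε)) (fun _ => 0) p' →
        ∀ x ≥ 0, ∀ t ≥ 0, p' x t = p x t) ∧
      -- `q` is the unique classical solution of its heat problem
      Adhesion.IsRobinHeatSolution ε uB
        (fun x => Adhesion.primitive ρ₀ x * Real.exp (-Adhesion.primitive u₀ x / ε))
        (fun t => ε * p 0 t * ρB t) q ∧
      (∀ q' : ℝ → ℝ → ℝ, Adhesion.IsRobinHeatSolution ε uB
          (fun x => Adhesion.primitive ρ₀ x * Real.exp (-Adhesion.primitive u₀ x / ε))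
          (fun t => ε * p 0 t * ρB t) q' →
        ∀ x ≥ 0, ∀ t ≥ 0, q' x t = q x t) ∧
      -- positivity and smoothness
      (∀ x ≥ 0, ∀ t ≥ 0, 0 < p x t) ∧
      Adhesion.IsSmooth p ∧ Adhesion.IsSmooth q ∧
      Adhesion.IsSmooth (Adhesion.velocity ε p) ∧ Adhesion.IsSmooth (Adhesion.density p q) ∧
      -- `u = -ε p_x / p`, `ρ = (q / p)_x` is the solution of the modified adhesion system
      Adhesion.IsAdhesionSolution ε u₀ ρ₀ (fun _ => uB) ρB
        (Adhesion.velocity ε p) (Adhesion.density p q) ∧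
      (∀ u ρ : ℝ → ℝ → ℝ, Adhesion.IsAdhesionSolution ε u₀ ρ₀ (fun _ => uB) ρB u ρ →
        ∀ x ≥ 0, ∀ t > 0,
          u x t = Adhesion.velocity ε p x t ∧ ρ x t = Adhesion.density p q x t) := by
  obtain ⟨p, q, hps, hqs, hp, hq, hpos, hsol⟩ := Adhesion.exists_adhesion hε
    (Adhesion.HalfLineData.of_boundedVariationOn hu₀)
    (Adhesion.HalfLineData.of_boundedVariationOn hρ₀) hρB uB
  have hpos' : ∀ x > 0, ∀ t > 0, 0 < p x t := fun x hx t ht => hpos x (le_of_lt hx) t (le_of_lt ht)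
  refine ⟨p, q, hp, fun p' hp' => Adhesion.IsRobinHeatSolution.eq hε hp' hp, hq,
    fun q' hq' => Adhesion.IsRobinHeatSolution.eq hε hq' hq, hpos, hps, hqs,
    Adhesion.isSmooth_velocity hps hpos', Adhesion.isSmooth_density hps hqs hpos', hsol,
    fun u ρ h x hx t ht => ⟨?_, ?_⟩⟩
  · exact h.velocity_unique hε (.of_boundedVariationOn hu₀) hp x hx t ht
  · exact h.density_unique hε (.of_boundedVariationOn hu₀) (.of_boundedVariationOn hρ₀) hp
      (fun x hx t ht => hpos x hx t (le_of_lt ht)) hq x hx t ht
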